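/- **Setting.** Let $\mathfrak g$ be a finite-dimensional complex simple Lie algebra with a Cartan subalgebra, a choice of simple roots $\alpha_1,\dots,\alpha_r$ and Cartan matrix $a_{ij}=(\alpha_i^\vee,\alpha_j)$, the invariant form being normalised so that shortest simple roots satisfy $(\alpha_i,\alpha_i)=2$; put $d_i=(\alpha_i,\alpha_i)/2$. Let $q\in\mathbb R\setminus\{-1,0,1\}$ and $q_i=q^{d_i}$. Let $U_q(\mathfrak g)$ be the Drinfeld--Jimbo algebra generated by $E_i,F_i,K_i^{\pm1}$ with $K_iE_j=q_i^{a_{ij}}E_jK_i$, $K_iF_j=q_i^{-a_{ij}}F_jK_i$, $K_iK_j=K_jK_i$, $E_iF_j-F_jE_i=\delta_{ij}(K_i-K_i^{-1})/(q_i-q_i^{-1})$ and the quantum Serre relations, with $\Delta(K_i)=K_i\otimes K_i$, $\Delta(E_i)=E_i\otimes K_i+1\otimes E_i$, $\Delta(F_i)=F_i\otimes1+K_i^{-1}\otimes F_i$, and compact real form $K_i^*=K_i$, $E_i^*=K_iF_i$, $F_i^*=E_iK_i^{-1}$. Let $A=\mathcal O_q(G)$ be the Hopf $*$-algebra spanned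 by the matrix coefficients of the finite-dimensional type $1$ representations of $U_q(\mathfrak g)$, with $\langle X,f^*\rangle=\overline{\langle S(X)^*,f\rangle}$. A *CMQGA* is a finitely generated Hopf $*$-algebra with a bi-invariant normalised functional (the Haar functional) $\mathbf h$ satisfying $\mathbf h(a^*a)>0$ for all $a\ne0$. **CQH-Hermitian spaces over $A$.** Such a space $\mathbf H$ consists of the following. 1. A surjective Hopf $*$-algebra map $\pi:A\to H$ between CMQGAs, where $A$ is a domain, and the algebra $B=A^{\mathrm{co}(H)}=\{a:(\mathrm{id}\otimes\pi)\Delta(a)=a\otimes1\}$ with the left $A$-coaction $\Delta|_B$; put $B^+=B\cap\ker\varepsilon$. 2. A differential $*$-calculus $(\Omega^\bullet,\mathrm d)$ over $B$, that is, a differential graded algebra with $\Omega^0=B$, generated by $B$ and $\mathrm dB$, with a conjugate linear involution extending that of $B$, commuting with $\mathrm d$, and with $(\omega\wedge\nu)^*=(-1)^{kl}\nu^*\wedge\omega^*$ for $\omega\in\Omega^k$, $\nu\in\Omega^l$. It is covariant (the coaction of $B$ extends to a comodule algebra structure on $\Omega^\bullet$ for which $\mathrm d$ is a comodule map), $\Omega^\bullet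 B^+\subseteq B^+\Omega^\bullet$, $\Omega^\bullet/B^+\Omega^\bullet$ is finite-dimensional, and $\Omega^\bullet$ has total degree $2n$, that is, $\Omega^{2n}\neq0$ and $\Omega^k=0$ for $k>2n$. 3. An isomorphism $\mathrm{vol}:\Omega^{2n}\to B$ of $B$-bimodules and left $A$-comodules, which is a $*$-map and satisfies $\mathbf h(\mathrm{vol}(\mathrm d\omega))=0$ for all $\omega\in\Omega^{2n-1}$. 4. A covariant complex structure: an $\mathbb N_0^2$-algebra grading $\Omega^{(\bullet,\bullet)}$ by $A$-subcomodules with $\Omega^k=\bigoplus_{a+b=k}\Omega^{(a,b)}$, $(\Omega^{(a,b)})^*=\Omega^{(b,a)}$ and $\mathrm d\,\Omega^{(a,b)}\subseteq\Omega^{(a+1,b)}\oplus\Omega^{(a,b+1)}$. The two components of $\mathrm d$ are denoted $\partial$ and $\overline\partial$. 5. A central, real, coinvariant form $\sigma\in\Omega^{(1,1)}$ such that $\sigma^{n-k}\wedge\cdot:\Omega^k\to\Omega^{2n-k}$ is bijective for $0\le k<n$. Let $*_\sigma$ be the Hodge map, determined by $$*_\sigma(\sigma^j\wedge\omega)=(-1)^{\frac{k(k+1)}2}\,i^{a-b}\,\frac{j!}{(n-j-k)!}\,\sigma^{n-j-k}\wedge\omega$$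 for $\omega\in\Omega^{(a,b)}$ with $k=a+b\le n$ and $\sigma^{n-k+1}\wedge\omega=0$, and $0\le j\le n-k$. It is required that $\mathrm{vol}=*_\sigma|_{\Omega^{2n}}$, and that the metric $g$, with $g(\omega,\nu)=*_\sigma(*_\sigma(\omega^*)\wedge\nu)$ for forms of the same degree and $g(\Omega^k,\Omega^l)=0$ for $k\ne l$, is positive definite: for every $\omega\neq0$, $g(\omega,\omega)$ is a nonzero element of $B$ of the form $\sum_i c_ib_i^*b_i$ with $c_i>0$ and $b_i\in B$. Put $\overline\partial^\dagger=-*_\sigma\circ\partial\circ*_\sigma$ and $\Delta_{\overline\partial}=(\overline\partial+\overline\partial^\dagger)^2$. A form is *harmonic* if $\Delta_{\overline\partial}$ annihilates it. $\mathbf H$ is *connected* if $\ker(\mathrm d|_B)=\mathbb C1$. It is *self-conjugate* if $V=V^*$ for every irreducible left $A$-subcomodule $V\subseteq B$. It is *of Gelfand type* if, for all $k$, every irreducible left $A$-comodule has multiplicity at most one in $\Omega^{(0,k)}$. The set $B_{\mathrm{hw}}$ of *highest weight vectors* consists of the nonzero $z\in B$ that are weight vectors with integral weight ($K_i\triangleright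 z=q_i^{\mu_i}z$ with $\mu_i\in\mathbb Z$) and satisfy $E_i\triangleright z=0$ for all $i$, for the action $X\triangleright b=\langle S(X),b_{(-1)}\rangle b_{(0)}$ of $U_q(\mathfrak g)$. **Proposition.** Let $\mathbf H$ be a connected, self-conjugate CQH-Hermitian space of Gelfand type over $\mathcal O_q(G)$, and let $z\in B_{\mathrm{hw}}$ be non-harmonic with real Leibniz constant $\lambda_z$; that is, $\lambda_z\in\mathbb R$ and $(\partial z)z=\lambda_z\,z\,\partial z$. Then: 1. $\lambda_z\notin[-1,0)$; 2. if $A_{z,\overline\partial z}\in\mathbb C$ satisfies $\partial z\wedge *_\sigma(\overline\partial z)=A_{z,\overline\partial z}\;z\;\partial\big(*_\sigma(\overline\partial z)\big)$ and $A_{z,\overline\partial z}\neq0$, then $\lambda_z>0$. -/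

import Mathlib

noncomputable section

namespace QG

open scoped TensorProduct
open MulOpposite

/-! ### Quantum integers and quantum binomial coefficients -/

/-- The symmetric quantum integer `[n]_t = t^(1-n) + t^(3-n) + ⋯ + t^(n-1)`. -/
def qInt (t : ℂ) (n : ℕ) : ℂ := ∑ k ∈ Finset.range n, t ^ (2 * (k : ℤ) - n + 1)

/-- The quantum factorial `[n]_t! = [1]_t [2]_t ⋯ [n]_t`. -/
def qFact (t : ℂ) (n : ℕ) : ℂ := ∏ k ∈ Finset.range n, qInt t (k + 1)

/-- The quantum binomial coefficient `[n]_t! / ([r]_t! [n-r]_t!)`, for `r ≤ n`. -/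
def qBinom (t : ℂ) (n r : ℕ) : ℂ := qFact t n / (qFact t r * qFact t (n - r))

/-- The element `∑_{r=0}^{m} (-1)^r [m choose r]_t X^(m-r) Z X^r` appearing in the quantum Serre
relations. -/
def qSerre {R : Type*} [Ring R] [Algebra ℂ R] (t : ℂ) (m : ℕ) (X Z : R) : R :=
  ∑ r ∈ Finset.range (m + 1), ((-1) ^ r * qBinom t m r) • (X ^ (m - r) * Z * X ^ r)

lemma qInt_mul {t : ℂ} (ht : t ≠ 0) (n : ℕ) :
    qInt t n * (t - t⁻¹) = t ^ (n : ℤ) - t ^ (-(n : ℤ)) := by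
  unfold qInt
  rw [Finset.sum_mul]
  have h : ∀ k ∈ Finset.range n, t ^ (2 * (k : ℤ) - n + 1) * (t - t⁻¹)
      = t ^ (2 * ((k + 1 : ℕ) : ℤ) - n) - t ^ (2 * (k : ℤ) - n) := by
    intro k _
    have e1 : (2 * ((k + 1 : ℕ) : ℤ) - n) = (2 * (k : ℤ) - n + 1) + 1 := by push_cast; ring
    have e2 : (2 * (k : ℤ) - n) = (2 * (k : ℤ) - n + 1) - 1 := by ring
    rw [e1]
    generalize 2 * (k : ℤ) - n + 1 = e at *
    rw [e2, zpow_add_one₀ ht, zpow_sub_one₀ ht]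
    ring
  rw [Finset.sum_congr rfl h, Finset.sum_range_sub (fun k : ℕ => t ^ (2 * (k : ℤ) - n))]
  congr 2 <;> (push_cast; ring)

/-- `t` is a real number different from `0, 1, -1`, regarded as a complex number. -/
def Generic (t : ℂ) : Prop := ∃ s : ℝ, t = s ∧ s ≠ 0 ∧ s ≠ 1 ∧ s ≠ -1

lemma Generic.ne_zero {t : ℂ} (h : Generic t) : t ≠ 0 := by
  obtain ⟨s, rfl, h0, -, -⟩ := h; exact_mod_cast h0

lemma Generic.inv {t : ℂ} (h : Generic t) : Generic t⁻¹ := by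
  obtain ⟨s, rfl, h0, h1, h2⟩ := h
  refine ⟨s⁻¹, by push_cast; rfl, inv_ne_zero h0, by simpa using h1, ?_⟩
  intro h; apply h2; rw [← inv_inv s, h]; norm_num

lemma Generic.pow_ne_one {t : ℂ} (h : Generic t) {n : ℕ} (hn : n ≠ 0) : t ^ n ≠ 1 := by
  obtain ⟨s, rfl, h0, h1, h2⟩ := h
  intro h
  have h3 : s ^ n = 1 := by exact_mod_cast h
  have h4 : |s| ^ n = 1 := by rw [← abs_pow, h3, abs_one]
  rw [pow_eq_one_iff_of_nonneg (abs_nonneg s) hn] at h4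
  rcases abs_eq (zero_le_one) |>.1 h4 with h | h
  · exact h1 h
  · exact h2 h

lemma Generic.pow {t : ℂ} (h : Generic t) {n : ℕ} (hn : n ≠ 0) : Generic (t ^ n) := by
  have h' := h
  obtain ⟨s, rfl, h0, h1, h2⟩ := h
  refine ⟨s ^ n, by push_cast; rfl, pow_ne_zero _ h0, ?_, ?_⟩
  · intro h; apply h'.pow_ne_one hn; exact_mod_cast h
  · intro h
    apply h'.pow_ne_one (n := n * 2) (by omega)
    rw [pow_mul]
    have : (s ^ n) ^ 2 = 1 := by rw [h]; norm_num
    exact_mod_cast this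

lemma Generic.qInt_ne_zero {t : ℂ} (h : Generic t) {n : ℕ} (hn : n ≠ 0) : qInt t n ≠ 0 := by
  intro h0
  have h1 := qInt_mul h.ne_zero n
  rw [h0, zero_mul, eq_comm, sub_eq_zero, zpow_neg, zpow_natCast] at h1
  apply h.pow_ne_one (n := n * 2) (by omega)
  have := pow_ne_zero n h.ne_zero
  rw [pow_mul, sq]
  nth_rewrite 1 [h1]
  exact inv_mul_cancel₀ this

lemma Generic.qFact_ne_zero {t : ℂ} (h : Generic t) (n : ℕ) : qFact t n ≠ 0 :=
  Finset.prod_ne_zero_iff.2 fun k _ => h.qInt_ne_zero (Nat.succ_ne_zero k)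

lemma qInt_inv (t : ℂ) (n : ℕ) : qInt t⁻¹ n = qInt t n := by
  unfold qInt
  rw [← Finset.sum_range_reflect]
  refine Finset.sum_congr rfl fun k hk => ?_
  rw [inv_zpow', Finset.mem_range] at *
  congr 1
  omega

lemma qBinom_inv (t : ℂ) (n r : ℕ) : qBinom t⁻¹ n r = qBinom t n r := by
  simp [qBinom, qFact, qInt_inv]

lemma qSerre_inv {R : Type*} [Ring R] [Algebra ℂ R] (t : ℂ) (m : ℕ) (X Z : R) :
    qSerre t⁻¹ m X Z = qSerre t m X Z := by
  simp [qSerre, qBinom_inv]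

lemma qBinom_zero {t : ℂ} (h : Generic t) (n : ℕ) : qBinom t n 0 = 1 := by
  have h1 : qFact t 0 = 1 := by simp [qFact]
  simp only [qBinom, Nat.sub_zero, h1, one_mul]
  exact div_self (h.qFact_ne_zero n)

lemma qBinom_self {t : ℂ} (h : Generic t) (n : ℕ) : qBinom t n n = 1 := by
  have h1 : qFact t 0 = 1 := by simp [qFact]
  simp only [qBinom, Nat.sub_self, h1, mul_one]
  exact div_self (h.qFact_ne_zero n)

lemma qInt_add {t : ℂ} (h : Generic t) (a b : ℕ) :
    qInt t (a + b) = t ^ (-(b : ℤ)) * qInt t a + t ^ (a : ℤ) * qInt t b := by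
  have ht := h.ne_zero
  have hd : t - t⁻¹ ≠ 0 := by
    intro h0
    apply h.pow_ne_one (n := 2) (by norm_num)
    field_simp at h0
    linear_combination h0
  apply mul_right_cancel₀ hd
  rw [add_mul, mul_assoc, mul_assoc, qInt_mul ht, qInt_mul ht, qInt_mul ht, mul_sub, mul_sub,
    ← zpow_add₀ ht, ← zpow_add₀ ht, ← zpow_add₀ ht, ← zpow_add₀ ht]
  push_cast
  rw [show (-((a : ℤ) + b)) = -b + -a by ring, show (-(b : ℤ) + a) = a + -b by ring]
  ring

/-- Pascal rule. -/
lemma qBinom_succ {t : ℂ} (h : Generic t) {n r : ℕ} (hr : r < n) :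
    qBinom t (n + 1) (r + 1) =
      t ^ (-((r : ℤ) + 1)) * qBinom t n (r + 1) + t ^ ((n : ℤ) - r) * qBinom t n r := by
  obtain ⟨a, rfl⟩ : ∃ a, n = r + 1 + a := ⟨n - (r + 1), by omega⟩
  have f : ∀ k, qFact t (k + 1) = qFact t k * qInt t (k + 1) := fun k => by
    simp [qFact, Finset.prod_range_succ]
  unfold qBinom
  rw [show r + 1 + a + 1 - (r + 1) = a + 1 by omega, show r + 1 + a - (r + 1) = a by omega,
    show r + 1 + a - r = a + 1 by omega, f (r + 1 + a), f r, f a]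
  have h1 := h.qFact_ne_zero r
  have h2 := h.qFact_ne_zero a
  have h3 := h.qInt_ne_zero (n := r + 1) (by omega)
  have h4 := h.qInt_ne_zero (n := a + 1) (by omega)
  have key := qInt_add h (a + 1) (r + 1)
  rw [show a + 1 + (r + 1) = r + 1 + a + 1 by omega] at key
  rw [key]
  push_cast
  rw [show ((r : ℤ) + 1 + a) - r = a + 1 by ring]
  field_simp

/-- Iterated twisted commutators `T_{k+1} = X T_k - c u^{2k} T_k X`, starting from `T_0 = Z`. -/
def iter {R : Type*} [Ring R] [Algebra ℂ R] (c u : ℂ) (X Z : R) : ℕ → R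
  | 0 => Z
  | k + 1 => X * iter c u X Z k - (c * u ^ (2 * k)) • (iter c u X Z k * X)

lemma iter_eq {R : Type*} [Ring R] [Algebra ℂ R] {u : ℂ} (h : Generic u) (c : ℂ) (X Z : R)
    (k : ℕ) : iter c u X Z k = ∑ r ∈ Finset.range (k + 1),
      ((-c) ^ r * u ^ ((r : ℤ) * (k - 1)) * qBinom u k r) • (X ^ (k - r) * Z * X ^ r) := by
  have hu := h.ne_zero
  induction k with
  | zero => simp [iter, qBinom_zero h]
  | succ k ih =>
    have hsum : ∀ F G H : ℕ → R, H 0 = F 0 → H (k + 1) = - G k →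
        (∀ r < k, H (r + 1) = F (r + 1) - G r) →
        ∑ r ∈ Finset.range (k + 1), F r - ∑ r ∈ Finset.range (k + 1), G r =
          ∑ r ∈ Finset.range (k + 1 + 1), H r := by
      intro F G H h0 h1 h2
      rw [Finset.sum_range_succ' F, Finset.sum_range_succ G, Finset.sum_range_succ' H,
        Finset.sum_range_succ, h0, h1, Finset.sum_congr rfl
          (fun r hr => h2 r (Finset.mem_range.1 hr)), Finset.sum_sub_distrib]
      abel
    rw [iter, ih, Finset.mul_sum, Finset.sum_mul, Finset.smul_sum]
    apply hsum
    · simp only [pow_zero, Nat.cast_zero, zero_mul, zpow_zero, mul_one, qBinom_zero h,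
        one_smul, Nat.sub_zero, pow_succ', mul_assoc]
    · rw [qBinom_self h, qBinom_self h, smul_mul_assoc, smul_smul, ← neg_smul]
      simp only [Nat.sub_self, pow_zero, one_mul, mul_assoc, ← pow_succ, mul_one]
      congr 1
      have z : u ^ (((k + 1 : ℕ) : ℤ) * ((k + 1 : ℕ) - 1)) =
          u ^ (2 * k) * u ^ ((k : ℤ) * (k - 1)) := by
        rw [← zpow_natCast u (2 * k), ← zpow_add₀ hu]
        congr 1; push_cast; ring
      rw [z, pow_succ]
      ring
    · intro r hr
      rw [qBinom_succ h hr, mul_smul_comm, smul_mul_assoc, smul_smul]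
      have x1 : X * (X ^ (k - (r + 1)) * Z * X ^ (r + 1)) = X ^ (k - r) * Z * X ^ (r + 1) := by
        rw [← mul_assoc, ← mul_assoc, ← pow_succ']
        congr 3; omega
      have x2 : X ^ (k - r) * Z * X ^ r * X = X ^ (k - r) * Z * X ^ (r + 1) := by
        rw [mul_assoc, ← pow_succ]
      rw [x1, x2, show k + 1 - (r + 1) = k - r by omega, ← sub_smul]
      congr 1
      have z1 : u ^ (((r + 1 : ℕ) : ℤ) * ((k + 1 : ℕ) - 1)) * u ^ ((k : ℤ) - r) =
          u ^ (2 * k) * u ^ ((r : ℤ) * (k - 1)) := by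
        rw [← zpow_natCast u (2 * k), ← zpow_add₀ hu, ← zpow_add₀ hu]
        congr 1; push_cast; ring
      have z2 : u ^ (((r + 1 : ℕ) : ℤ) * ((k + 1 : ℕ) - 1)) * u ^ (-((r : ℤ) + 1)) =
          u ^ (((r + 1 : ℕ) : ℤ) * (k - 1)) := by
        rw [← zpow_add₀ hu]
        congr 1; push_cast; ring
      rw [← z2]
      rw [pow_succ]
      linear_combination ((-c) ^ r * (-c) * qBinom u k r) * z1

/-- The quantum Serre element as an iterated twisted commutator. -/
lemma qSerre_eq_iter {R : Type*} [Ring R] [Algebra ℂ R] {u : ℂ} (h : Generic u) (X Z : R)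
    (m : ℕ) : qSerre u m X Z = iter (u ^ (1 - (m : ℤ))) u X Z m := by
  rw [iter_eq h, qSerre]
  refine Finset.sum_congr rfl fun r _ => ?_
  congr 2
  rw [neg_eq_neg_one_mul (u ^ (1 - (m : ℤ))), mul_pow, mul_assoc, ← zpow_natCast (u ^ (1 - (m : ℤ))), ← zpow_mul,
    ← zpow_add₀ h.ne_zero]
  rw [show (1 - (m : ℤ)) * r + r * (m - 1) = 0 by ring, zpow_zero, mul_one]

lemma iter_add_left {R : Type*} [Ring R] [Algebra ℂ R] {c u : ℂ} {x y v : R}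
    (hv : y * v = c • (v * y)) (hx : y * x = u ^ 2 • (x * y)) (k : ℕ) :
    iter c u (x + y) v k = iter c u x v k ∧
      y * iter c u x v k = (c * u ^ (2 * k)) • (iter c u x v k * y) := by
  induction k with
  | zero => simpa [iter] using hv
  | succ k ih =>
    obtain ⟨h1, h2⟩ := ih
    constructor
    · rw [iter, iter, h1, add_mul, h2, mul_add, smul_add]; abel
    · rw [iter]
      generalize iter c u x v k = T at h2 ⊢
      have e1 : y * (x * T) = (u ^ 2 * (c * u ^ (2 * k))) • (x * T * y) := by
        rw [← mul_assoc, hx, smul_mul_assoc, mul_assoc, h2, mul_smul_comm, smul_smul, mul_assoc]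
      have e2 : y * (T * x) = (u ^ 2 * (c * u ^ (2 * k))) • (T * x * y) := by
        rw [← mul_assoc, h2, smul_mul_assoc, mul_assoc, hx, mul_smul_comm, smul_smul,
          mul_comm (u ^ 2), ← mul_assoc T]
      rw [mul_sub, mul_smul_comm, e1, e2, sub_mul, smul_sub, smul_mul_assoc,
        smul_comm (c * u ^ (2 * k)) (u ^ 2 * (c * u ^ (2 * k))),
        show c * u ^ (2 * (k + 1)) = u ^ 2 * (c * u ^ (2 * k)) by ring]

lemma iter_add_right {R : Type*} [Ring R] [Algebra ℂ R] (c u : ℂ) (x v w : R) (k : ℕ) :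
    iter c u x (v + w) k = iter c u x v k + iter c u x w k := by
  induction k with
  | zero => rfl
  | succ k ih => simp only [iter, ih, mul_add, add_mul, smul_add]; abel

/-- Vanishing of the quantum Serre element for a sum of quantum commuting elements. -/
lemma qSerre_add {R : Type*} [Ring R] [Algebra ℂ R] {t : ℂ} (h : Generic t) {m : ℕ}
    {x y v w : R}
    (hyx : y * x = t ^ 2 • (x * y)) (hyv : y * v = t ^ (1 - (m : ℤ)) • (v * y))
    (hwx : w * x = t ^ (1 - (m : ℤ)) • (x * w))
    (hv : qSerre t m x v = 0) (hw : qSerre t m y w = 0) :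
    qSerre t m (x + y) (v + w) = 0 := by
  have ht := h.ne_zero
  rw [qSerre_eq_iter h, iter_add_right, (iter_add_left hyv hyx m).1, ← qSerre_eq_iter h, hv,
    zero_add]
  have e : ∀ X Z : R, iter (t ^ (1 - (m : ℤ))) t X Z m = qSerre t⁻¹ m X Z := fun X Z => by
    rw [qSerre_inv, qSerre_eq_iter h]
  rw [e, qSerre_eq_iter h.inv, add_comm, (iter_add_left _ _ m).1, ← qSerre_eq_iter h.inv,
    qSerre_inv, hw]
  · rw [hwx, smul_smul, inv_zpow', ← zpow_add₀ ht]; simp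
  · rw [hyx, smul_smul, ← mul_pow, inv_mul_cancel₀ ht]; simp

lemma qSerre_map {R R' : Type*} [Ring R] [Algebra ℂ R] [Ring R'] [Algebra ℂ R'] (t : ℂ) (m : ℕ)
    (f : R →ₐ[ℂ] R') (X Z : R) : f (qSerre t m X Z) = qSerre t m (f X) (f Z) := by
  simp [qSerre]

lemma qBinom_symm (t : ℂ) {n r : ℕ} (h : r ≤ n) : qBinom t n (n - r) = qBinom t n r := by
  unfold qBinom
  rw [Nat.sub_sub_self h, mul_comm]

/-- Reversing all products in the quantum Serre element only changes its sign. -/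
lemma qSerre_op {R : Type*} [Ring R] [Algebra ℂ R] (t : ℂ) (m : ℕ) (X Z : R) :
    qSerre t m (op X) (op Z) = (-1 : ℂ) ^ m • op (qSerre t m X Z) := by
  unfold qSerre
  rw [← Finset.sum_range_reflect, ← opAddEquiv_apply, map_sum, Finset.smul_sum]
  refine Finset.sum_congr rfl fun r hr => ?_
  have hr' : r ≤ m := by rw [Finset.mem_range] at hr; omega
  rw [show m + 1 - 1 - r = m - r by omega, Nat.sub_sub_self hr', qBinom_symm t hr',
    opAddEquiv_apply, op_smul, smul_smul, op_mul, op_mul, op_pow, op_pow, mul_assoc]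
  congr 1
  obtain ⟨a, rfl⟩ := Nat.exists_eq_add_of_le hr'
  rw [show r + a - r = a by omega, pow_add]
  have : ((-1 : ℂ) ^ r) * (-1) ^ r = 1 := by rw [← mul_pow]; norm_num
  linear_combination (-(-1 : ℂ) ^ a * qBinom t (r + a) r) * this

/-! ### Drinfeld--Jimbo quantised enveloping algebras -/

/-- The data defining a quantised enveloping algebra: the Cartan matrix `a i j = (α_i^∨, α_j)`, the
half square lengths `d i = (α_i, α_i)/2` of the simple roots, and the deformation parameter `q`. -/
structure QuantumDatum (ι : Type*) where
  a : ι → ι → ℤ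
  d : ι → ℕ
  a_diag : ∀ i, a i i = 2
  a_offDiag : ∀ i j, i ≠ j → a i j ≤ 0
  d_pos : ∀ i, 0 < d i
  symm : ∀ i j, (d i : ℤ) * a i j = d j * a j i
  q : ℝ
  q_ne_zero : q ≠ 0
  q_ne_one : q ≠ 1
  q_ne_neg_one : q ≠ -1

/-- The generators `E_i, F_i, K_i, K_i⁻¹`. -/
inductive Gen (ι : Type*)
  | E (i : ι)
  | F (i : ι)
  | K (i : ι)
  | Kinv (i : ι)

variable {ι : Type*}

namespace QuantumDatum

variable (D : QuantumDatum ι)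

/-- `q_i = q^{d_i}`. -/
def qi (i : ι) : ℂ := (D.q : ℂ) ^ D.d i

lemma generic (i : ι) : Generic (D.qi i) :=
  Generic.pow ⟨D.q, rfl, D.q_ne_zero, D.q_ne_one, D.q_ne_neg_one⟩ (D.d_pos i).ne'

lemma qi_ne_zero (i : ι) : D.qi i ≠ 0 := (D.generic i).ne_zero

lemma qi_conj (i : ι) : (starRingEnd ℂ) (D.qi i) = D.qi i := by simp [qi]

lemma qi_symm (i j : ι) : D.qi i ^ D.a i j = D.qi j ^ D.a j i := by
  unfold qi
  rw [← zpow_natCast, ← zpow_natCast, ← zpow_mul, ← zpow_mul, D.symm]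

/-- A family of elements `E_i, F_i, K_i, K_i⁻¹` of an algebra satisfies the defining relations of
`U_q(𝔤)`. -/
structure Relations {R : Type*} [Ring R] [Algebra ℂ R] (E F K Kinv : ι → R) : Prop where
  K_mul_Kinv : ∀ i, K i * Kinv i = 1
  Kinv_mul_K : ∀ i, Kinv i * K i = 1
  K_mul_K : ∀ i j, K i * K j = K j * K i
  K_mul_E : ∀ i j, K i * E j = D.qi i ^ D.a i j • (E j * K i)
  K_mul_F : ∀ i j, K i * F j = D.qi i ^ (-D.a i j) • (F j * K i)
  E_mul_F_same : ∀ i, E i * F i - F i * E i = (D.qi i - (D.qi i)⁻¹)⁻¹ • (K i - Kinv i)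
  E_mul_F_ne : ∀ i j, i ≠ j → E i * F j - F j * E i = 0
  serre_E : ∀ i j, i ≠ j → qSerre (D.qi i) (1 - D.a i j).toNat (E i) (E j) = 0
  serre_F : ∀ i j, i ≠ j → qSerre (D.qi i) (1 - D.a i j).toNat (F i) (F j) = 0

/-- The free algebra on the generators. -/
abbrev Free (ι : Type*) := FreeAlgebra ℂ (Gen ι)

/-- The generators in the free algebra. -/
abbrev fr (g : Gen ι) : Free ι := FreeAlgebra.ι ℂ g

open Gen in
/-- The defining relations of `U_q(𝔤)`. -/
inductive Rel : Free ι → Free ι → Prop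
  | K_mul_Kinv (i) : Rel (fr (K i) * fr (Kinv i)) 1
  | Kinv_mul_K (i) : Rel (fr (Kinv i) * fr (K i)) 1
  | K_mul_K (i j) : Rel (fr (K i) * fr (K j)) (fr (K j) * fr (K i))
  | K_mul_E (i j) : Rel (fr (K i) * fr (E j)) (D.qi i ^ D.a i j • (fr (E j) * fr (K i)))
  | K_mul_F (i j) : Rel (fr (K i) * fr (F j)) (D.qi i ^ (-D.a i j) • (fr (F j) * fr (K i)))
  | E_mul_F_same (i) : Rel (fr (E i) * fr (F i) - fr (F i) * fr (E i))
      ((D.qi i - (D.qi i)⁻¹)⁻¹ • (fr (K i) - fr (Kinv i)))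
  | E_mul_F_ne (i j) (h : i ≠ j) : Rel (fr (E i) * fr (F j) - fr (F j) * fr (E i)) 0
  | serre_E (i j) (h : i ≠ j) :
      Rel (qSerre (D.qi i) (1 - D.a i j).toNat (fr (E i)) (fr (E j))) 0
  | serre_F (i j) (h : i ≠ j) :
      Rel (qSerre (D.qi i) (1 - D.a i j).toNat (fr (F i)) (fr (F j))) 0

end QuantumDatum

variable (D : QuantumDatum ι)

/-- The quantised enveloping algebra `U_q(𝔤)`. -/
def Uq : Type _ := RingQuot D.Rel

instance : Ring (Uq D) := inferInstanceAs (Ring (RingQuot D.Rel))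
instance : Algebra ℂ (Uq D) := inferInstanceAs (Algebra ℂ (RingQuot D.Rel))

namespace Uq

/-- The image of a generator in `U_q(𝔤)`. -/
def of (g : Gen ι) : Uq D := RingQuot.mkAlgHom ℂ D.Rel (FreeAlgebra.ι ℂ g)

/-- The generator `E_i`. -/
def E (i : ι) : Uq D := of D (.E i)
/-- The generator `F_i`. -/
def F (i : ι) : Uq D := of D (.F i)
/-- The generator `K_i`. -/
def K (i : ι) : Uq D := of D (.K i)
/-- The generator `K_i⁻¹`. -/
def Kinv (i : ι) : Uq D := of D (.Kinv i)

lemma relations : D.Relations (E D) (F D) (K D) (Kinv D) := by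
  have h : ∀ {x y}, D.Rel x y → RingQuot.mkAlgHom ℂ D.Rel x = RingQuot.mkAlgHom ℂ D.Rel y :=
    fun w => RingQuot.mkAlgHom_rel ℂ w
  constructor
  · intro i; have := h (.K_mul_Kinv i); rwa [map_mul, map_one] at this
  · intro i; have := h (.Kinv_mul_K i); rwa [map_mul, map_one] at this
  · intro i j; have := h (.K_mul_K i j); rwa [map_mul, map_mul] at this
  · intro i j; have := h (.K_mul_E i j); rwa [map_mul, map_smul, map_mul] at this
  · intro i j; have := h (.K_mul_F i j); rwa [map_mul, map_smul, map_mul] at this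
  · intro i; have := h (.E_mul_F_same i)
    rwa [map_sub, map_mul, map_mul, map_smul, map_sub] at this
  · intro i j hij; have := h (.E_mul_F_ne i j hij)
    rwa [map_sub, map_mul, map_mul, map_zero] at this
  · intro i j hij; have := h (.serre_E i j hij); rwa [qSerre_map, map_zero] at this
  · intro i j hij; have := h (.serre_F i j hij); rwa [qSerre_map, map_zero] at this

variable {D} {R : Type*} [Ring R] [Algebra ℂ R]

/-- The values on generators given by four families. -/
def genVal (E F K Kinv : ι → R) : Gen ι → R
  | .E i => E i
  | .F i => F i
  | .K i => K i
  | .Kinv i => Kinv i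

/-- The universal property of `U_q(𝔤)`. -/
def lift {E F K Kinv : ι → R} (h : D.Relations E F K Kinv) : Uq D →ₐ[ℂ] R :=
  RingQuot.liftAlgHom ℂ ⟨FreeAlgebra.lift ℂ (genVal E F K Kinv), by
    intro x y hxy
    cases hxy with
    | K_mul_Kinv i => simpa [genVal] using h.K_mul_Kinv i
    | Kinv_mul_K i => simpa [genVal] using h.Kinv_mul_K i
    | K_mul_K i j => simpa [genVal] using h.K_mul_K i j
    | K_mul_E i j => simpa [genVal] using h.K_mul_E i j
    | K_mul_F i j => simpa [genVal] using h.K_mul_F i j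
    | E_mul_F_same i => simpa [genVal] using h.E_mul_F_same i
    | E_mul_F_ne i j hij => simpa [genVal] using h.E_mul_F_ne i j hij
    | serre_E i j hij => simpa [genVal, qSerre_map] using h.serre_E i j hij
    | serre_F i j hij => simpa [genVal, qSerre_map] using h.serre_F i j hij⟩

section lift
variable {E' F' K' Kinv' : ι → R} (h : D.Relations E' F' K' Kinv')

lemma lift_of (g : Gen ι) : lift h (of D g) = genVal E' F' K' Kinv' g := by
  unfold lift of
  erw [RingQuot.liftAlgHom_mkAlgHom_apply]
  simp

@[simp] lemma lift_E (i : ι) : lift h (E D i) = E' i := lift_of h _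
@[simp] lemma lift_F (i : ι) : lift h (F D i) = F' i := lift_of h _
@[simp] lemma lift_K (i : ι) : lift h (K D i) = K' i := lift_of h _
@[simp] lemma lift_Kinv (i : ι) : lift h (Kinv D i) = Kinv' i := lift_of h _

end lift

lemma hom_ext {f g : Uq D →ₐ[ℂ] R} (hE : ∀ i, f (E D i) = g (E D i))
    (hF : ∀ i, f (F D i) = g (F D i)) (hK : ∀ i, f (K D i) = g (K D i))
    (hKinv : ∀ i, f (Kinv D i) = g (Kinv D i)) : f = g := by
  apply RingQuot.ringQuot_ext'
  apply FreeAlgebra.hom_ext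
  funext x
  cases x with
  | E i => exact hE i
  | F i => exact hF i
  | K i => exact hK i
  | Kinv i => exact hKinv i

/-- Induction principle: a subalgebra containing the generators is everything. -/
lemma mem_of_generators (S : Subalgebra ℂ (Uq D)) (hE : ∀ i, E D i ∈ S) (hF : ∀ i, F D i ∈ S)
    (hK : ∀ i, K D i ∈ S) (hKinv : ∀ i, Kinv D i ∈ S) (X : Uq D) : X ∈ S := by
  have hr := relations D
  have h : D.Relations (R := S) (fun i => ⟨E D i, hE i⟩) (fun i => ⟨F D i, hF i⟩)
      (fun i => ⟨K D i, hK i⟩) (fun i => ⟨Kinv D i, hKinv i⟩) := by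
    constructor
    · intro i; exact Subtype.ext (hr.K_mul_Kinv i)
    · intro i; exact Subtype.ext (hr.Kinv_mul_K i)
    · intro i j; exact Subtype.ext (hr.K_mul_K i j)
    · intro i j; exact Subtype.ext (hr.K_mul_E i j)
    · intro i j; exact Subtype.ext (hr.K_mul_F i j)
    · intro i; exact Subtype.ext (hr.E_mul_F_same i)
    · intro i j hij; exact Subtype.ext (hr.E_mul_F_ne i j hij)
    · intro i j hij
      apply Subtype.ext
      exact (qSerre_map (D.qi i) _ S.val _ _).trans (hr.serre_E i j hij)
    · intro i j hij
      apply Subtype.ext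
      exact (qSerre_map (D.qi i) _ S.val _ _).trans (hr.serre_F i j hij)
  have key : S.val.comp (lift h) = AlgHom.id ℂ (Uq D) := by
    apply hom_ext <;> intro i <;> simp
  have : X = S.val (lift h X) := (DFunLike.congr_fun key X).symm
  rw [this]
  exact (lift h X).2

end Uq
lemma iter_twist {R : Type*} [Ring R] [Algebra ℂ R] {c t s p : ℂ} {X Z u w : R}
    (huX : u * X = s • (X * u)) (huZ : u * Z = p • (Z * u)) (hwX : w * X = p • (X * w))
    (huw : u * w = w * u) (k : ℕ) :
    ∃ α : ℂ, iter c t (X * u) (Z * w) k = α • (iter c t X Z k * u ^ k * w) := by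
  have hpow : ∀ k : ℕ, u ^ k * X = s ^ k • (X * u ^ k) := by
    intro k
    induction k with
    | zero => simp
    | succ k ih =>
      rw [pow_succ', mul_assoc, ih, mul_smul_comm, ← mul_assoc, huX, smul_mul_assoc, smul_smul,
        mul_assoc, pow_succ]
  have hT : ∀ k : ℕ, u * iter c t X Z k = (s ^ k * p) • (iter c t X Z k * u) := by
    intro k
    induction k with
    | zero => simpa [iter] using huZ
    | succ k ih =>
      simp only [iter]
      generalize iter c t X Z k = T at ih ⊢
      have e1 : u * (X * T) = (s ^ (k + 1) * p) • (X * T * u) := by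
        rw [← mul_assoc, huX, smul_mul_assoc, mul_assoc, ih, mul_smul_comm, smul_smul, mul_assoc]
        congr 1; ring
      have e2 : u * (T * X) = (s ^ (k + 1) * p) • (T * X * u) := by
        rw [← mul_assoc, ih, smul_mul_assoc, mul_assoc, huX, mul_smul_comm, smul_smul,
          ← mul_assoc]
        congr 1; ring
      rw [mul_sub, mul_smul_comm, e1, e2, sub_mul, smul_sub, smul_mul_assoc, smul_comm]
  have huwk : ∀ k : ℕ, u ^ k * w = w * u ^ k := fun k => (Commute.pow_left huw k)
  induction k with
  | zero => exact ⟨1, by simp [iter]⟩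
  | succ k ih =>
    obtain ⟨α, h⟩ := ih
    refine ⟨α * (s ^ k * p), ?_⟩
    have h2 := hT k
    rw [iter, h, iter]
    generalize iter c t X Z k = T at h2 ⊢
    have e1 : X * u * (α • (T * u ^ k * w)) = (α * (s ^ k * p)) • (X * T * u ^ (k + 1) * w) := by
      rw [mul_smul_comm, mul_assoc T, ← mul_assoc (X * u), mul_assoc X, h2]
      simp only [mul_smul_comm, smul_mul_assoc, smul_smul, pow_succ', mul_assoc]
    have e2 : α • (T * u ^ k * w) * (X * u) = (α * (s ^ k * p)) • (T * X * u ^ (k + 1) * w) := by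
      have : u ^ k * w * (X * u) = (s ^ k * p) • (X * u ^ (k + 1) * w) := by
        rw [show u ^ k * w * (X * u) = u ^ k * (w * X) * u by simp only [mul_assoc], hwX,
          mul_smul_comm, smul_mul_assoc, ← mul_assoc, hpow, smul_mul_assoc, smul_mul_assoc,
          smul_smul, mul_comm p, mul_assoc (X * u ^ k), ← huw, pow_succ]
        simp only [mul_assoc]
      rw [smul_mul_assoc, mul_assoc T, mul_assoc T, this, mul_smul_comm, smul_smul]
      simp only [mul_assoc]
    rw [e1, e2, smul_smul, mul_comm (c * t ^ (2 * k)), ← smul_smul _ (c * t ^ (2 * k)), ← smul_sub,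
      sub_mul, sub_mul, smul_mul_assoc, smul_mul_assoc]

/-- Vanishing of the quantum Serre element is preserved by twisting with quantum commuting
elements. -/
lemma qSerre_twist {R : Type*} [Ring R] [Algebra ℂ R] {t s p : ℂ} (h : Generic t) {m : ℕ}
    {X Z u w : R} (huX : u * X = s • (X * u)) (huZ : u * Z = p • (Z * u))
    (hwX : w * X = p • (X * w)) (huw : u * w = w * u) (h0 : qSerre t m X Z = 0) :
    qSerre t m (X * u) (Z * w) = 0 := by
  rw [qSerre_eq_iter h] at h0 ⊢
  obtain ⟨α, e⟩ := iter_twist (c := t ^ (1 - (m : ℤ))) (t := t) huX huZ hwX huw m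
  rw [e, h0, zero_mul, zero_mul, smul_zero]

lemma qSerre_smul {R : Type*} [Ring R] [Algebra ℂ R] {t : ℂ} {m : ℕ} (a b : ℂ) {X Z : R}
    (h0 : qSerre t m X Z = 0) : qSerre t m (a • X) (b • Z) = 0 := by
  have : qSerre t m (a • X) (b • Z) = (a ^ m * b) • qSerre t m X Z := by
    unfold qSerre
    rw [Finset.smul_sum]
    refine Finset.sum_congr rfl fun r hr => ?_
    obtain ⟨k, rfl⟩ := Nat.exists_eq_add_of_le (Nat.lt_succ_iff.1 (Finset.mem_range.1 hr))
    rw [show r + k - r = k by omega, smul_comm]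
    congr 1
    simp only [smul_pow, smul_mul_assoc, mul_smul_comm, smul_smul]
    congr 1; ring
  rw [this, h0, smul_zero]

namespace QuantumDatum

lemma a_eq {i j : ι} (h : i ≠ j) : (1 : ℤ) - ((1 - D.a i j).toNat : ℕ) = D.a i j := by
  have := D.a_offDiag i j h
  omega

namespace Relations

variable {D}
variable {R : Type*} [Ring R] [Algebra ℂ R] {E F K Kinv : ι → R}

lemma conj_Kinv {i : ι} {x : R} {c : ℂ} (hc : c ≠ 0) (h1 : K i * x = c • (x * K i))
    (h : D.Relations E F K Kinv) : Kinv i * x = c⁻¹ • (x * Kinv i) := by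
  have h2 : x * Kinv i = c • (Kinv i * x) := by
    calc x * Kinv i = Kinv i * (K i * x) * Kinv i := by
          rw [← mul_assoc (Kinv i), h.Kinv_mul_K, one_mul]
      _ = c • (Kinv i * x * (K i * Kinv i)) := by
          rw [h1, mul_smul_comm, smul_mul_assoc]; simp only [mul_assoc]
      _ = c • (Kinv i * x) := by rw [h.K_mul_Kinv, mul_one]
  rw [h2, smul_smul, inv_mul_cancel₀ hc, one_smul]

end Relations

end QuantumDatum

namespace QuantumDatum.Relations

variable {D}
variable {R : Type*} [Ring R] [Algebra ℂ R] {E F K Kinv : ι → R}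

lemma Kinv_mul_E (h : D.Relations E F K Kinv) (i j : ι) :
    Kinv i * E j = D.qi i ^ (-D.a i j) • (E j * Kinv i) := by
  rw [zpow_neg]
  exact conj_Kinv (zpow_ne_zero _ (D.qi_ne_zero i)) (h.K_mul_E i j) h

lemma Kinv_mul_F (h : D.Relations E F K Kinv) (i j : ι) :
    Kinv i * F j = D.qi i ^ D.a i j • (F j * Kinv i) := by
  have := conj_Kinv (zpow_ne_zero _ (D.qi_ne_zero i)) (h.K_mul_F i j) h
  rwa [zpow_neg, inv_inv] at this

lemma Kinv_comm_K (h : D.Relations E F K Kinv) (i j : ι) : Kinv i * K j = K j * Kinv i := by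
  have := conj_Kinv one_ne_zero ((h.K_mul_K i j).trans (one_smul ℂ _).symm) h
  rwa [inv_one, one_smul] at this

lemma Kinv_mul_Kinv (h : D.Relations E F K Kinv) (i j : ι) :
    Kinv i * Kinv j = Kinv j * Kinv i := by
  have := conj_Kinv one_ne_zero ((Kinv_comm_K h j i).symm.trans (one_smul ℂ _).symm) h
  rwa [inv_one, one_smul] at this

end QuantumDatum.Relations

namespace Uq

open QuantumDatum.Relations

lemma comul_relations : D.Relations (R := Uq D ⊗[ℂ] Uq D)
    (fun i => 1 ⊗ₜ E D i + E D i ⊗ₜ K D i) (fun i => F D i ⊗ₜ 1 + Kinv D i ⊗ₜ F D i)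
    (fun i => K D i ⊗ₜ K D i) (fun i => Kinv D i ⊗ₜ Kinv D i) := by
  have h := relations D
  have split : ∀ x y : Uq D, x ⊗ₜ[ℂ] y = (x ⊗ₜ[ℂ] (1 : Uq D)) * ((1 : Uq D) ⊗ₜ[ℂ] y) := by simp
  have split' : ∀ x y : Uq D, x ⊗ₜ[ℂ] y = ((1 : Uq D) ⊗ₜ[ℂ] y) * (x ⊗ₜ[ℂ] (1 : Uq D)) := by simp
  constructor
  · intro i; simp [h.K_mul_Kinv, Algebra.TensorProduct.one_def]
  · intro i; simp [h.Kinv_mul_K, Algebra.TensorProduct.one_def]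
  · intro i j; simp [h.K_mul_K i j]
  · intro i j
    simp only [mul_add, add_mul, Algebra.TensorProduct.tmul_mul_tmul, h.K_mul_E i j,
      h.K_mul_K i j, mul_one, one_mul, TensorProduct.tmul_smul, TensorProduct.smul_tmul',
      smul_add]
  · intro i j
    simp only [mul_add, add_mul, Algebra.TensorProduct.tmul_mul_tmul, h.K_mul_F i j,
      Kinv_comm_K h, mul_one, one_mul, TensorProduct.tmul_smul, TensorProduct.smul_tmul',
      smul_add]
  · intro i
    have e := h.E_mul_F_same i
    have e1 : E D i * F D i = F D i * E D i + (D.qi i - (D.qi i)⁻¹)⁻¹ • (K D i - Kinv D i) := by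
      rw [← e]; abel
    have e2 : K D i * F D i = (D.qi i ^ (-D.a i i)) • (F D i * K D i) := h.K_mul_F i i
    have e3 : E D i * Kinv D i = (D.qi i ^ D.a i i) • (Kinv D i * E D i) := by
      rw [Kinv_mul_E h, smul_smul, ← zpow_add₀ (D.qi_ne_zero i)]; simp
    have e4 : (D.qi i ^ D.a i i) * (D.qi i ^ (-D.a i i)) = 1 := by
      rw [← zpow_add₀ (D.qi_ne_zero i)]; simp
    simp only [mul_add, add_mul, Algebra.TensorProduct.tmul_mul_tmul, mul_one, one_mul, e1, e2, e3,
      TensorProduct.tmul_smul, TensorProduct.smul_tmul', TensorProduct.tmul_add,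
      TensorProduct.add_tmul, TensorProduct.tmul_sub, TensorProduct.sub_tmul, smul_sub, smul_smul,
      mul_comm (D.qi i ^ (-D.a i i)), e4, one_smul]
    abel
  · intro i j hij
    have e := h.E_mul_F_ne i j hij
    have e1 : E D i * F D j = F D j * E D i := sub_eq_zero.1 e
    have e2 : K D i * F D j = (D.qi i ^ (-D.a i j)) • (F D j * K D i) := h.K_mul_F i j
    have e3 : E D i * Kinv D j = (D.qi i ^ D.a i j) • (Kinv D j * E D i) := by
      rw [Kinv_mul_E h, smul_smul, D.qi_symm, ← zpow_add₀ (D.qi_ne_zero j)]; simp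
    have e4 : (D.qi i ^ D.a i j) * (D.qi i ^ (-D.a i j)) = 1 := by
      rw [← zpow_add₀ (D.qi_ne_zero i)]; simp
    simp only [mul_add, add_mul, Algebra.TensorProduct.tmul_mul_tmul, mul_one, one_mul, e1, e2, e3,
      TensorProduct.tmul_smul, TensorProduct.smul_tmul', smul_smul,
      mul_comm (D.qi i ^ (-D.a i j)), e4, one_smul]
    abel
  · intro i j hij
    refine qSerre_add (D.generic i) ?_ ?_ ?_ ?_ ?_
    · have e := h.K_mul_E i i
      rw [D.a_diag] at e
      simp only [Algebra.TensorProduct.tmul_mul_tmul, mul_one, one_mul, e, TensorProduct.tmul_smul,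
        TensorProduct.smul_tmul']
      norm_cast
    · simp only [Algebra.TensorProduct.tmul_mul_tmul, mul_one, one_mul, h.K_mul_E i j,
        TensorProduct.tmul_smul, TensorProduct.smul_tmul', D.a_eq hij]
    · simp only [Algebra.TensorProduct.tmul_mul_tmul, mul_one, one_mul, h.K_mul_E j i,
        TensorProduct.tmul_smul, TensorProduct.smul_tmul', D.a_eq hij, D.qi_symm i j]
    · have := qSerre_map (D.qi i) (1 - D.a i j).toNat
        (Algebra.TensorProduct.includeRight : Uq D →ₐ[ℂ] Uq D ⊗[ℂ] Uq D) (E D i) (E D j)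
      rw [h.serre_E i j hij, map_zero] at this
      exact this.symm
    · rw [split (E D i), split (E D j)]
      refine qSerre_twist (D.generic i) (s := 1) (p := 1) ?_ ?_ ?_ ?_ ?_
      · simp
      · simp
      · simp
      · simp [h.K_mul_K i j]
      · have := qSerre_map (D.qi i) (1 - D.a i j).toNat
          (Algebra.TensorProduct.includeLeft : Uq D →ₐ[ℂ] Uq D ⊗[ℂ] Uq D) (E D i) (E D j)
        rw [h.serre_E i j hij, map_zero] at this
        exact this.symm
  · intro i j hij
    refine qSerre_add (D.generic i) ?_ ?_ ?_ ?_ ?_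
    · have e := Kinv_mul_F h i i
      rw [D.a_diag] at e
      simp only [Algebra.TensorProduct.tmul_mul_tmul, mul_one, one_mul, e,
        TensorProduct.smul_tmul']
      norm_cast
    · simp only [Algebra.TensorProduct.tmul_mul_tmul, mul_one, one_mul, Kinv_mul_F h i j,
        TensorProduct.smul_tmul', D.a_eq hij]
    · simp only [Algebra.TensorProduct.tmul_mul_tmul, mul_one, one_mul, Kinv_mul_F h j i,
        TensorProduct.smul_tmul', D.a_eq hij, D.qi_symm i j]
    · have := qSerre_map (D.qi i) (1 - D.a i j).toNat
        (Algebra.TensorProduct.includeLeft : Uq D →ₐ[ℂ] Uq D ⊗[ℂ] Uq D) (F D i) (F D j)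
      rw [h.serre_F i j hij, map_zero] at this
      exact this.symm
    · rw [split' (Kinv D i), split' (Kinv D j)]
      refine qSerre_twist (D.generic i) (s := 1) (p := 1) ?_ ?_ ?_ ?_ ?_
      · simp
      · simp
      · simp
      · simp [Kinv_mul_Kinv h i j]
      · have := qSerre_map (D.qi i) (1 - D.a i j).toNat
          (Algebra.TensorProduct.includeRight : Uq D →ₐ[ℂ] Uq D ⊗[ℂ] Uq D) (F D i) (F D j)
        rw [h.serre_F i j hij, map_zero] at this
        exact this.symm

lemma qSerre_zero {R : Type*} [Ring R] [Algebra ℂ R] (t : ℂ) (m : ℕ) (X : R) :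
    qSerre t m X 0 = 0 := by simp [qSerre]

lemma counit_relations : D.Relations (R := ℂ) (fun _ => 0) (fun _ => 0) (fun _ => 1)
    (fun _ => 1) := by
  constructor <;> intros <;> simp [qSerre_zero]

/-- The comultiplication of `U_q(𝔤)`. -/
def comulHom : Uq D →ₐ[ℂ] Uq D ⊗[ℂ] Uq D := lift (comul_relations D)

/-- The counit of `U_q(𝔤)`. -/
def counitHom : Uq D →ₐ[ℂ] ℂ := lift (counit_relations D)

instance : Bialgebra ℂ (Uq D) := Bialgebra.ofAlgHom (comulHom D) (counitHom D)
  (by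
    apply hom_ext <;> intro i <;>
      simp [comulHom, TensorProduct.tmul_add, TensorProduct.add_tmul,
        Algebra.TensorProduct.one_def, add_assoc])
  (by
    apply hom_ext <;> intro i <;> simp [comulHom, counitHom])
  (by
    apply hom_ext <;> intro i <;> simp [comulHom, counitHom])

section
variable (i : ι)
lemma comul_E : Coalgebra.comul (R := ℂ) (E D i) = E D i ⊗ₜ[ℂ] K D i + 1 ⊗ₜ[ℂ] E D i :=
  (lift_E (comul_relations D) i).trans (add_comm _ _)
lemma comul_F : Coalgebra.comul (R := ℂ) (F D i) = F D i ⊗ₜ[ℂ] 1 + Kinv D i ⊗ₜ[ℂ] F D i :=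
  lift_F (comul_relations D) i
lemma comul_K : Coalgebra.comul (R := ℂ) (K D i) = K D i ⊗ₜ[ℂ] K D i :=
  lift_K (comul_relations D) i
lemma comul_Kinv : Coalgebra.comul (R := ℂ) (Kinv D i) = Kinv D i ⊗ₜ[ℂ] Kinv D i :=
  lift_Kinv (comul_relations D) i
lemma counit_E : Coalgebra.counit (R := ℂ) (E D i) = 0 := lift_E (counit_relations D) i
lemma counit_F : Coalgebra.counit (R := ℂ) (F D i) = 0 := lift_F (counit_relations D) i
lemma counit_K : Coalgebra.counit (R := ℂ) (K D i) = 1 := lift_K (counit_relations D) i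
lemma counit_Kinv : Coalgebra.counit (R := ℂ) (Kinv D i) = 1 := lift_Kinv (counit_relations D) i
end

end Uq

namespace Uq

open QuantumDatum.Relations

lemma antipode_relations : D.Relations (R := (Uq D)ᵐᵒᵖ)
    (fun i => op (-(E D i * Kinv D i))) (fun i => op (-(K D i * F D i)))
    (fun i => op (Kinv D i)) (fun i => op (K D i)) := by
  have h := relations D
  have neg : ∀ x : Uq D, -x = (-1 : ℂ) • x := fun x => by simp
  constructor
  · intro i; rw [← op_mul, h.K_mul_Kinv, op_one]
  · intro i; rw [← op_mul, h.Kinv_mul_K, op_one]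
  · intro i j; rw [← op_mul, ← op_mul, Kinv_mul_Kinv h]
  · intro i j
    rw [← op_mul, ← op_mul, ← op_smul]
    congr 1
    rw [mul_neg, neg_mul, smul_neg, ← mul_assoc, Kinv_mul_E h, smul_mul_assoc, smul_smul,
      ← zpow_add₀ (D.qi_ne_zero i), add_neg_cancel, zpow_zero, one_smul, mul_assoc,
      Kinv_mul_Kinv h j i, mul_assoc]
  · intro i j
    rw [← op_mul, ← op_mul, ← op_smul]
    congr 1
    rw [mul_neg, neg_mul, smul_neg, ← mul_assoc, Kinv_comm_K h, mul_assoc, mul_assoc,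
      Kinv_mul_F h, mul_smul_comm, smul_smul, ← zpow_add₀ (D.qi_ne_zero i), neg_add_cancel,
      zpow_zero, one_smul]
  · intro i
    rw [← op_mul, ← op_mul, ← op_sub, ← op_sub, ← op_smul]
    congr 1
    have e := h.E_mul_F_same i
    have e1 : F D i * E D i = E D i * F D i - (D.qi i - (D.qi i)⁻¹)⁻¹ • (K D i - Kinv D i) := by
      rw [← e]; abel
    have e2 : K D i * F D i * (E D i * Kinv D i) = K D i * (F D i * E D i) * Kinv D i := by
      simp only [mul_assoc]
    have e3 : E D i * Kinv D i * (K D i * F D i) = E D i * F D i := by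
      rw [mul_assoc, ← mul_assoc (Kinv D i), h.Kinv_mul_K, one_mul]
    have e4 : K D i * (E D i * F D i) * Kinv D i = E D i * F D i := by
      have e5 : K D i * F D i * Kinv D i = (D.qi i ^ (-D.a i i)) • F D i := by
        rw [h.K_mul_F, smul_mul_assoc, mul_assoc, h.K_mul_Kinv, mul_one]
      rw [← mul_assoc, h.K_mul_E, smul_mul_assoc, smul_mul_assoc, mul_assoc (E D i),
        mul_assoc (E D i), e5, mul_smul_comm, smul_smul, ← zpow_add₀ (D.qi_ne_zero i),
        add_neg_cancel, zpow_zero, one_smul]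
    rw [neg_mul_neg, neg_mul_neg, e2, e3, e1, mul_sub, sub_mul, e4, mul_smul_comm, smul_mul_assoc,
      mul_sub, sub_mul, mul_assoc (K D i) (K D i), h.K_mul_Kinv, mul_one, one_mul,
      sub_sub_cancel_left, ← smul_neg, neg_sub]
  · intro i j hij
    rw [← op_mul, ← op_mul, ← op_sub, ← op_zero]
    congr 1
    have e := sub_eq_zero.1 (h.E_mul_F_ne i j hij)
    have e1 : K D j * F D j * (E D i * Kinv D i) =
        K D j * E D i * (F D j * Kinv D i) := by
      rw [mul_assoc, ← mul_assoc (F D j), ← e]; simp only [mul_assoc]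
    have e2 : F D j * Kinv D i = D.qi i ^ (-D.a i j) • (Kinv D i * F D j) := by
      rw [Kinv_mul_F h, smul_smul, ← zpow_add₀ (D.qi_ne_zero i), neg_add_cancel, zpow_zero,
        one_smul]
    rw [neg_mul_neg, neg_mul_neg, e1, e2, h.K_mul_E, smul_mul_assoc, mul_smul_comm, smul_smul,
      ← D.qi_symm, ← zpow_add₀ (D.qi_ne_zero i), add_neg_cancel, zpow_zero, one_smul,
      mul_assoc, ← mul_assoc (K D j), ← Kinv_comm_K h i j]
    simp only [mul_assoc, sub_self]
  · intro i j hij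
    rw [qSerre_op, neg, neg, qSerre_smul, op_zero, smul_zero]
    exact qSerre_twist (D.generic i) (Kinv_mul_E h i i) (Kinv_mul_E h i j)
      (by rw [Kinv_mul_E h, zpow_neg, zpow_neg, D.qi_symm]) (Kinv_mul_Kinv h i j)
      (h.serre_E i j hij)
  · intro i j hij
    rw [qSerre_op, neg, neg, h.K_mul_F, h.K_mul_F, smul_smul, smul_smul, qSerre_smul, op_zero,
      smul_zero]
    exact qSerre_twist (D.generic i) (h.K_mul_F i i) (h.K_mul_F i j)
      (by rw [h.K_mul_F, zpow_neg, zpow_neg, D.qi_symm]) (h.K_mul_K i j)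
      (h.serre_F i j hij)

/-- Induction on the generators. -/
@[elab_as_elim]
lemma gen_induction {p : Uq D → Prop} (alg : ∀ c, p (algebraMap ℂ _ c))
    (add : ∀ a b, p a → p b → p (a + b)) (mul : ∀ a b, p a → p b → p (a * b))
    (E : ∀ i, p (E D i)) (F : ∀ i, p (F D i)) (K : ∀ i, p (K D i)) (Kinv : ∀ i, p (Kinv D i))
    (X : Uq D) : p X :=
  mem_of_generators
    { carrier := {X | p X}
      mul_mem' := fun {a b} ha hb => mul a b ha hb
      add_mem' := fun {a b} ha hb => add a b ha hb
      algebraMap_mem' := alg } E F K Kinv X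

/-- The antipode of `U_q(𝔤)`, as an algebra map to the opposite algebra. -/
def antipodeHom : Uq D →ₐ[ℂ] (Uq D)ᵐᵒᵖ := lift (antipode_relations D)

/-- The antipode of `U_q(𝔤)`. -/
def S : Uq D →ₗ[ℂ] Uq D := (opLinearEquiv ℂ).symm.toLinearMap ∘ₗ (antipodeHom D).toLinearMap

lemma S_mul (x y : Uq D) : S D (x * y) = S D y * S D x := by simp [S]
lemma S_one : S D 1 = 1 := by simp [S]
lemma S_algebraMap (c : ℂ) : S D (algebraMap ℂ _ c) = algebraMap ℂ _ c := by
  rw [Algebra.algebraMap_eq_smul_one, map_smul, S_one]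

section
variable (i : ι)
lemma S_E : S D (E D i) = -(E D i * Kinv D i) := congrArg unop (lift_E (antipode_relations D) i)
lemma S_F : S D (F D i) = -(K D i * F D i) := congrArg unop (lift_F (antipode_relations D) i)
lemma S_K : S D (K D i) = Kinv D i := congrArg unop (lift_K (antipode_relations D) i)
lemma S_Kinv : S D (Kinv D i) = K D i := congrArg unop (lift_Kinv (antipode_relations D) i)
end

lemma antipode_left (X : Uq D) : LinearMap.mul' ℂ (Uq D) ((S D).rTensor (Uq D)
    (Coalgebra.comul (R := ℂ) X)) = algebraMap ℂ (Uq D) (Coalgebra.counit (R := ℂ) X) := by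
  have key1 : ∀ (u : Uq D ⊗[ℂ] Uq D) (y z : Uq D),
      LinearMap.mul' ℂ (Uq D) ((S D).rTensor (Uq D) (u * (y ⊗ₜ z))) =
      S D y * LinearMap.mul' ℂ (Uq D) ((S D).rTensor (Uq D) u) * z := by
    intro u y z
    induction u with
    | zero => simp
    | tmul a b => simp [S_mul, mul_assoc]
    | add a b ha hb => rw [add_mul, map_add, map_add, ha, hb, map_add, map_add, mul_add, add_mul]
  have key : ∀ (u v : Uq D ⊗[ℂ] Uq D) (c : ℂ),
      LinearMap.mul' ℂ (Uq D) ((S D).rTensor (Uq D) u) = algebraMap ℂ _ c →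
      LinearMap.mul' ℂ (Uq D) ((S D).rTensor (Uq D) (u * v)) =
      c • LinearMap.mul' ℂ (Uq D) ((S D).rTensor (Uq D) v) := by
    intro u v c hc
    induction v with
    | zero => simp
    | tmul y z =>
      rw [key1, hc, ← Algebra.commutes, mul_assoc, ← Algebra.smul_def]; simp
    | add a b ha hb => rw [mul_add, map_add, map_add, ha, hb, map_add, map_add, smul_add]
  have h := relations D
  induction X using gen_induction with
  | alg c =>
    rw [Bialgebra.comul_algebraMap, Bialgebra.counit_algebraMap,
      Algebra.TensorProduct.algebraMap_apply]
    simp [S_algebraMap]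
  | add a b ha hb => rw [map_add, map_add, map_add, ha, hb, map_add, map_add]
  | mul a b ha hb =>
    rw [Bialgebra.comul_mul, key _ _ _ ha, hb, Bialgebra.counit_mul, map_mul, Algebra.smul_def]
  | E i => simp [comul_E, counit_E, S_E, S_one, mul_assoc, h.Kinv_mul_K]
  | F i => simp [comul_F, counit_F, S_F, S_Kinv]
  | K i => simp [comul_K, counit_K, S_K, h.Kinv_mul_K]
  | Kinv i => simp [comul_Kinv, counit_Kinv, S_Kinv, h.K_mul_Kinv]

lemma antipode_right (X : Uq D) : LinearMap.mul' ℂ (Uq D) ((S D).lTensor (Uq D)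
    (Coalgebra.comul (R := ℂ) X)) = algebraMap ℂ (Uq D) (Coalgebra.counit (R := ℂ) X) := by
  have key1 : ∀ (u : Uq D ⊗[ℂ] Uq D) (y z : Uq D),
      LinearMap.mul' ℂ (Uq D) ((S D).lTensor (Uq D) ((y ⊗ₜ z) * u)) =
      y * LinearMap.mul' ℂ (Uq D) ((S D).lTensor (Uq D) u) * S D z := by
    intro u y z
    induction u with
    | zero => simp
    | tmul a b => simp [S_mul, mul_assoc]
    | add a b ha hb => rw [mul_add, map_add, map_add, ha, hb, map_add, map_add, mul_add, add_mul]
  have key : ∀ (u v : Uq D ⊗[ℂ] Uq D) (c : ℂ),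
      LinearMap.mul' ℂ (Uq D) ((S D).lTensor (Uq D) v) = algebraMap ℂ _ c →
      LinearMap.mul' ℂ (Uq D) ((S D).lTensor (Uq D) (u * v)) =
      c • LinearMap.mul' ℂ (Uq D) ((S D).lTensor (Uq D) u) := by
    intro u v c hc
    induction u with
    | zero => simp
    | tmul y z => rw [key1, hc, ← Algebra.commutes, mul_assoc, ← Algebra.smul_def]; simp
    | add a b ha hb => rw [add_mul, map_add, map_add, ha, hb, map_add, map_add, smul_add]
  have h := relations D
  induction X using gen_induction with
  | alg c =>
    rw [Bialgebra.comul_algebraMap, Bialgebra.counit_algebraMap,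
      Algebra.TensorProduct.algebraMap_apply]
    simp [S_one]
  | add a b ha hb => rw [map_add, map_add, map_add, ha, hb, map_add, map_add]
  | mul a b ha hb =>
    rw [Bialgebra.comul_mul, key _ _ _ hb, ha, Bialgebra.counit_mul, mul_comm, map_mul,
      Algebra.smul_def]
  | E i => simp [comul_E, counit_E, S_E, S_K]
  | F i => simp [comul_F, counit_F, S_F, S_one, ← mul_assoc, h.Kinv_mul_K]
  | K i => simp [comul_K, counit_K, S_K, h.K_mul_Kinv]
  | Kinv i => simp [comul_Kinv, counit_Kinv, S_Kinv, h.Kinv_mul_K]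

instance : HopfAlgebra ℂ (Uq D) where
  antipode := S D
  mul_antipode_rTensor_comul := LinearMap.ext (antipode_left D)
  mul_antipode_lTensor_comul := LinearMap.ext (antipode_right D)

/-- The comultiplication and the antipode. -/
lemma comul_S (X : Uq D) : Coalgebra.comul (R := ℂ) (S D X) =
    TensorProduct.comm ℂ _ _ (TensorProduct.map (S D) (S D) (Coalgebra.comul (R := ℂ) X)) := by
  have key : ∀ u v : Uq D ⊗[ℂ] Uq D,
      TensorProduct.comm ℂ _ _ (TensorProduct.map (S D) (S D) (u * v)) =
      TensorProduct.comm ℂ _ _ (TensorProduct.map (S D) (S D) v) *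
      TensorProduct.comm ℂ _ _ (TensorProduct.map (S D) (S D) u) := by
    intro u v
    induction u with
    | zero => simp
    | add a b ha hb => simp [add_mul, mul_add, ha, hb]
    | tmul a b =>
      induction v with
      | zero => simp
      | add c d hc hd => rw [mul_add, map_add, map_add, hc, hd, map_add, map_add, add_mul]
      | tmul c d => simp [S_mul]
  have h := relations D
  induction X using gen_induction with
  | alg c =>
    rw [S_algebraMap, Bialgebra.comul_algebraMap, Algebra.TensorProduct.algebraMap_apply,
      TensorProduct.map_tmul, S_algebraMap, S_one, TensorProduct.comm_tmul,
      Algebra.algebraMap_eq_smul_one, TensorProduct.tmul_smul, TensorProduct.smul_tmul']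
  | add a b ha hb => simp only [map_add, ha, hb]
  | mul a b ha hb => rw [S_mul, Bialgebra.comul_mul, Bialgebra.comul_mul, key, ha, hb]
  | E i =>
    rw [S_E, map_neg, Bialgebra.comul_mul, comul_E, comul_Kinv]
    simp [S_E, S_K, S_one, add_mul, TensorProduct.tmul_neg, TensorProduct.neg_tmul,
      h.K_mul_Kinv, add_comm]
  | F i =>
    rw [S_F, map_neg, Bialgebra.comul_mul, comul_F, comul_K]
    simp [S_F, S_Kinv, S_one, mul_add, TensorProduct.tmul_neg, TensorProduct.neg_tmul,
      h.K_mul_Kinv, add_comm]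
  | K i => simp [comul_K, S_K, comul_Kinv]
  | Kinv i => simp [comul_K, S_Kinv, comul_Kinv]

end Uq

/-- The conjugate algebra: the same ring, with scalars acting through complex conjugation. -/
def Conj (R : Type*) : Type _ := R

instance (R : Type*) [Ring R] : Ring (Conj R) := inferInstanceAs (Ring R)

instance (R : Type*) [Ring R] [Algebra ℂ R] : Algebra ℂ (Conj R) :=
  RingHom.toAlgebra' ((algebraMap ℂ R).comp (starRingEnd ℂ) : ℂ →+* R)
    (fun _ x => Algebra.commutes (R := ℂ) (A := R) _ x)

lemma Conj.smul_def {R : Type*} [Ring R] [Algebra ℂ R] (c : ℂ) (x : Conj R) :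
    c • x = @HSMul.hSMul ℂ R R _ (starRingEnd ℂ c) x :=
  (Algebra.smul_def (R := ℂ) (A := R) (starRingEnd ℂ c) x).symm

lemma Conj.qSerre {R : Type*} [Ring R] [Algebra ℂ R] {t : ℂ} (ht : starRingEnd ℂ t = t) (m : ℕ)
    (X Z : Conj R) : QG.qSerre t m X Z = QG.qSerre (R := R) t m X Z := by
  have h1 : ∀ n, starRingEnd ℂ (qInt t n) = qInt t n := fun n => by simp [qInt, ht]
  have h2 : ∀ n, starRingEnd ℂ (qFact t n) = qFact t n := fun n => by simp [qFact, h1]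
  have h3 : ∀ n r, starRingEnd ℂ (qBinom t n r) = qBinom t n r := fun n r => by simp [qBinom, h2]
  unfold QG.qSerre
  refine Finset.sum_congr rfl fun r _ => ?_
  refine (Conj.smul_def _ _).trans ?_
  rw [map_mul, h3, map_pow, map_neg, map_one]
  rfl

namespace Uq

open QuantumDatum.Relations

lemma tau_relations : D.Relations (R := Conj (Uq D)) (fun i => (-F D i : Uq D))
    (fun i => (-E D i : Uq D)) (fun i => Kinv D i) (fun i => K D i) := by
  have h := relations D
  have neg : ∀ x : Uq D, -x = (-1 : ℂ) • x := fun x => by simp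
  have hc : ∀ i (n : ℤ), starRingEnd ℂ (D.qi i ^ n) = D.qi i ^ n := fun i n => by
    rw [map_zpow₀, D.qi_conj]
  constructor
  · intro i; exact h.Kinv_mul_K i
  · intro i; exact h.K_mul_Kinv i
  · intro i j; exact Kinv_mul_Kinv h i j
  · intro i j
    refine Eq.trans ?_ (Conj.smul_def (R := Uq D) _ _).symm
    rw [hc]
    change Kinv D i * -F D j = _ • (-F D j * Kinv D i)
    rw [mul_neg, Kinv_mul_F h, neg_mul, smul_neg]
  · intro i j
    refine Eq.trans ?_ (Conj.smul_def (R := Uq D) _ _).symm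
    rw [hc]
    change Kinv D i * -E D j = _ • (-E D j * Kinv D i)
    rw [mul_neg, Kinv_mul_E h, neg_mul, smul_neg]
  · intro i
    refine Eq.trans ?_ (Conj.smul_def (R := Uq D) _ _).symm
    rw [map_inv₀, map_sub, map_inv₀, D.qi_conj]
    change -F D i * -E D i - -E D i * -F D i = _ • (Kinv D i - K D i)
    rw [neg_mul_neg, neg_mul_neg, ← neg_sub, h.E_mul_F_same, ← smul_neg, neg_sub]
  · intro i j hij
    change -F D i * -E D j - -E D j * -F D i = 0
    rw [neg_mul_neg, neg_mul_neg, ← neg_sub, h.E_mul_F_ne j i hij.symm, neg_zero]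
  · intro i j hij
    refine (Conj.qSerre (R := Uq D) (D.qi_conj i) _ _ _).trans ?_
    change qSerre (R := Uq D) _ _ (-F D i) (-F D j) = 0
    rw [neg, neg]
    exact qSerre_smul _ _ (h.serre_F i j hij)
  · intro i j hij
    refine (Conj.qSerre (R := Uq D) (D.qi_conj i) _ _ _).trans ?_
    change qSerre (R := Uq D) _ _ (-E D i) (-E D j) = 0
    rw [neg, neg]
    exact qSerre_smul _ _ (h.serre_E i j hij)

/-- The conjugate linear algebra automorphism with `E_i ↦ -F_i`, `F_i ↦ -E_i`, `K_i ↦ K_i⁻¹`. -/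
def tau : Uq D →+* Uq D := ((lift (tau_relations D) : Uq D →ₐ[ℂ] Conj (Uq D)) :
    Uq D →+* Conj (Uq D))

lemma tau_smul (c : ℂ) (x : Uq D) : tau D (c • x) = starRingEnd ℂ c • tau D x :=
  (map_smul (lift (tau_relations D)) c x).trans (Conj.smul_def _ _)

lemma tau_algebraMap (c : ℂ) : tau D (algebraMap ℂ _ c) = algebraMap ℂ _ (starRingEnd ℂ c) := by
  rw [Algebra.algebraMap_eq_smul_one, tau_smul, map_one, Algebra.algebraMap_eq_smul_one]

section
variable (i : ι)
lemma tau_E : tau D (E D i) = -F D i := lift_E (tau_relations D) i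
lemma tau_F : tau D (F D i) = -E D i := lift_F (tau_relations D) i
lemma tau_K : tau D (K D i) = Kinv D i := lift_K (tau_relations D) i
lemma tau_Kinv : tau D (Kinv D i) = K D i := lift_Kinv (tau_relations D) i
end

lemma tau_tau (X : Uq D) : tau D (tau D X) = X := by
  induction X using gen_induction with
  | alg c => simp [tau_algebraMap]
  | add a b ha hb => rw [map_add, map_add, ha, hb]
  | mul a b ha hb => rw [map_mul, map_mul, ha, hb]
  | E i => rw [tau_E, map_neg, tau_F, neg_neg]
  | F i => rw [tau_F, map_neg, tau_E, neg_neg]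
  | K i => rw [tau_K, tau_Kinv]
  | Kinv i => rw [tau_Kinv, tau_K]

lemma S_tau_S (X : Uq D) : S D (tau D (S D X)) = tau D X := by
  have h := relations D
  induction X using gen_induction with
  | alg c => simp [S_algebraMap, tau_algebraMap]
  | add a b ha hb => simp only [map_add, ha, hb]
  | mul a b ha hb => simp only [S_mul, map_mul, ha, hb]
  | E i => simp [S_E, tau_E, tau_Kinv, S_mul, S_F, S_K, ← mul_assoc, h.Kinv_mul_K]
  | F i => simp [S_F, tau_F, tau_K, S_mul, S_E, S_Kinv, mul_assoc, h.Kinv_mul_K]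
  | K i => simp [S_K, tau_Kinv, tau_K]
  | Kinv i => simp [S_Kinv, tau_Kinv, tau_K]

/-- The compact real form of `U_q(𝔤)`: the conjugate linear anti-automorphism with `K_i^* = K_i`,
`E_i^* = K_i F_i` and `F_i^* = E_i K_i⁻¹`. -/
instance : StarRing (Uq D) where
  star X := S D (tau D X)
  star_involutive X := by
    change S D (tau D (S D (tau D X))) = X
    rw [S_tau_S, tau_tau]
  star_mul x y := by
    change S D (tau D (x * y)) = S D (tau D y) * S D (tau D x)
    rw [map_mul, S_mul]
  star_add x y := by
    change S D (tau D (x + y)) = S D (tau D x) + S D (tau D y)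
    rw [map_add, map_add]

instance : StarModule ℂ (Uq D) where
  star_smul c x := by
    change S D (tau D (c • x)) = star c • S D (tau D x)
    rw [tau_smul, map_smul]; rfl

section
variable (i : ι)
lemma star_K : star (K D i) = K D i := by
  change S D (tau D _) = _
  rw [tau_K, S_Kinv]
lemma star_E : star (E D i) = K D i * F D i := by
  change S D (tau D _) = _
  rw [tau_E, map_neg, S_F, neg_neg]
lemma star_F : star (F D i) = E D i * Kinv D i := by
  change S D (tau D _) = _
  rw [tau_F, map_neg, S_E, neg_neg]
lemma star_Kinv : star (Kinv D i) = Kinv D i := by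
  change S D (tau D _) = _
  rw [tau_Kinv, S_K]
end

lemma star_S (X : Uq D) : star (S D X) = tau D X := S_tau_S D X

/-- `U_q(𝔤)` is a Hopf `*`-algebra. -/
lemma comul_star (X : Uq D) :
    Coalgebra.comul (R := ℂ) (star X) = star (Coalgebra.comul (R := ℂ) X) := by
  have h := relations D
  induction X using gen_induction with
  | alg c => simp [Algebra.algebraMap_eq_smul_one, Algebra.TensorProduct.one_def]
  | add a b ha hb => simp only [star_add, map_add, ha, hb]
  | mul a b ha hb => simp only [star_mul, Bialgebra.comul_mul, ha, hb]
  | E i =>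
    rw [star_E, Bialgebra.comul_mul, comul_E, comul_K, comul_F]
    simp [star_E, star_K, mul_add, h.K_mul_Kinv]
  | F i =>
    rw [star_F, Bialgebra.comul_mul, comul_E, comul_F, comul_Kinv]
    simp [star_F, star_Kinv, add_mul, h.K_mul_Kinv]
  | K i => simp [star_K, comul_K]
  | Kinv i => simp [star_Kinv, comul_Kinv]

end Uq

/-! ### Type 1 representations and the quantised coordinate algebra -/

open WithConv

/-- A finite-dimensional type 1 representation of `U_q(𝔤)`, written in a basis of weight vectors:
the basis vector with index `k` has weight `∑ i, wt k i • ϖ_i`. -/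
structure Type1Rep where
  κ : Type
  [fintype : Fintype κ]
  [decEq : DecidableEq κ]
  hom : Uq D →ₐ[ℂ] Matrix κ κ ℂ
  wt : κ → ι → ℤ
  hom_K : ∀ i, hom (Uq.K D i) = Matrix.diagonal fun k => D.qi i ^ wt k i

namespace Type1Rep

attribute [instance] Type1Rep.fintype Type1Rep.decEq

variable {D}

lemma hom_Kinv (V : Type1Rep D) (i : ι) :
    V.hom (Uq.Kinv D i) = Matrix.diagonal fun k => D.qi i ^ (-V.wt k i) := by
  have h1 : V.hom (Uq.Kinv D i) * V.hom (Uq.K D i) = 1 := by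
    rw [← map_mul, (Uq.relations D).Kinv_mul_K, map_one]
  have h2 : V.hom (Uq.K D i) * Matrix.diagonal (fun k => D.qi i ^ (-V.wt k i)) = 1 := by
    rw [V.hom_K, Matrix.diagonal_mul_diagonal, ← Matrix.diagonal_one]
    congr 1; funext k
    rw [← zpow_add₀ (D.qi_ne_zero i), add_neg_cancel, zpow_zero]
  exact left_inv_eq_right_inv h1 h2

/-- The matrix coefficients, as functionals on `U_q(𝔤)`. -/
def coeffFun (V : Type1Rep D) (k l : V.κ) : Uq D →ₗ[ℂ] ℂ :=
  Matrix.entryLinearMap ℂ ℂ k l ∘ₗ V.hom.toLinearMap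

@[simp] lemma coeffFun_apply (V : Type1Rep D) (k l : V.κ) (X : Uq D) :
    V.coeffFun k l X = V.hom X k l := rfl

variable (D) in
/-- The trivial representation. -/
def triv : Type1Rep D where
  κ := Unit
  hom := (Algebra.ofId ℂ (Matrix Unit Unit ℂ)).comp (Bialgebra.counitAlgHom ℂ (Uq D))
  wt _ _ := 0
  hom_K i := by
    simp [Uq.counit_K, Matrix.algebraMap_eq_diagonal]

/-- The tensor product of representations. -/
def tensor (V W : Type1Rep D) : Type1Rep D where
  κ := V.κ × W.κ
  hom := (Matrix.kroneckerAlgEquiv V.κ W.κ ℂ).toAlgHom.comp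
    ((Algebra.TensorProduct.map V.hom W.hom).comp (Bialgebra.comulAlgHom ℂ (Uq D)))
  wt k := V.wt k.1 + W.wt k.2
  hom_K i := by
    simp [Uq.comul_K, V.hom_K, W.hom_K, zpow_add₀ (D.qi_ne_zero i),
      Matrix.diagonal_kronecker_diagonal]

/-- The dual representation. -/
def dual (V : Type1Rep D) : Type1Rep D where
  κ := V.κ
  hom := (((Matrix.transposeAlgEquiv V.κ ℂ ℂ).symm.toAlgHom.comp (AlgHom.op V.hom))).comp
    (Uq.antipodeHom D)
  wt k := -V.wt k
  hom_K i := by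
    change (V.hom (Uq.S D (Uq.K D i))).transpose = _
    rw [Uq.S_K, V.hom_Kinv, Matrix.diagonal_transpose]
    rfl

lemma dual_hom (V : Type1Rep D) (X : Uq D) : V.dual.hom X = (V.hom (Uq.S D X)).transpose := rfl

/-- The conjugate of a representation along the automorphism `X ↦ S(X)^*`. -/
def conj (V : Type1Rep D) : Type1Rep D where
  κ := V.κ
  hom :=
    { toFun := fun X => (V.hom (Uq.tau D X)).map (starRingEnd ℂ)
      map_one' := by simp
      map_mul' := fun x y => by rw [map_mul, map_mul, Matrix.map_mul]
      map_zero' := by simp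
      map_add' := fun x y => by
        rw [map_add, map_add, Matrix.map_add _ (map_add (starRingEnd ℂ))]
      commutes' := fun c => by
        rw [Uq.tau_algebraMap, AlgHom.commutes]
        ext k l
        simp only [Matrix.map_apply, Matrix.algebraMap_matrix_apply]
        split_ifs <;> simp }
  wt k := -V.wt k
  hom_K i := by
    change (V.hom (Uq.tau D (Uq.K D i))).map (starRingEnd ℂ) = _
    rw [Uq.tau_K, V.hom_Kinv, Matrix.diagonal_map (by simp)]
    congr 1; funext k
    simp [D.qi_conj]

lemma conj_hom (V : Type1Rep D) (X : Uq D) :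
    V.conj.hom X = (V.hom (Uq.tau D X)).map (starRingEnd ℂ) := rfl

lemma coeffFun_mul (V W : Type1Rep D) (k l : V.κ) (k' l' : W.κ) :
    toConv (V.coeffFun k l) * toConv (W.coeffFun k' l') =
      toConv ((V.tensor W).coeffFun (k, k') (l, l')) := by
  ext X
  change LinearMap.mul' ℂ ℂ (TensorProduct.map _ _ (Coalgebra.comul X)) =
    (Matrix.kroneckerAlgEquiv V.κ W.κ ℂ (Algebra.TensorProduct.map V.hom W.hom
      (Coalgebra.comul X))) (k, k') (l, l')
  induction Coalgebra.comul (R := ℂ) X with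
  | zero => simp
  | tmul a b => simp
  | add a b ha hb => simp only [map_add, ha, hb, Matrix.add_apply]

end Type1Rep

/-- The span of all matrix coefficients of type 1 representations. -/
def oqSpan : Submodule ℂ (WithConv (Uq D →ₗ[ℂ] ℂ)) :=
  Submodule.span ℂ {f | ∃ (V : Type1Rep D) (k l : V.κ), f = toConv (V.coeffFun k l)}

/-- The span of all matrix coefficients of type 1 representations, as a subalgebra of the
convolution algebra of functionals on `U_q(𝔤)`. -/
def oqSubalgebra : Subalgebra ℂ (WithConv (Uq D →ₗ[ℂ] ℂ)) :=
  (oqSpan D).toSubalgebra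
    (Submodule.subset_span ⟨Type1Rep.triv D, (), (), by
      ext X
      have h := Matrix.algebraMap_matrix_apply (R := ℂ) (α := ℂ) (n := Unit)
        (r := Coalgebra.counit (R := ℂ) X) (i := ()) (j := ())
      rw [if_pos rfl] at h
      exact h.symm⟩)
    (by
      intro x y hx hy
      refine Submodule.span_induction₂ (p := fun x y _ _ => x * y ∈ oqSpan D) ?_ ?_ ?_ ?_ ?_ ?_ ?_ hx hy
      · rintro _ _ ⟨V, k, l, rfl⟩ ⟨W, k', l', rfl⟩
        rw [Type1Rep.coeffFun_mul]
        exact Submodule.subset_span ⟨_, _, _, rfl⟩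
      · intro y _; rw [zero_mul]; exact zero_mem _
      · intro x _; rw [mul_zero]; exact zero_mem _
      · intro x y z _ _ _ h1 h2; rw [add_mul]; exact add_mem h1 h2
      · intro x y z _ _ _ h1 h2; rw [mul_add]; exact add_mem h1 h2
      · intro c x y _ _ h; rw [smul_mul_assoc]; exact Submodule.smul_mem _ c h
      · intro c x y _ _ h; rw [mul_smul_comm]; exact Submodule.smul_mem _ c h)

/-- The quantised coordinate algebra `O_q(G)`: the type 1 Hopf dual of `U_q(𝔤)`. -/
def Oq : Type _ := oqSubalgebra D

instance : Ring (Oq D) := inferInstanceAs (Ring (oqSubalgebra D))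
instance : Algebra ℂ (Oq D) := inferInstanceAs (Algebra ℂ (oqSubalgebra D))

namespace Oq

/-- The evaluation pairing `⟨X, f⟩` as the functional on `U_q(𝔤)` that `f` is. -/
def ev : Oq D →ₗ[ℂ] Uq D →ₗ[ℂ] ℂ :=
  (WithConv.linearEquiv ℂ (Uq D →ₗ[ℂ] ℂ)).toLinearMap ∘ₗ (oqSubalgebra D).val.toLinearMap

variable {D}

@[ext] lemma ext {f g : Oq D} (h : ∀ X, ev D f X = ev D g X) : f = g :=
  Subtype.ext (WithConv.ext (LinearMap.ext h))

lemma ev_mul (f g : Oq D) (X : Uq D) : ev D (f * g) X =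
    LinearMap.mul' ℂ ℂ (TensorProduct.map (ev D f) (ev D g) (Coalgebra.comul (R := ℂ) X)) := rfl

lemma ev_one (X : Uq D) : ev D 1 X = Coalgebra.counit (R := ℂ) X := rfl

/-- The matrix coefficients, as elements of `O_q(G)`. -/
def coeff (V : Type1Rep D) (k l : V.κ) : Oq D :=
  ⟨toConv (V.coeffFun k l), Submodule.subset_span ⟨V, k, l, rfl⟩⟩

lemma ev_coeff (V : Type1Rep D) (k l : V.κ) (X : Uq D) : ev D (coeff V k l) X = V.hom X k l := rfl

lemma coeff_mul (V W : Type1Rep D) (k l : V.κ) (k' l' : W.κ) :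
    coeff V k l * coeff W k' l' = coeff (V.tensor W) (k, k') (l, l') :=
  Subtype.ext (Type1Rep.coeffFun_mul V W k l k' l')

lemma coeff_induction {p : Oq D → Prop} (coeff : ∀ V k l, p (coeff V k l)) (zero : p 0)
    (add : ∀ f g, p f → p g → p (f + g)) (smul : ∀ (c : ℂ) f, p f → p (c • f)) (f : Oq D) : p f := by
  obtain ⟨f, hf⟩ := f
  refine Submodule.span_induction (p := fun f hf => p ⟨f, hf⟩) ?_ zero ?_ ?_ hf
  · rintro _ ⟨V, k, l, rfl⟩
    exact coeff V k l
  · intro x y hx hy h1 h2; exact add _ _ h1 h2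
  · intro c x hx h; exact smul c _ h

lemma linearMap_ext {M : Type*} [AddCommMonoid M] [Module ℂ M] {f g : Oq D →ₗ[ℂ] M}
    (h : ∀ (V : Type1Rep D) k l, f (coeff V k l) = g (coeff V k l)) : f = g := by
  ext x
  induction x using coeff_induction with
  | coeff V k l => exact h V k l
  | zero => simp
  | add a b ha hb => simp [ha, hb]
  | smul c a ha => simp [ha]

variable (D)

/-- The pairing of `O_q(G) ⊗ O_q(G)` with pairs of elements of `U_q(𝔤)`. -/
def ev₂ : Oq D ⊗[ℂ] Oq D →ₗ[ℂ] Uq D →ₗ[ℂ] Uq D →ₗ[ℂ] ℂ :=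
  TensorProduct.lift (LinearMap.mk₂ ℂ
    (fun f g => (LinearMap.mul ℂ ℂ).compl₁₂ (ev D f) (ev D g))
    (by intros; ext; simp) (by intros; ext; simp [mul_assoc])
    (by intros; ext; simp [mul_add]) (by intros; ext; simp [mul_left_comm]))

@[simp] lemma ev₂_tmul (f g : Oq D) (X Y : Uq D) : ev₂ D (f ⊗ₜ g) X Y = ev D f X * ev D g Y := rfl

lemma ev₂_injective : Function.Injective (ev₂ D) := by
  classical
  rw [injective_iff_map_eq_zero]
  intro t ht
  let b := Module.Basis.ofVectorSpace ℂ (Oq D)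
  let e := TensorProduct.equivFinsuppOfBasisRight (M := Oq D) b
  let L : Uq D → Oq D ⊗[ℂ] Oq D →ₗ[ℂ] Oq D := fun X =>
    (TensorProduct.lid ℂ (Oq D)).toLinearMap ∘ₗ ((ev D).flip X).rTensor (Oq D)
  have key1 : ∀ X Y t, ev D (L X t) Y = ev₂ D t X Y := by
    intro X Y t
    induction t with
    | zero => simp
    | add x y hx hy => simp only [map_add, LinearMap.add_apply, hx, hy]
    | tmul f g => simp [L]
  have key2 : ∀ X t n, b.repr (L X t) n = ev D (e t n) X := by
    intro X t n
    induction t with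
    | zero => simp
    | add x y hx hy => simp only [map_add, Finsupp.add_apply, LinearMap.add_apply, hx, hy]
    | tmul f g => simp [L, e, mul_comm]
  have h0 : ∀ X, L X t = 0 := fun X => ext fun Y => by rw [key1, ht]; simp
  have : e t = 0 := by
    ext n X
    rw [← key2, h0]
    simp
  exact e.map_eq_zero_iff.1 this

/-- The functional `(X, Y) ↦ ⟨X Y, f⟩`. -/
def evMul : Oq D →ₗ[ℂ] Uq D →ₗ[ℂ] Uq D →ₗ[ℂ] ℂ where
  toFun f := (LinearMap.mul ℂ (Uq D)).compr₂ (ev D f)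
  map_add' f g := by ext; simp
  map_smul' c f := by ext; simp

@[simp] lemma evMul_apply (f : Oq D) (X Y : Uq D) : evMul D f X Y = ev D f (X * Y) := rfl

variable {D} in
lemma ev₂_coeff (V : Type1Rep D) (k l : V.κ) :
    ev₂ D (∑ m, coeff V k m ⊗ₜ coeff V m l) = evMul D (coeff V k l) := by
  ext X Y
  simp only [map_sum, LinearMap.sum_apply, ev₂_tmul, evMul_apply, ev_coeff, map_mul,
    Matrix.mul_apply]

lemma evMul_mem (f : Oq D) : evMul D f ∈ LinearMap.range (ev₂ D) := by
  induction f using coeff_induction with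
  | coeff V k l => exact ⟨_, ev₂_coeff V k l⟩
  | zero => rw [map_zero]; exact zero_mem _
  | add f g hf hg => rw [map_add]; exact add_mem hf hg
  | smul c f hf => rw [map_smul]; exact Submodule.smul_mem _ c hf

/-- The comultiplication of `O_q(G)`, determined by `⟨X, f₍₁₎⟩ ⟨Y, f₍₂₎⟩ = ⟨X Y, f⟩`. -/
def comul : Oq D →ₗ[ℂ] Oq D ⊗[ℂ] Oq D :=
  (LinearEquiv.ofInjective (ev₂ D) (ev₂_injective D)).symm.toLinearMap ∘ₗ
    (evMul D).codRestrict (LinearMap.range (ev₂ D)) (evMul_mem D)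

lemma ev₂_comul (f : Oq D) : ev₂ D (comul D f) = evMul D f := by
  have := LinearEquiv.apply_symm_apply (LinearEquiv.ofInjective (ev₂ D) (ev₂_injective D))
    ⟨evMul D f, evMul_mem D f⟩
  exact congrArg Subtype.val this

lemma comul_coeff (V : Type1Rep D) (k l : V.κ) :
    comul D (coeff V k l) = ∑ m, coeff V k m ⊗ₜ coeff V m l :=
  ev₂_injective D ((ev₂_comul D _).trans (ev₂_coeff V k l).symm)

/-- The counit of `O_q(G)`, which is `f ↦ ⟨1, f⟩`. -/
def counit : Oq D →ₗ[ℂ] ℂ := (ev D).flip 1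

lemma counit_coeff (V : Type1Rep D) (k l : V.κ) :
    counit D (coeff V k l) = (1 : Matrix V.κ V.κ ℂ) k l := by
  change V.hom 1 k l = _
  rw [map_one]

instance : Coalgebra ℂ (Oq D) where
  comul := comul D
  counit := counit D
  coassoc := by
    refine linearMap_ext fun V k l => ?_
    simp only [LinearMap.comp_apply, comul_coeff, map_sum, LinearMap.rTensor_tmul,
      LinearMap.lTensor_tmul, TensorProduct.sum_tmul, TensorProduct.tmul_sum,
      LinearEquiv.coe_coe, TensorProduct.assoc_tmul]
    exact Finset.sum_comm
  rTensor_counit_comp_comul := by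
    refine linearMap_ext fun V k l => ?_
    simp only [LinearMap.comp_apply, comul_coeff, map_sum, LinearMap.rTensor_tmul, counit_coeff]
    rw [Finset.sum_eq_single k (fun m _ h => by simp [h.symm]) (by simp)]
    simp
  lTensor_counit_comp_comul := by
    refine linearMap_ext fun V k l => ?_
    simp only [LinearMap.comp_apply, comul_coeff, map_sum, LinearMap.lTensor_tmul, counit_coeff]
    rw [Finset.sum_eq_single l (fun m _ h => by simp [h]) (by simp)]
    simp

lemma comul_eq (V : Type1Rep D) (k l : V.κ) :
    Coalgebra.comul (R := ℂ) (coeff V k l) = ∑ m, coeff V k m ⊗ₜ[ℂ] coeff V m l :=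
  comul_coeff D V k l

lemma counit_eq (f : Oq D) : Coalgebra.counit (R := ℂ) f = ev D f 1 := rfl

/-- The pairing of `O_q(G)` with `U_q(𝔤)` intertwines the comultiplication of `O_q(G)` and the
multiplication of `U_q(𝔤)`. -/
lemma ev₂_comul' (f : Oq D) (X Y : Uq D) :
    ev₂ D (Coalgebra.comul (R := ℂ) f) X Y = ev D f (X * Y) := by
  change ev₂ D (comul D f) X Y = _
  rw [ev₂_comul]; rfl

instance : Bialgebra ℂ (Oq D) := Bialgebra.mk' ℂ (Oq D)
  (by rw [counit_eq, ev_one, Bialgebra.counit_one])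
  (by
    intro a b
    rw [counit_eq, ev_mul, Bialgebra.comul_one, Algebra.TensorProduct.one_def]
    rfl)
  (by
    apply ev₂_injective D
    ext X Y
    rw [ev₂_comul', ev_one, Bialgebra.counit_mul, Algebra.TensorProduct.one_def, ev₂_tmul]
    rfl)
  (by
    intro a b
    induction a using coeff_induction with
    | zero => simp
    | add f g hf hg => rw [add_mul, map_add, hf, hg, map_add, add_mul]
    | smul c f hf => rw [smul_mul_assoc, map_smul, hf, map_smul, smul_mul_assoc]
    | coeff V k l =>
      induction b using coeff_induction with
      | zero => simp
      | add f g hf hg => rw [mul_add, map_add, hf, hg, map_add, mul_add]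
      | smul c f hf => rw [mul_smul_comm, map_smul, hf, map_smul, mul_smul_comm]
      | coeff W k' l' =>
        rw [coeff_mul, comul_eq _ V, comul_eq _ W, Finset.sum_mul_sum]
        refine (comul_eq D (V.tensor W) (k, k') (l, l')).trans ?_
        refine (Fintype.sum_prod_type _).trans ?_
        refine Finset.sum_congr rfl fun m _ => Finset.sum_congr rfl fun m' _ => ?_
        rw [Algebra.TensorProduct.tmul_mul_tmul, coeff_mul, coeff_mul])

lemma antipode_mem (f : Oq D) : toConv (ev D f ∘ₗ Uq.S D) ∈ oqSpan D := by
  induction f using coeff_induction with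
  | coeff V k l => exact Submodule.subset_span ⟨V.dual, l, k, rfl⟩
  | zero => rw [map_zero]; exact zero_mem _
  | add f g hf hg => rw [map_add]; exact add_mem hf hg
  | smul c f hf => rw [map_smul]; exact Submodule.smul_mem _ c hf

/-- The antipode of `O_q(G)`, determined by `⟨X, S(f)⟩ = ⟨S(X), f⟩`. -/
def antipode : Oq D →ₗ[ℂ] Oq D where
  toFun f := ⟨toConv (ev D f ∘ₗ Uq.S D), antipode_mem D f⟩
  map_add' f g := by ext X; change ev D (f + g) _ = ev D f _ + ev D g _; rw [map_add]; rfl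
  map_smul' c f := by ext X; change ev D (c • f) _ = c • ev D f _; rw [map_smul]; rfl

lemma ev_antipode (f : Oq D) (X : Uq D) : ev D (antipode D f) X = ev D f (Uq.S D X) := rfl

instance : HopfAlgebra ℂ (Oq D) where
  antipode := antipode D
  mul_antipode_rTensor_comul := by
    refine linearMap_ext fun V k l => ?_
    simp only [LinearMap.comp_apply, comul_eq, map_sum, LinearMap.rTensor_tmul,
      LinearMap.mul'_apply]
    ext X
    have key : ∀ u : Uq D ⊗[ℂ] Uq D, ∑ m, LinearMap.mul' ℂ ℂ
        (TensorProduct.map (ev D (antipode D (coeff V k m))) (ev D (coeff V m l)) u) =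
        V.hom (LinearMap.mul' ℂ (Uq D) ((Uq.S D).rTensor (Uq D) u)) k l := by
      intro u
      induction u with
      | zero => simp
      | add a b ha hb => simp only [map_add, Finset.sum_add_distrib, ha, hb, Matrix.add_apply]
      | tmul a b => simp [Matrix.mul_apply, ev_antipode, ev_coeff]
    simp only [map_sum, LinearMap.sum_apply, ev_mul, key, Uq.antipode_left,
      Algebra.linearMap_apply, Algebra.algebraMap_eq_smul_one, map_smul, LinearMap.smul_apply,
      ev_one, counit_eq, ev_coeff, map_one, Matrix.smul_apply, smul_eq_mul]
    ring
  mul_antipode_lTensor_comul := by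
    refine linearMap_ext fun V k l => ?_
    simp only [LinearMap.comp_apply, comul_eq, map_sum, LinearMap.lTensor_tmul,
      LinearMap.mul'_apply]
    ext X
    have key : ∀ u : Uq D ⊗[ℂ] Uq D, ∑ m, LinearMap.mul' ℂ ℂ
        (TensorProduct.map (ev D (coeff V k m)) (ev D (antipode D (coeff V m l))) u) =
        V.hom (LinearMap.mul' ℂ (Uq D) ((Uq.S D).lTensor (Uq D) u)) k l := by
      intro u
      induction u with
      | zero => simp
      | add a b ha hb => simp only [map_add, Finset.sum_add_distrib, ha, hb, Matrix.add_apply]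
      | tmul a b => simp [Matrix.mul_apply, ev_antipode, ev_coeff]
    simp only [map_sum, LinearMap.sum_apply, ev_mul, key, Uq.antipode_right,
      Algebra.linearMap_apply, Algebra.algebraMap_eq_smul_one, map_smul, LinearMap.smul_apply,
      ev_one, counit_eq, ev_coeff, map_one, Matrix.smul_apply, smul_eq_mul]
    ring

/-- The functional `X ↦ conj ⟨S(X)^*, f⟩`. -/
def starFun (f : Oq D) : Uq D →ₗ[ℂ] ℂ where
  toFun X := starRingEnd ℂ (ev D f (star (Uq.S D X)))
  map_add' X Y := by simp
  map_smul' c X := by simp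

variable {D} in
lemma starFun_apply (f : Oq D) (X : Uq D) :
    starFun D f X = starRingEnd ℂ (ev D f (star (Uq.S D X))) := rfl

lemma starFun_mem (f : Oq D) : toConv (starFun D f) ∈ oqSpan D := by
  induction f using coeff_induction with
  | coeff V k l =>
    refine Submodule.subset_span ⟨V.conj, k, l, ?_⟩
    ext X
    change starFun D _ X = _
    rw [starFun_apply, Uq.star_S]
    rfl
  | zero =>
    convert zero_mem (oqSpan D)
    ext X
    change starFun D _ X = 0
    simp [starFun_apply]
  | add f g hf hg =>
    convert add_mem hf hg
    ext X
    change starFun D _ X = starFun D _ X + starFun D _ X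
    simp [starFun_apply]
  | smul c f hf =>
    convert Submodule.smul_mem _ (starRingEnd ℂ c) hf
    ext X
    change starFun D _ X = _ * starFun D _ X
    simp [starFun_apply]

/-- The `*`-structure of `O_q(G)` dual to the compact real form of `U_q(𝔤)`, determined by
`⟨X, f^*⟩ = conj ⟨S(X)^*, f⟩`. -/
instance : Star (Oq D) where
  star f := ⟨toConv (starFun D f), starFun_mem D f⟩

lemma ev_star (f : Oq D) (X : Uq D) :
    ev D (star f) X = starRingEnd ℂ (ev D f (star (Uq.S D X))) := rfl

lemma ev_star' (f : Oq D) (X : Uq D) :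
    ev D (star f) X = starRingEnd ℂ (ev D f (Uq.tau D X)) := by rw [ev_star, Uq.star_S]

instance : StarRing (Oq D) where
  star_involutive f := by
    ext X
    rw [ev_star', ev_star', Uq.tau_tau, Complex.conj_conj]
  star_add f g := by
    ext X
    simp only [ev_star', map_add, LinearMap.add_apply]
  star_mul f g := by
    ext X
    have key : ∀ u : Uq D ⊗[ℂ] Uq D,
        starRingEnd ℂ (LinearMap.mul' ℂ ℂ (TensorProduct.map (ev D f) (ev D g)
          (star (TensorProduct.comm ℂ _ _ (TensorProduct.map (Uq.S D) (Uq.S D) u))))) =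
        LinearMap.mul' ℂ ℂ (TensorProduct.map (ev D (star g)) (ev D (star f)) u) := by
      intro u
      induction u with
      | zero => simp
      | add a b ha hb => simp only [map_add, star_add, ha, hb]
      | tmul a b => simp [ev_star, mul_comm]
    rw [ev_star, ev_mul, ev_mul, Uq.comul_star, Uq.comul_S, key]

instance : StarModule ℂ (Oq D) where
  star_smul c f := by
    ext X
    simp [ev_star']

end Oq

/-! ### The quantum datum of a simple Lie algebra -/

section Lie

variable {M N : Type*} {κ : Type*} [Fintype κ] [AddCommGroup M] [Module ℂ M] [AddCommGroup N]
  [Module ℂ N] {P : RootPairing κ ℂ M N} [P.IsCrystallographic] (b : P.Base)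

/-- The square length of a simple root, for the canonical Weyl group invariant form. -/
def simpleLength (i : b.support) : ℤ := (P.posRootForm ℤ).rootLength i

/-- The number `d_i = (α_i, α_i)/2`, where the invariant form is normalised such that the shortest
simple roots have square length `2`; that is, the square length of the simple root `α_i` divided by
the smallest square length of a simple root. -/
def halfLength (i : b.support) : ℕ :=
  (simpleLength b i / Finset.univ.inf' ⟨i, Finset.mem_univ i⟩ (simpleLength b)).toNat

variable [P.IsReduced] [P.IsIrreducible]

lemma simpleLength_eq (i : b.support) : 0 < halfLength b i ∧ simpleLength b i =
    halfLength b i * Finset.univ.inf' ⟨i, Finset.mem_univ i⟩ (simpleLength b) := by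
  obtain ⟨j, -, hj⟩ := Finset.exists_mem_eq_inf' (s := Finset.univ) ⟨i, Finset.mem_univ i⟩
    (simpleLength b)
  have hle : simpleLength b j ≤ simpleLength b i := by
    rw [← hj]; exact Finset.inf'_le _ (Finset.mem_univ i)
  have hpos : 0 < simpleLength b j := (P.posRootForm ℤ).rootLength_pos j
  unfold halfLength
  rw [hj]
  have h := (P.posRootForm ℤ).toInvariantForm.apply_eq_or i j
  have e : ∀ k : b.support, (P.posRootForm ℤ).form (P.root k) (P.root k) =
      ((simpleLength b k : ℤ) : ℂ) := fun k =>
    ((P.posRootForm ℤ).algebraMap_rootLength (k : κ)).symm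
  change (P.posRootForm ℤ).form _ _ = (P.posRootForm ℤ).form _ _ ∨
    (P.posRootForm ℤ).form _ _ = 2 * (P.posRootForm ℤ).form _ _ ∨
    (P.posRootForm ℤ).form _ _ = 3 * (P.posRootForm ℤ).form _ _ ∨
    (P.posRootForm ℤ).form _ _ = 2 * (P.posRootForm ℤ).form _ _ ∨
    (P.posRootForm ℤ).form _ _ = 3 * (P.posRootForm ℤ).form _ _ at h
  rw [e, e] at h
  norm_cast at h
  generalize simpleLength b i = x at *
  generalize simpleLength b j = y at *
  rcases h with h | h | h | h | h
  · subst h; simp [Int.ediv_self hpos.ne']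
  · subst h; simp [hpos.ne']
  · subst h; simp [hpos.ne']
  · omega
  · omega

/-- The quantum datum of a reduced irreducible crystallographic root system with a base. -/
def quantumDatum (q : ℝ) (h0 : q ≠ 0) (h1 : q ≠ 1) (h2 : q ≠ -1) : QuantumDatum b.support where
  a i j := b.cartanMatrix j i
  d := halfLength b
  a_diag i := b.cartanMatrix_apply_same i
  a_offDiag i j h := b.cartanMatrix_le_zero_of_ne j i h.symm
  d_pos i := (simpleLength_eq b i).1
  symm i j := by
    have hi := (simpleLength_eq b i).2
    have hj := (simpleLength_eq b j).2
    have key : b.cartanMatrix j i * simpleLength b i = b.cartanMatrix i j * simpleLength b j :=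
      (P.posRootForm ℤ).pairingIn_mul_eq_pairingIn_mul_swap (i : κ) (j : κ)
    have hpos : 0 < Finset.univ.inf' ⟨i, Finset.mem_univ i⟩ (simpleLength b) := by
      obtain ⟨k, -, hk⟩ := Finset.exists_mem_eq_inf' (s := Finset.univ) ⟨i, Finset.mem_univ i⟩
        (simpleLength b)
      rw [hk]
      exact (P.posRootForm ℤ).rootLength_pos k
    rw [hi, hj] at key
    generalize Finset.univ.inf' ⟨i, Finset.mem_univ i⟩ (simpleLength b) = m at *
    apply mul_right_cancel₀ hpos.ne'
    linear_combination key
  q := q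
  q_ne_zero := h0
  q_ne_one := h1
  q_ne_neg_one := h2

end Lie


/-! ### Comodules and compact quantum group algebras -/

section Comodule

variable (A : Type*) [Ring A] [HopfAlgebra ℂ A]

/-- A Haar functional: a normalised left and right invariant functional. -/
structure IsHaar (h : A →ₗ[ℂ] ℂ) : Prop where
  map_one : h 1 = 1
  left : ∀ a, TensorProduct.rid ℂ A (h.lTensor A (Coalgebra.comul a)) = algebraMap ℂ A (h a)
  right : ∀ a, TensorProduct.lid ℂ A (h.rTensor A (Coalgebra.comul a)) = algebraMap ℂ A (h a)

/-- Compact matrix quantum group algebras: finitely generated Hopf `*`-algebras with a positive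
definite Haar functional (whose existence is equivalent to cosemisimplicity). -/
structure IsCMQGA [StarRing A] [StarModule ℂ A] : Prop where
  comul_star : ∀ a : A, Coalgebra.comul (R := ℂ) (star a) = star (Coalgebra.comul (R := ℂ) a)
  finiteType : Algebra.FiniteType ℂ A
  haar : ∃ h : A →ₗ[ℂ] ℂ, IsHaar A h ∧ ∀ a, a ≠ 0 → 0 < (h (star a * a)).re ∧
    (h (star a * a)).im = 0

variable {A}
variable {V M : Type*} [AddCommGroup V] [Module ℂ V] [AddCommGroup M] [Module ℂ M]

/-- Left coactions of a Hopf algebra on a vector space. -/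
structure IsCoaction (δ : M →ₗ[ℂ] A ⊗[ℂ] M) : Prop where
  coassoc : (TensorProduct.assoc ℂ A A M).toLinearMap ∘ₗ
    (Coalgebra.comul (R := ℂ) (A := A)).rTensor M ∘ₗ δ = δ.lTensor A ∘ₗ δ
  counit : (TensorProduct.lid ℂ M).toLinearMap ∘ₗ
    (Coalgebra.counit (R := ℂ) (A := A)).rTensor M ∘ₗ δ = LinearMap.id

/-- The subspace `W` satisfies `δ(W) ⊆ A ⊗ W`. -/
def IsSubcomodule (δ : M →ₗ[ℂ] A ⊗[ℂ] M) (W : Submodule ℂ M) : Prop :=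
  ∀ w ∈ W, δ w ∈ LinearMap.range (W.subtype.lTensor A)

/-- Irreducible subcomodules. -/
structure IsIrreducibleSubcomodule (δ : M →ₗ[ℂ] A ⊗[ℂ] M) (W : Submodule ℂ M) : Prop where
  isSubcomodule : IsSubcomodule δ W
  ne_bot : W ≠ ⊥
  eq_bot_or_eq : ∀ W' ≤ W, IsSubcomodule δ W' → W' = ⊥ ∨ W' = W

/-- The space of comodule maps from `V` to the subcomodule `C` of `M`. -/
def comoduleHom (δV : V →ₗ[ℂ] A ⊗[ℂ] V) (δ : M →ₗ[ℂ] A ⊗[ℂ] M) (C : Submodule ℂ M) :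
    Submodule ℂ (V →ₗ[ℂ] M) where
  carrier := {f | δ ∘ₗ f = f.lTensor A ∘ₗ δV ∧ ∀ v, f v ∈ C}
  add_mem' := fun {f g} hf hg => ⟨by
      rw [LinearMap.comp_add, hf.1, hg.1, LinearMap.lTensor_add, LinearMap.add_comp],
    fun v => C.add_mem (hf.2 v) (hg.2 v)⟩
  zero_mem' := ⟨by simp, fun _ => C.zero_mem⟩
  smul_mem' := fun c f hf => ⟨by
      rw [LinearMap.comp_smul, hf.1, LinearMap.lTensor_smul, LinearMap.smul_comp],
    fun v => C.smul_mem c (hf.2 v)⟩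

/-- The subcomodule `C` of `M` contains every irreducible comodule with multiplicity at most one.
(Irreducible comodules are finite-dimensional, so that it suffices to consider those in `Type`.) -/
def MultiplicityFree (δ : M →ₗ[ℂ] A ⊗[ℂ] M) (C : Submodule ℂ M) : Prop :=
  ∀ (V : Type) [AddCommGroup V] [Module ℂ V] (δV : V →ₗ[ℂ] A ⊗[ℂ] V), IsCoaction δV →
    IsIrreducibleSubcomodule δV ⊤ → Module.rank ℂ (comoduleHom δV δ C) ≤ 1

end Comodule

/-! ### Quantum homogeneous spaces -/

section Calculus

variable {A H : Type*} [Ring A] [HopfAlgebra ℂ A] [Ring H] [HopfAlgebra ℂ H]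

/-- The quantum homogeneous space `B = A^{co(H)}` of coinvariants of the right `H`-coaction
`(id ⊗ π) ∘ Δ` on `A`. -/
def coinvariants (π : A →ₐc[ℂ] H) : Subalgebra ℂ A :=
  AlgHom.equalizer
    ((Algebra.TensorProduct.map (AlgHom.id ℂ A) (π : A →ₐ[ℂ] H)).comp (Bialgebra.comulAlgHom ℂ A))
    (Algebra.TensorProduct.includeLeft : A →ₐ[ℂ] A ⊗[ℂ] H)

/-- `B = A^{co(H)}` is a CMQGA-homogeneous space. -/
structure IsCMQGAHomogeneous [StarRing A] [StarModule ℂ A] [StarRing H] [StarModule ℂ H]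
    (π : A →ₐc[ℂ] H) : Prop where
  left : IsCMQGA A
  right : IsCMQGA H
  surjective : Function.Surjective π
  map_star : ∀ a, π (star a) = star (π a)

/-- The quantum homogeneous space is self-conjugate: every irreducible subcomodule of `B` is a
`*`-closed subspace. -/
def IsSelfConjugate [StarRing A] (B : Subalgebra ℂ A) : Prop :=
  ∀ V : Submodule ℂ A, V ≤ Subalgebra.toSubmodule B →
    IsIrreducibleSubcomodule (Coalgebra.comul (R := ℂ) (A := A)) V → (V : Set A) = star '' V

/-- The cone `B_{>0}` of nonzero elements of the form `∑ i, c_i b_i^* b_i`, with `c_i > 0`. -/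
def positiveCone [StarRing A] (B : Subalgebra ℂ A) : Set A :=
  {a | a ≠ 0 ∧ ∃ (l : ℕ) (c : Fin l → ℝ) (b : Fin l → B), (∀ i, 0 < c i) ∧
    a = ∑ i, (c i : ℂ) • (star (b i : A) * (b i : A))}

variable [StarRing A] (B : Subalgebra ℂ A) (Ω : Type*) [Ring Ω] [Algebra ℂ Ω]

/-- Differential `*`-calculi over `B`. -/
structure DiffStarCalculus where
  /-- The space of forms of degree `k`. -/
  deg : ℕ → Submodule ℂ Ω
  isInternal : DirectSum.IsInternal deg
  one_mem : (1 : Ω) ∈ deg 0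
  mul_mem : ∀ {k l : ℕ} {x y : Ω}, x ∈ deg k → y ∈ deg l → x * y ∈ deg (k + l)
  /-- The identification of `B` with the forms of degree `0`. -/
  incl : B →ₐ[ℂ] Ω
  incl_injective : Function.Injective incl
  mem_deg_zero : ∀ x, x ∈ deg 0 ↔ ∃ b, incl b = x
  /-- The exterior derivative. -/
  d : Ω →ₗ[ℂ] Ω
  d_mem : ∀ {k : ℕ} {x : Ω}, x ∈ deg k → d x ∈ deg (k + 1)
  d_d : ∀ x, d (d x) = 0
  d_mul : ∀ {k : ℕ} {x : Ω} (y : Ω), x ∈ deg k → d (x * y) = d x * y + (-1) ^ k * (x * d y)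
  generated : Algebra.adjoin ℂ ((deg 0 : Set Ω) ∪ d '' (deg 0 : Set Ω)) = ⊤
  /-- The `*`-map on forms. -/
  st : Ω →ₗ⋆[ℂ] Ω
  st_st : ∀ x, st (st x) = x
  st_mul : ∀ {k l : ℕ} {x y : Ω}, x ∈ deg k → y ∈ deg l → st (x * y) = (-1) ^ (k * l) * (st y * st x)
  st_d : ∀ x, st (d x) = d (st x)
  st_incl : ∀ b b' : B, (b' : A) = star (b : A) → st (incl b) = incl b'

namespace DiffStarCalculus

variable {B Ω} (X : DiffStarCalculus B Ω)

/-- The calculus has total degree `m`. -/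
def HasTotalDegree (m : ℕ) : Prop := X.deg m ≠ ⊥ ∧ ∀ k, m < k → X.deg k = ⊥

/-- The calculus is connected: the only closed elements of `B` are the scalars. -/
def IsConnected : Prop := ∀ b : B, X.d (X.incl b) = 0 → ∃ c : ℂ, b = algebraMap ℂ B c

/-- The coaction `δ` makes the calculus covariant: it is a comodule algebra structure which extends
the coaction `Δ` of `B` and for which `d` is a comodule map. -/
structure IsCovariant (δ : Ω →ₐ[ℂ] A ⊗[ℂ] Ω) : Prop where
  isCoaction : IsCoaction δ.toLinearMap
  extends_comul : ∀ b : B, ∃ t : A ⊗[ℂ] B, B.val.toLinearMap.lTensor A t =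
    Coalgebra.comul (R := ℂ) (b : A) ∧ X.incl.toLinearMap.lTensor A t = δ (X.incl b)
  d_comm : ∀ x, δ (X.d x) = X.d.lTensor A (δ x)

/-- The subspace `B⁺Ω`, where `B⁺ = B ∩ ker ε`. -/
def plusMul : Submodule ℂ Ω :=
  Submodule.span ℂ {x | ∃ (b : B) (y : Ω), Coalgebra.counit (R := ℂ) (b : A) = 0 ∧ x = X.incl b * y}

/-- The component of degree `k` of a form. -/
def component (k : ℕ) : Ω →ₗ[ℂ] Ω :=
  (X.deg k).subtype ∘ₗ DirectSum.component ℂ ℕ (fun k => X.deg k) k ∘ₗ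
    (LinearEquiv.ofBijective (DirectSum.coeLinearMap X.deg) X.isInternal).symm.toLinearMap

end DiffStarCalculus

end Calculus

/-! ### CQH-spaces -/

variable (A H Ω : Type*) [Ring A] [HopfAlgebra ℂ A] [StarRing A] [StarModule ℂ A]
  [Ring H] [HopfAlgebra ℂ H] [StarRing H] [StarModule ℂ H] [Ring Ω] [Algebra ℂ Ω]

/-- Compact quantum calculus homogeneous spaces. -/
structure CQHCalculusSpace where
  /-- The projection defining the homogeneous space `B = A^{co(H)}`. -/
  proj : A →ₐc[ℂ] H
  homogeneous : IsCMQGAHomogeneous proj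
  isDomain : IsDomain A
  /-- The calculus. -/
  forms : DiffStarCalculus (coinvariants proj) Ω
  /-- The coaction of `A` on the calculus. -/
  coact : Ω →ₐ[ℂ] A ⊗[ℂ] Ω
  covariant : forms.IsCovariant coact
  mul_plus : ∀ (x : Ω) (b : coinvariants proj), Coalgebra.counit (R := ℂ) (b : A) = 0 →
    x * forms.incl b ∈ forms.plusMul
  finiteDimensional : FiniteDimensional ℂ (Ω ⧸ forms.plusMul)
  /-- The total degree. -/
  m : ℕ
  totalDegree : forms.HasTotalDegree m
  /-- The isomorphism of the forms of top degree with `B`. -/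
  vol : forms.deg m ≃ₗ[ℂ] coinvariants proj
  vol_mul_left : ∀ (b : coinvariants proj) (x y : forms.deg m), (y : Ω) = forms.incl b * x →
    vol y = b * vol x
  vol_mul_right : ∀ (b : coinvariants proj) (x y : forms.deg m), (y : Ω) = x * forms.incl b →
    vol y = vol x * b
  vol_coact : ∀ x : forms.deg m, ∃ t : A ⊗[ℂ] forms.deg m,
    (forms.deg m).subtype.lTensor A t = coact x ∧
    ((coinvariants proj).val.toLinearMap ∘ₗ vol.toLinearMap).lTensor A t =
      Coalgebra.comul (R := ℂ) (vol x : A)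
  vol_star : ∀ x y : forms.deg m, (y : Ω) = forms.st x → (vol y : A) = star (vol x : A)
  integral_closed : ∀ h : A →ₗ[ℂ] ℂ, IsHaar A h → ∀ (k : ℕ) (x : Ω) (y : forms.deg m), k + 1 = m →
    x ∈ forms.deg k → (y : Ω) = forms.d x → h (vol y : A) = 0

/-- Compact quantum homogeneous complex spaces: CQH-calculus spaces with a covariant complex
structure. -/
structure CQHComplexSpace extends CQHCalculusSpace A H Ω where
  /-- The space of `(a, b)`-forms, for `p = (a, b)`. -/
  bideg : ℕ × ℕ → Submodule ℂ Ω
  isInternal : DirectSum.IsInternal bideg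
  mul_mem : ∀ {p r : ℕ × ℕ} {x y : Ω}, x ∈ bideg p → y ∈ bideg r → x * y ∈ bideg (p + r)
  deg_eq : ∀ k, forms.deg k = ⨆ (p : ℕ × ℕ) (_ : p.1 + p.2 = k), bideg p
  st_mem : ∀ {a b : ℕ} {x : Ω}, x ∈ bideg (a, b) → forms.st x ∈ bideg (b, a)
  d_mem : ∀ {a b : ℕ} {x : Ω}, x ∈ bideg (a, b) → forms.d x ∈ bideg (a + 1, b) ⊔ bideg (a, b + 1)
  isSubcomodule : ∀ p, IsSubcomodule coact.toLinearMap (bideg p)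

namespace CQHComplexSpace

variable {A H Ω} (X : CQHComplexSpace A H Ω)

/-- The decomposition of forms into `(a, b)`-forms. -/
def decomp : Ω ≃ₗ[ℂ] DirectSum (ℕ × ℕ) fun p => X.bideg p :=
  (LinearEquiv.ofBijective (DirectSum.coeLinearMap X.bideg) X.isInternal).symm

/-- The component in `Ω^{(a, b)}` of a form, for `p = (a, b)`. -/
def component (p : ℕ × ℕ) : Ω →ₗ[ℂ] Ω :=
  (X.bideg p).subtype ∘ₗ DirectSum.component ℂ (ℕ × ℕ) (fun p => X.bideg p) p ∘ₗ
    X.decomp.toLinearMap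

/-- The holomorphic derivative, given on `Ω^{(a, b)}` by `d` followed by the projection to
`Ω^{(a + 1, b)}`. -/
def del : Ω →ₗ[ℂ] Ω :=
  DirectSum.toModule ℂ (ℕ × ℕ) Ω (fun p => X.component (p.1 + 1, p.2) ∘ₗ X.forms.d ∘ₗ
    (X.bideg p).subtype) ∘ₗ X.decomp.toLinearMap

/-- The anti-holomorphic derivative, given on `Ω^{(a, b)}` by `d` followed by the projection to
`Ω^{(a, b + 1)}`. -/
def delbar : Ω →ₗ[ℂ] Ω :=
  DirectSum.toModule ℂ (ℕ × ℕ) Ω (fun p => X.component (p.1, p.2 + 1) ∘ₗ X.forms.d ∘ₗ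
    (X.bideg p).subtype) ∘ₗ X.decomp.toLinearMap

/-- The complex structure is of Gelfand type: `Ω^{(0, •)}` is graded multiplicity-free. -/
def IsGelfandType : Prop := ∀ k, MultiplicityFree X.coact.toLinearMap (X.bideg (0, k))

variable (n : ℕ) (σ : Ω)

/-- The primitive `(a, b)`-forms, for the Hermitian form `σ` and total degree `2n`. -/
def IsPrimitive (a b : ℕ) (x : Ω) : Prop :=
  a + b ≤ n ∧ x ∈ X.bideg (a, b) ∧ σ ^ (n - (a + b) + 1) * x = 0

/-- The characterisation of the Hodge map: if `x` is a primitive `(a, b)`-form, `k = a + b`, then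
`*(σ^j x) = (-1)^{k(k+1)/2} i^{a-b} (j!/(n-j-k)!) σ^{n-j-k} x`. -/
def IsHodge (T : Ω →ₗ[ℂ] Ω) : Prop :=
  ∀ (a b j : ℕ) (x : Ω), X.IsPrimitive n σ a b x → j + (a + b) ≤ n →
    T (σ ^ j * x) = ((-1) ^ ((a + b) * (a + b + 1) / 2) * Complex.I ^ ((a : ℤ) - b) *
      (j.factorial / (n - j - (a + b)).factorial)) • (σ ^ (n - j - (a + b)) * x)

open Classical in
/-- The Hodge map: the map characterised by `IsHodge`. -/
def hodge : Ω →ₗ[ℂ] Ω := if h : ∃ T, X.IsHodge n σ T then h.choose else 0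

/-- The metric `g(ω, ν)`, equal to `*(*(ω^*) ν)` for `ω`, `ν` of the same degree, and zero for forms
of different degrees. -/
def metric (x y : Ω) : Ω :=
  ∑ k ∈ Finset.range (2 * n + 1), X.hodge n σ
    (X.hodge n σ (X.forms.st (X.forms.component k x)) * X.forms.component k y)

end CQHComplexSpace

/-- Compact quantum homogeneous Hermitian spaces. -/
structure CQHHermitianSpace extends CQHComplexSpace A H Ω where
  /-- Half of the total degree. -/
  n : ℕ
  m_eq : m = 2 * n
  /-- The Hermitian form. -/
  σ : Ω
  σ_mem : σ ∈ bideg (1, 1)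
  σ_central : ∀ x, σ * x = x * σ
  σ_real : forms.st σ = σ
  σ_coinvariant : coact σ = 1 ⊗ₜ[ℂ] σ
  lefschetz : ∀ k < n, Set.BijOn (fun x => σ ^ (n - k) * x) (forms.deg k) (forms.deg (2 * n - k))
  vol_eq : ∀ x : forms.deg m, forms.incl (vol x) = toCQHComplexSpace.hodge n σ (x : Ω)
  metric_pos : ∀ x, x ≠ 0 → ∃ b : coinvariants proj,
    (b : A) ∈ positiveCone (coinvariants proj) ∧
      toCQHComplexSpace.metric n σ x x = forms.incl b

namespace CQHHermitianSpace

variable {A H Ω} (X : CQHHermitianSpace A H Ω)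

/-- The quantum homogeneous space underlying a CQH-Hermitian space. -/
abbrev space : Subalgebra ℂ A := coinvariants X.proj

/-- The Hodge map `*_σ`. -/
abbrev hodgeStar : Ω →ₗ[ℂ] Ω := X.hodge X.n X.σ

/-- The adjoint `-*_σ ∘ ∂ ∘ *_σ` of the anti-holomorphic derivative. -/
def delbarAdj : Ω →ₗ[ℂ] Ω := -(X.hodgeStar ∘ₗ X.del ∘ₗ X.hodgeStar)

/-- The anti-holomorphic Laplacian. -/
def laplacian : Ω →ₗ[ℂ] Ω := (X.delbar + X.delbarAdj) ∘ₗ (X.delbar + X.delbarAdj)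

end CQHHermitianSpace

/-! ### Highest weight vectors -/

namespace Oq

/-- The action `X ▹ a = ⟨S(X), a₍₋₁₎⟩ a₍₀₎` of `U_q(𝔤)` on `O_q(G)`, induced by the left coaction
of `O_q(G)` on itself. -/
def act (X : Uq D) : Oq D →ₗ[ℂ] Oq D :=
  (TensorProduct.lid ℂ (Oq D)).toLinearMap ∘ₗ ((ev D).flip (Uq.S D X)).rTensor (Oq D) ∘ₗ
    Coalgebra.comul (R := ℂ)

/-- Highest weight vectors, of weight `∑ i, μ_i ϖ_i`. -/
structure IsHighestWeight (a : Oq D) : Prop where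
  ne_zero : a ≠ 0
  act_E : ∀ i, act D (Uq.E D i) a = 0
  act_K : ∃ μ : ι → ℤ, ∀ i, act D (Uq.K D i) a = D.qi i ^ μ i • a

end Oq

end QG

end

/-!
The conclusion is an instance of a statement about the quantised coordinate algebra `A = O_q(G)`
alone: if `a, z ∈ A` are nonzero and `a z = λ z a` with `λ` real, then `λ > 0`
(`QG.Oq.pos_of_mul_eq`). Both assertions of the theorem follow from `λ_z > 0`.

*From forms to `A`.* Every form `ν` gives a functional `φ(x) = ε(vol(x ∧ ν))` on `Ω`, for which
`φ(b x) = ε(b) φ(x) = φ(x b)` when `b ∈ B`; the second equality is the condition `Ω B⁺ ⊆ B⁺ Ω`. So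
`ω ↦ ω₍₋₁₎ φ(ω₍₀₎)` is a map of `B`-bimodules from `Ω` to `A` (`QG.CQHCalculusSpace.fibreMap`). As
the metric is positive definite, these maps separate the points of `Ω^{(1,0)}`
(`QG.CQHHermitianSpace.exists_fibreMap_ne_zero`). If `∂z ≠ 0`, one of them takes `∂z` to a nonzero
`a ∈ A`, and `(∂z) z = λ z ∂z` becomes `a z = λ z a`.

*`∂z` is nonzero.* The kernel of `∂` on `B` is a subcomodule. Orthogonal complements for the Haar
inner product decompose its finite-dimensional subcomodules into irreducible ones, which are closed
under `*` as the space is self-conjugate. Hence an element of `B` killed by `∂` is killed by `∂̄`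
(`QG.CQHComplexSpace.kerDel_le_kerDelbar`), and is then harmonic.

*Positivity in `A`.* The algebra `U_q(𝔤)` acts on `A` by left and by right translation. The
`K_i` act by algebra endomorphisms that are diagonalisable with positive eigenvalues. For `q_i < 0`
this is not automatic: it is a consequence of the positivity of the Haar functional
(`QG.Oq.zpow_wt_pos`). Comparing the components of the largest eigenvalues, one may assume that `a`
and `z` are weight vectors. The left translations by `E_i` and the right translations by `F_i`
are locally nilpotent, and on weight vectors they are skew derivations with positive coefficients.
So if `D` is one of them and `D^m a`, `D^n z` are the last nonzero iterates, then `D^{m+n}` takes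
`a z` and `z a` to positive multiples of `(D^m a)(D^n z)` and `(D^n z)(D^m a)`. This reduces the
claim to weight vectors killed by all these operators (`QG.pos_of_mul_eq_smul_mul`). By the
decomposition `U_q(𝔤) = U⁺ U⁰ U⁻` the counit does not vanish at nonzero vectors of this kind
(`QG.Oq.eq_zero_of_counit_eq_zero`), and applying it to `a z = λ z a` gives `λ = 1`.
-/

noncomputable section

namespace QG

open scoped TensorProduct

/-! ### Positivity of commutation constants in algebras with a torus action -/

section Positivity

variable {A : Type*} [Ring A] [Algebra ℂ A]

/-- A simultaneous eigenvector, with positive real eigenvalues, of a family of operators. The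
vector zero is allowed. -/
def IsPosWeight {τ : Type*} (T : τ → Module.End ℂ A) (a : A) : Prop :=
  ∀ t, ∃ c : ℝ, 0 < c ∧ T t a = (c : ℂ) • a

/-- The elements annihilated by all words of length `N` in the operators `E j`; for `N = 0` this is
the zero subspace. -/
def wordKernel {J : Type*} (E : J → Module.End ℂ A) : ℕ → Submodule ℂ A
  | 0 => ⊥
  | N + 1 => ⨅ j, (wordKernel E N).comap (E j)

lemma mem_wordKernel_succ {J : Type*} {E : J → Module.End ℂ A} {N : ℕ} {a : A} :
    a ∈ wordKernel E (N + 1) ↔ ∀ j, E j a ∈ wordKernel E N := by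
  simp [wordKernel]

lemma wordKernel_mono {J : Type*} (E : J → Module.End ℂ A) : Monotone (wordKernel E) := by
  refine monotone_nat_of_le_succ fun N => ?_
  induction N with
  | zero => exact bot_le
  | succ N ih => exact fun a ha => mem_wordKernel_succ.2 fun j => ih (mem_wordKernel_succ.1 ha j)

lemma pow_mem_wordKernel {J : Type*} {E : J → Module.End ℂ A} (j : J) (m : ℕ) :
    ∀ {N : ℕ} {a : A}, a ∈ wordKernel E (N + m) → (E j ^ m) a ∈ wordKernel E N := by
  induction m with
  | zero => intro N a h; simpa using h
  | succ m ih =>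
    intro N a h
    rw [pow_succ]
    exact ih (mem_wordKernel_succ.1 h j)

/-- The last nonzero iterate of a locally nilpotent operator. -/
lemma exists_last_pow {J : Type*} {E : J → Module.End ℂ A} (j : J) {N : ℕ} {a : A}
    (ha : a ∈ wordKernel E N) (h0 : a ≠ 0) :
    ∃ m r, N = r + m ∧ (E j ^ m) a ≠ 0 ∧ E j ((E j ^ m) a) = 0 ∧
      (E j ^ m) a ∈ wordKernel E r := by
  classical
  have hex : ∃ m, (E j ^ m) a = 0 := ⟨N, by
    have := pow_mem_wordKernel (E := E) j N (N := 0) (a := a) (by simpa using ha)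
    simpa [wordKernel] using this⟩
  obtain ⟨m, hm⟩ : ∃ m, Nat.find hex = m + 1 := by
    refine Nat.exists_eq_succ_of_ne_zero fun h => h0 ?_
    simpa [h] using Nat.find_spec hex
  have hN : Nat.find hex ≤ N := Nat.find_min' hex (by
    have := pow_mem_wordKernel (E := E) j N (N := 0) (a := a) (by simpa using ha)
    simpa [wordKernel] using this)
  obtain ⟨r, rfl⟩ : ∃ r, N = r + m := ⟨N - m, by omega⟩
  refine ⟨m, r, rfl, Nat.find_min hex (by omega), ?_, pow_mem_wordKernel j m ha⟩
  have := Nat.find_spec hex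
  rwa [hm, pow_succ'] at this

/-- If a linear operator is a skew derivation with positive coefficients on a class of elements,
then its highest nonvanishing iterate on a product is a positive multiple of the product of the
highest iterates. -/
lemma exists_pow_mul_eq {E : Module.End ℂ A} {p : A → Prop} (hp : ∀ a, p a → p (E a))
    (hE : ∀ a b, p a → p b → ∃ s t : ℝ, 0 < s ∧ 0 < t ∧
      E (a * b) = (s : ℂ) • (E a * b) + (t : ℂ) • (a * E b)) (m n : ℕ) :
    ∀ a b, p a → p b → (E ^ (m + 1)) a = 0 → (E ^ (n + 1)) b = 0 →
      ∃ c : ℝ, 0 < c ∧ (E ^ (m + n)) (a * b) = (c : ℂ) • ((E ^ m) a * (E ^ n) b) := by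
  induction hk : m + n generalizing m n with
  | zero =>
    obtain ⟨rfl, rfl⟩ : m = 0 ∧ n = 0 := by omega
    intro a b _ _ _ _
    exact ⟨1, one_pos, by simp⟩
  | succ k ih =>
    intro a b ha hb ha0 hb0
    obtain ⟨s, t, hs, ht, hst⟩ := hE a b ha hb
    have hL : ∃ c : ℝ, 0 ≤ c ∧ (m ≠ 0 → 0 < c) ∧
        (E ^ k) (E a * b) = (c : ℂ) • ((E ^ m) a * (E ^ n) b) := by
      cases m with
      | zero =>
        have : E a = 0 := by simpa using ha0
        exact ⟨0, le_rfl, by simp, by simp [this]⟩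
      | succ m =>
        obtain ⟨c, hc, h⟩ := ih m n (by omega) (E a) b (hp a ha) hb
          (by rwa [pow_succ] at ha0) hb0
        exact ⟨c, hc.le, fun _ => hc, by rw [h, pow_succ E m]; rfl⟩
    have hR : ∃ c : ℝ, 0 ≤ c ∧ (n ≠ 0 → 0 < c) ∧
        (E ^ k) (a * E b) = (c : ℂ) • ((E ^ m) a * (E ^ n) b) := by
      cases n with
      | zero =>
        have : E b = 0 := by simpa using hb0
        exact ⟨0, le_rfl, by simp, by simp [this]⟩
      | succ n =>
        obtain ⟨c, hc, h⟩ := ih m n (by omega) a (E b) ha (hp b hb) ha0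
          (by rwa [pow_succ] at hb0)
        exact ⟨c, hc.le, fun _ => hc, by rw [h, pow_succ E n]; rfl⟩
    obtain ⟨c₁, h₁, h₁', e₁⟩ := hL
    obtain ⟨c₂, h₂, h₂', e₂⟩ := hR
    refine ⟨s * c₁ + t * c₂, ?_, ?_⟩
    · by_cases hm : m = 0
      · have := h₂' (by omega)
        positivity
      · have := h₁' hm
        positivity
    · rw [pow_succ, Module.End.mul_apply, hst, map_add, map_smul, map_smul, e₁, e₂, smul_smul,
        smul_smul, ← add_smul]
      push_cast
      rfl

/-- Leading terms: a commutation relation is inherited by the components of the largest eigenvalue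
of an algebra endomorphism `T` that is diagonalisable with positive eigenvalues. -/
lemma exists_leading {T : Module.End ℂ A} (hmul : ∀ a b, T (a * b) = T a * T b)
    (hspan : ⨆ c : {c : ℝ // 0 < c}, T.eigenspace ((c : ℝ) : ℂ) = ⊤) {a z : A} {l : ℂ}
    (ha : a ≠ 0) (hz : z ≠ 0) (h : a * z = l • (z * a)) :
    ∃ a' z' : A, a' ≠ 0 ∧ z' ≠ 0 ∧ a' * z' = l • (z' * a') ∧
      (∃ c : ℝ, 0 < c ∧ T a' = (c : ℂ) • a') ∧ (∃ c : ℝ, 0 < c ∧ T z' = (c : ℂ) • z') ∧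
      ∀ S : Module.End ℂ A, Commute S T → ∀ s : ℂ,
        (S a = s • a → S a' = s • a') ∧ (S z = s • z → S z' = s • z') := by
  classical
  let E : {c : ℝ // 0 < c} → Submodule ℂ A := fun c => T.eigenspace ((c : ℝ) : ℂ)
  have hind : iSupIndep E := T.eigenspaces_iSupIndep.comp
    (f := fun c : {c : ℝ // 0 < c} => ((c : ℝ) : ℂ))
    (fun c c' h => Subtype.ext (Complex.ofReal_injective h))
  have hint := DirectSum.isInternal_submodule_of_iSupIndep_of_iSup_eq_top hind hspan
  let 𝒟 : DirectSum.Decomposition E := hint.chooseDecomposition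
  let p : {c : ℝ // 0 < c} → A → A := fun c x => (DirectSum.decompose E x c : A)
  have hpE : ∀ c x, p c x ∈ E c := fun c x => (DirectSum.decompose E x c).2
  have padd : ∀ c x y, p c (x + y) = p c x + p c y := fun c x y => by
    simp [p, DirectSum.decompose_add]
  have psmul : ∀ c (r : ℂ) x, p c (r • x) = r • p c x := fun c r x => by
    simp only [p, DirectSum.decompose_smul]; rfl
  have psum : ∀ c (s : Finset {c : ℝ // 0 < c}) (f : {c : ℝ // 0 < c} → A),
      p c (∑ i ∈ s, f i) = ∑ i ∈ s, p c (f i) := by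
    intro c s f
    induction s using Finset.induction with
    | empty => simp [p]
    | insert i s hi ih => rw [Finset.sum_insert hi, padd, ih, Finset.sum_insert hi]
  have psame : ∀ c x, x ∈ E c → p c x = x := fun c x hx => DirectSum.decompose_of_mem_same E hx
  have pne : ∀ c c' x, x ∈ E c → c ≠ c' → p c' x = 0 := fun c c' x hx hc =>
    DirectSum.decompose_of_mem_ne E hx hc
  have hsum : ∀ x, ∑ c ∈ (DirectSum.decompose E x).support, p c x = x := fun x =>
    DirectSum.sum_support_decompose E x
  have hEmul : ∀ c c' x y, x ∈ E c → y ∈ E c' → x * y ∈ E (c * c') := by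
    intro c c' x y hx hy
    simp only [E, Module.End.mem_eigenspace_iff] at hx hy ⊢
    rw [hmul, hx, hy]
    rw [smul_mul_assoc, mul_smul_comm, smul_smul]
    congr 1
    exact (Complex.ofReal_mul _ _).symm
  have hsupp : ∀ x, x ≠ 0 → ∃ c, p c x ≠ 0 ∧
      ∀ c' ∈ (DirectSum.decompose E x).support, c' ≤ c := by
    intro x hx
    have hne : (DirectSum.decompose E x).support.Nonempty := by
      rw [Finset.nonempty_iff_ne_empty]
      intro h0
      apply hx
      rw [← hsum x, h0, Finset.sum_empty]
    refine ⟨Finset.max' _ hne, ?_, fun c' hc' => Finset.le_max' _ c' hc'⟩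
    have := Finset.max'_mem _ hne
    rw [DFinsupp.mem_support_iff] at this
    simpa [p] using this
  -- As eigenvalues multiply, this is the component of `x * y` at the
  -- product of the largest eigenvalues.
  have hlead : ∀ x y c₁ c₂, (∀ c' ∈ (DirectSum.decompose E x).support, c' ≤ c₁) →
      (∀ c' ∈ (DirectSum.decompose E y).support, c' ≤ c₂) →
      p (c₁ * c₂) (x * y) = p c₁ x * p c₂ y := by
    intro x y c₁ c₂ h1 h2
    conv_lhs => rw [← hsum x, ← hsum y, Finset.sum_mul_sum, psum]
    have hz : ∀ w (c : {c : ℝ // 0 < c}), c ∉ (DirectSum.decompose E w).support → p c w = 0 := by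
      intro w c hc
      rw [DFinsupp.notMem_support_iff] at hc
      simp [p, hc]
    rw [Finset.sum_eq_single c₁, psum, Finset.sum_eq_single c₂]
    · exact psame _ _ (hEmul _ _ _ _ (hpE _ _) (hpE _ _))
    · intro c hc hne
      refine pne _ _ _ (hEmul _ _ _ _ (hpE _ _) (hpE _ _)) ?_
      intro he
      exact hne (mul_left_cancel he)
    · intro hc
      rw [hz y c₂ hc, mul_zero]
      exact psame _ _ (zero_mem _)
    · intro c hc hne
      rw [psum]
      refine Finset.sum_eq_zero fun c' hc' => ?_
      refine pne _ _ _ (hEmul _ _ _ _ (hpE _ _) (hpE _ _)) (ne_of_lt ?_)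
      exact mul_lt_mul_of_lt_of_le (lt_of_le_of_ne (h1 c hc) hne) (h2 c' hc')
    · intro hc
      rw [psum]
      refine Finset.sum_eq_zero fun c' _ => ?_
      rw [hz x c₁ hc, zero_mul]
      exact psame _ _ (zero_mem _)
  have hcomm : ∀ S : Module.End ℂ A, Commute S T → ∀ c x, p c (S x) = S (p c x) := by
    intro S hS c x
    have hSE : ∀ c x, x ∈ E c → S x ∈ E c := by
      intro c x hx
      simp only [E, Module.End.mem_eigenspace_iff] at hx ⊢
      rw [← Module.End.mul_apply, ← hS.eq, Module.End.mul_apply, hx, map_smul]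
    conv_lhs => rw [← hsum x, map_sum, psum]
    by_cases hc : c ∈ (DirectSum.decompose E x).support
    · rw [Finset.sum_eq_single c (fun c' _ hne => pne _ _ _ (hSE _ _ (hpE c' x)) hne)
        (fun h => absurd hc h)]
      exact psame _ _ (hSE _ _ (hpE c x))
    · rw [Finset.sum_eq_zero]
      · rw [DFinsupp.notMem_support_iff] at hc
        simp [p, hc]
      · intro c' hc'
        exact pne _ _ _ (hSE _ _ (hpE c' x)) (fun h => hc (h ▸ hc'))
  obtain ⟨c₁, h1, h1'⟩ := hsupp a ha
  obtain ⟨c₂, h2, h2'⟩ := hsupp z hz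
  refine ⟨p c₁ a, p c₂ z, h1, h2, ?_, ⟨c₁, c₁.2, ?_⟩, ⟨c₂, c₂.2, ?_⟩, ?_⟩
  · rw [← hlead a z c₁ c₂ h1' h2', ← hlead z a c₂ c₁ h2' h1', h, psmul, mul_comm c₁]
  · exact Module.End.mem_eigenspace_iff.1 (hpE c₁ a)
  · exact Module.End.mem_eigenspace_iff.1 (hpE c₂ z)
  · intro S hS s
    constructor
    · intro hs
      rw [← hcomm S hS, hs, psmul]
    · intro hs
      rw [← hcomm S hS, hs, psmul]

/-- Let `T` be a finite commuting family of algebra endomorphisms of an algebra `A` that are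
diagonalisable with positive eigenvalues, let `E` be a family of locally nilpotent operators which
are homogeneous for `T` and are skew derivations with positive coefficients on weight vectors, and
let `ε` be a character that does not vanish at nonzero weight vectors killed by `E`. Then two
nonzero elements of `A` that commute up to a real scalar do so up to a positive scalar. -/
theorem pos_of_mul_eq_smul_mul {τ J : Type*} [Finite τ] (T : τ → Module.End ℂ A)
    (E : J → Module.End ℂ A) (ε : A →ₐ[ℂ] ℂ)
    (hmul : ∀ t a b, T t (a * b) = T t a * T t b)
    (hTT : ∀ t t', Commute (T t) (T t'))
    (hspan : ∀ t, ⨆ c : {c : ℝ // 0 < c}, (T t).eigenspace ((c : ℝ) : ℂ) = ⊤)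
    (hTE : ∀ t j, ∃ r : ℂ, T t * E j = r • (E j * T t))
    (hE : ∀ j a b, IsPosWeight T a → IsPosWeight T b → ∃ s t : ℝ, 0 < s ∧ 0 < t ∧
      E j (a * b) = (s : ℂ) • (E j a * b) + (t : ℂ) • (a * E j b))
    (hnil : ∀ a, ∃ N, a ∈ wordKernel E N)
    (hε : ∀ a, IsPosWeight T a → (∀ j, E j a = 0) → ε a = 0 → a = 0)
    {a z : A} (ha : a ≠ 0) (hz : z ≠ 0) {l : ℝ} (h : a * z = (l : ℂ) • (z * a)) : 0 < l := by
  classical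
  have hEp : ∀ j x, IsPosWeight T x → IsPosWeight T (E j x) := by
    intro j x hx t
    by_cases h0 : E j x = 0
    · exact ⟨1, one_pos, by simp [h0]⟩
    obtain ⟨c, hc, hcx⟩ := hx t
    obtain ⟨r, hr⟩ := hTE t j
    have he : T t (E j x) = (r * c) • E j x := by
      rw [← Module.End.mul_apply, hr, LinearMap.smul_apply, Module.End.mul_apply, hcx, map_smul,
        smul_smul]
    -- Otherwise `E j x` would be an eigenvector whose eigenvalue is not positive.
    by_contra hcon
    push Not at hcon
    have hdis := (T t).eigenspaces_iSupIndep (r * c)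
    have hle : (⊤ : Submodule ℂ A) ≤ ⨆ (μ : ℂ) (_ : μ ≠ r * c), (T t).eigenspace μ := by
      rw [← hspan t]
      refine iSup_le fun d => le_iSup₂_of_le ((d : ℝ) : ℂ) ?_ le_rfl
      intro hd
      exact hcon d d.2 (by rw [hd]; exact he)
    apply h0
    have := hdis.mono_right hle
    rw [disjoint_top] at this
    rw [← Submodule.mem_bot ℂ, ← this]
    exact Module.End.mem_eigenspace_iff.2 he
  -- For weight vectors, pass to the last nonzero iterates of the operators `E j`.
  have key : ∀ k N M : ℕ, N + M = k → ∀ a z : A, a ∈ wordKernel E N → z ∈ wordKernel E M →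
      a ≠ 0 → z ≠ 0 → IsPosWeight T a → IsPosWeight T z → ∀ l : ℝ,
      a * z = (l : ℂ) • (z * a) → 0 < l := by
    intro k
    induction k using Nat.strong_induction_on with
    | _ k ih =>
    intro N M hk a z haN hzM ha hz haT hzT l h
    by_cases hall : ∀ j, E j a = 0 ∧ E j z = 0
    · have ea : ε a ≠ 0 := fun h => ha (hε a haT (fun j => (hall j).1) h)
      have ez : ε z ≠ 0 := fun h => hz (hε z hzT (fun j => (hall j).2) h)
      have h1 := congrArg ε h
      rw [map_smul, map_mul, map_mul, mul_comm (ε z), smul_eq_mul] at h1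
      have h2 : (l : ℂ) = 1 := by
        apply mul_right_cancel₀ (mul_ne_zero ea ez)
        rw [← h1, one_mul]
      have : l = 1 := by exact_mod_cast h2
      rw [this]; exact one_pos
    · push Not at hall
      obtain ⟨j, hj⟩ := hall
      obtain ⟨m, r, hm, ham, ham', hamr⟩ := exists_last_pow j haN ha
      obtain ⟨n, s, hn, hzn, hzn', hzns⟩ := exists_last_pow j hzM hz
      have hmn : 0 < m + n := by
        rcases Nat.eq_zero_or_pos (m + n) with h0 | h0
        · obtain ⟨rfl, rfl⟩ : m = 0 ∧ n = 0 := by omega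
          exact absurd (by simpa using hzn') (hj (by simpa using ham'))
        · exact h0
      have hp : ∀ m x, IsPosWeight T x → IsPosWeight T ((E j ^ m) x) := by
        intro m
        induction m with
        | zero => intro x hx; simpa using hx
        | succ m ih => intro x hx; rw [pow_succ]; exact ih _ (hEp j x hx)
      have e1 : (E j ^ (m + 1)) a = 0 := by rw [pow_succ']; exact ham'
      have e2 : (E j ^ (n + 1)) z = 0 := by rw [pow_succ']; exact hzn'
      obtain ⟨c₁, hc₁, h₁⟩ := exists_pow_mul_eq (hEp j) (hE j) m n a z haT hzT e1 e2
      obtain ⟨c₂, hc₂, h₂⟩ := exists_pow_mul_eq (hEp j) (hE j) n m z a hzT haT e2 e1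
      have h3 : (E j ^ m) a * (E j ^ n) z =
          ((l * c₂ / c₁ : ℝ) : ℂ) • ((E j ^ n) z * (E j ^ m) a) := by
        have h4 := congrArg (E j ^ (m + n)) h
        rw [map_smul, h₁, add_comm m n, h₂, smul_smul] at h4
        have h5 : (c₁ : ℂ) ≠ 0 := by exact_mod_cast hc₁.ne'
        rw [← one_smul ℂ ((E j ^ m) a * (E j ^ n) z), ← inv_mul_cancel₀ h5, mul_smul, h4,
          smul_smul]
        congr 1
        push_cast
        field_simp
      have := ih (r + s) (by omega) r s rfl _ _ hamr hzns ham hzn (hp m a haT) (hp n z hzT) _ h3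
      rw [mul_div_assoc] at this
      exact pos_of_mul_pos_left this (div_pos hc₂ hc₁).le
  -- Weight vectors for all of `T` are reached by taking leading terms for one operator at a time.
  have hlead : ∀ s : Finset τ, ∃ a' z' : A, a' ≠ 0 ∧ z' ≠ 0 ∧ a' * z' = (l : ℂ) • (z' * a') ∧
      ∀ t ∈ s, (∃ c : ℝ, 0 < c ∧ T t a' = (c : ℂ) • a') ∧
        (∃ c : ℝ, 0 < c ∧ T t z' = (c : ℂ) • z') := by
    intro s
    induction s using Finset.induction with
    | empty => exact ⟨a, z, ha, hz, h, by simp⟩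
    | insert t s hts ih =>
      obtain ⟨a₁, z₁, ha₁, hz₁, h₁, hs₁⟩ := ih
      obtain ⟨a₂, z₂, ha₂, hz₂, h₂, hca, hcz, hS⟩ :=
        exists_leading (hmul t) (hspan t) ha₁ hz₁ h₁
      refine ⟨a₂, z₂, ha₂, hz₂, h₂, fun t' ht' => ?_⟩
      rcases Finset.mem_insert.1 ht' with rfl | ht'
      · exact ⟨hca, hcz⟩
      · obtain ⟨⟨c, hc, hc'⟩, ⟨d, hd, hd'⟩⟩ := hs₁ t' ht'
        exact ⟨⟨c, hc, (hS _ (hTT t' t) _).1 hc'⟩, ⟨d, hd, (hS _ (hTT t' t) _).2 hd'⟩⟩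
  have := Fintype.ofFinite τ
  obtain ⟨a', z', ha', hz', h', hT'⟩ := hlead Finset.univ
  obtain ⟨N, hN⟩ := hnil a'
  obtain ⟨M, hM⟩ := hnil z'
  exact key _ N M rfl a' z' hN hM ha' hz' (fun t => (hT' t (Finset.mem_univ t)).1)
    (fun t => (hT' t (Finset.mem_univ t)).2) l h'

end Positivity

/-! ### The two translation actions on the quantised coordinate algebra -/

namespace Oq

variable {ι : Type*} {D : QuantumDatum ι}

/-- Left translation, `(left X f)(Y) = f(X Y)`. -/
def left (X : Uq D) : Module.End ℂ (Oq D) :=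
  (TensorProduct.lid ℂ (Oq D)).toLinearMap ∘ₗ ((ev D).flip X).rTensor (Oq D) ∘ₗ
    Coalgebra.comul (R := ℂ)

/-- Right translation, `(right X f)(Y) = f(Y X)`. -/
def right (X : Uq D) : Module.End ℂ (Oq D) :=
  (TensorProduct.rid ℂ (Oq D)).toLinearMap ∘ₗ ((ev D).flip X).lTensor (Oq D) ∘ₗ
    Coalgebra.comul (R := ℂ)

lemma ev_left (X Y : Uq D) (f : Oq D) : ev D (left X f) Y = ev D f (X * Y) := by
  rw [← ev₂_comul']
  change ev D (TensorProduct.lid ℂ (Oq D) (((ev D).flip X).rTensor (Oq D)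
    (Coalgebra.comul (R := ℂ) f))) Y = _
  induction Coalgebra.comul (R := ℂ) f with
  | zero => simp
  | add x y hx hy => simp only [map_add, LinearMap.add_apply, hx, hy]
  | tmul f g => simp

lemma ev_right (X Y : Uq D) (f : Oq D) : ev D (right X f) Y = ev D f (Y * X) := by
  rw [← ev₂_comul']
  change ev D (TensorProduct.rid ℂ (Oq D) (((ev D).flip X).lTensor (Oq D)
    (Coalgebra.comul (R := ℂ) f))) Y = _
  induction Coalgebra.comul (R := ℂ) f with
  | zero => simp
  | add x y hx hy => simp only [map_add, LinearMap.add_apply, hx, hy]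
  | tmul f g => simp [mul_comm]

lemma left_mul (X Y : Uq D) : left (X * Y) = left Y * left X := by
  ext f Z
  simp [ev_left, mul_assoc]

lemma right_mul (X Y : Uq D) : right (X * Y) = right X * right Y := by
  ext f Z
  simp [ev_right, mul_assoc]

lemma left_one : left (1 : Uq D) = 1 := by
  ext f Z
  simp [ev_left]

lemma left_add (X Y : Uq D) : left (X + Y) = left X + left Y := by
  ext f Z
  simp [ev_left, add_mul]

lemma left_sub (X Y : Uq D) : left (X - Y) = left X - left Y := by
  ext f Z
  simp [ev_left, sub_mul]

lemma left_smul (c : ℂ) (X : Uq D) : left (c • X) = c • left X := by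
  ext f Z
  simp [ev_left]

lemma right_smul (c : ℂ) (X : Uq D) : right (c • X) = c • right X := by
  ext f Z
  simp [ev_right]

lemma commute_left_right (X Y : Uq D) : Commute (left X) (right Y) := by
  ext f Z
  simp [ev_left, ev_right, mul_assoc]

lemma ev_mul_tmul (f g : Oq D) (x y : Uq D) (u : Uq D ⊗[ℂ] Uq D) :
    LinearMap.mul' ℂ ℂ (TensorProduct.map (ev D f) (ev D g) ((x ⊗ₜ y) * u)) =
      LinearMap.mul' ℂ ℂ (TensorProduct.map (ev D (left x f)) (ev D (left y g)) u) := by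
  induction u with
  | zero => simp
  | add a b ha hb => rw [mul_add, map_add, map_add, ha, hb, map_add, map_add]
  | tmul a b => simp [ev_left]

lemma ev_mul_tmul' (f g : Oq D) (x y : Uq D) (u : Uq D ⊗[ℂ] Uq D) :
    LinearMap.mul' ℂ ℂ (TensorProduct.map (ev D f) (ev D g) (u * (x ⊗ₜ y))) =
      LinearMap.mul' ℂ ℂ (TensorProduct.map (ev D (right x f)) (ev D (right y g)) u) := by
  induction u with
  | zero => simp
  | add a b ha hb => rw [add_mul, map_add, map_add, ha, hb, map_add, map_add]
  | tmul a b => simp [ev_right]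

lemma left_K_mul (i : ι) (f g : Oq D) :
    left (Uq.K D i) (f * g) = left (Uq.K D i) f * left (Uq.K D i) g := by
  ext Z
  rw [ev_left, ev_mul, ev_mul, Bialgebra.comul_mul, Uq.comul_K, ev_mul_tmul]

lemma right_K_mul (i : ι) (f g : Oq D) :
    right (Uq.K D i) (f * g) = right (Uq.K D i) f * right (Uq.K D i) g := by
  ext Z
  rw [ev_right, ev_mul, ev_mul, Bialgebra.comul_mul, Uq.comul_K, ev_mul_tmul']

lemma left_E_mul (i : ι) (f g : Oq D) : left (Uq.E D i) (f * g) =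
    left (Uq.E D i) f * left (Uq.K D i) g + f * left (Uq.E D i) g := by
  ext Z
  rw [ev_left, ev_mul, map_add, LinearMap.add_apply, ev_mul, ev_mul, Bialgebra.comul_mul,
    Uq.comul_E, add_mul, map_add, map_add, ev_mul_tmul, ev_mul_tmul, left_one]
  rfl

lemma left_F_mul (i : ι) (f g : Oq D) : left (Uq.F D i) (f * g) =
    left (Uq.F D i) f * g + left (Uq.Kinv D i) f * left (Uq.F D i) g := by
  ext Z
  rw [ev_left, ev_mul, map_add, LinearMap.add_apply, ev_mul, ev_mul, Bialgebra.comul_mul,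
    Uq.comul_F, add_mul, map_add, map_add, ev_mul_tmul, ev_mul_tmul, left_one]
  rfl

lemma right_one : right (1 : Uq D) = 1 := by
  ext f Z
  simp [ev_right]

lemma right_F_mul (i : ι) (f g : Oq D) : right (Uq.F D i) (f * g) =
    right (Uq.F D i) f * g + right (Uq.Kinv D i) f * right (Uq.F D i) g := by
  ext Z
  rw [ev_right, ev_mul, map_add, LinearMap.add_apply, ev_mul, ev_mul, Bialgebra.comul_mul,
    Uq.comul_F, mul_add, map_add, map_add, ev_mul_tmul', ev_mul_tmul', right_one]
  rfl

lemma left_star (X : Uq D) (f : Oq D) : left X (star f) = star (left (Uq.tau D X) f) := by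
  ext Z
  rw [ev_left, ev_star', ev_star', ev_left, map_mul]

lemma left_coeff (X : Uq D) (V : Type1Rep D) (k l : V.κ) :
    left X (coeff V k l) = ∑ m, V.hom X k m • coeff V m l := by
  ext Z
  simp [ev_left, ev_coeff, Matrix.mul_apply]

lemma right_coeff (X : Uq D) (V : Type1Rep D) (k l : V.κ) :
    right X (coeff V k l) = ∑ m, V.hom X m l • coeff V k m := by
  ext Z
  simp [ev_right, ev_coeff, Matrix.mul_apply, mul_comm]

lemma left_K_coeff (i : ι) (V : Type1Rep D) (k l : V.κ) :
    left (Uq.K D i) (coeff V k l) = D.qi i ^ V.wt k i • coeff V k l := by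
  rw [left_coeff, V.hom_K, Finset.sum_eq_single k]
  · simp
  · intro m _ hm; simp [Matrix.diagonal_apply_ne' _ hm]
  · simp

lemma right_K_coeff (i : ι) (V : Type1Rep D) (k l : V.κ) :
    right (Uq.K D i) (coeff V k l) = D.qi i ^ V.wt l i • coeff V k l := by
  rw [right_coeff, V.hom_K, Finset.sum_eq_single l]
  · simp
  · intro m _ hm; simp [Matrix.diagonal_apply_ne _ hm]
  · simp

lemma coeff_self_ne_zero (V : Type1Rep D) (k : V.κ) : coeff V k k ≠ 0 := by
  intro h
  have h0 : V.hom 1 k k = 0 := by rw [← ev_coeff, h]; simp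
  rw [map_one, Matrix.one_apply_eq] at h0
  exact one_ne_zero h0

/-! ### Triangular decomposition -/

/-- A functional on `U_q(𝔤)` that is a weight vector for left translation and vanishes on all
`E_i U_q(𝔤)` and all `U_q(𝔤) F_i` is determined by its value at `1`. This is the fact that
`U_q(𝔤) = U⁺ U⁰ U⁻`. -/
lemma eq_zero_of_counit_eq_zero {f : Oq D} (hE : ∀ i, left (Uq.E D i) f = 0)
    (hF : ∀ i, right (Uq.F D i) f = 0)
    (hK : ∀ i, ∃ c : ℂ, c ≠ 0 ∧ left (Uq.K D i) f = c • f) (h1 : ev D f 1 = 0) : f = 0 := by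
  have hr := Uq.relations D
  choose c hc0 hc using hK
  let B : Subalgebra ℂ (Uq D) := Algebra.adjoin ℂ
    (Set.range (Uq.K D) ∪ Set.range (Uq.Kinv D) ∪ Set.range (Uq.F D))
  have hKB : ∀ i, Uq.K D i ∈ B := fun i => Algebra.subset_adjoin (.inl (.inl ⟨i, rfl⟩))
  have hKinvB : ∀ i, Uq.Kinv D i ∈ B := fun i => Algebra.subset_adjoin (.inl (.inr ⟨i, rfl⟩))
  have hFB : ∀ i, Uq.F D i ∈ B := fun i => Algebra.subset_adjoin (.inr ⟨i, rfl⟩)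
  -- First, `f` vanishes on the subalgebra `B = U⁰ U⁻`.
  have hB : ∀ b ∈ B, ev D f b = 0 := by
    have key : ∀ b ∈ B, ∀ g : Oq D, (∀ i, right (Uq.F D i) g = 0) →
        (∀ i, left (Uq.K D i) g = c i • g) → ev D g 1 = 0 →
        (∀ i, right (Uq.F D i) (right b g) = 0) ∧
        (∀ i, left (Uq.K D i) (right b g) = c i • right b g) ∧ ev D (right b g) 1 = 0 := by
      intro b hb
      induction hb using Algebra.adjoin_induction with
      | mem b hb =>
        intro g h1 h2 h3
        refine ⟨fun i => ?_, fun i => ?_, ?_⟩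
        · rw [← Module.End.mul_apply, ← right_mul]
          rcases hb with (⟨j, rfl⟩ | ⟨j, rfl⟩) | ⟨j, rfl⟩
          · have : Uq.F D i * Uq.K D j = D.qi j ^ D.a j i • (Uq.K D j * Uq.F D i) := by
              rw [hr.K_mul_F, smul_smul, ← zpow_add₀ (D.qi_ne_zero j)]; simp
            rw [this, right_smul, right_mul, LinearMap.smul_apply, Module.End.mul_apply, h1]
            simp
          · have : Uq.F D i * Uq.Kinv D j =
                D.qi j ^ (-D.a j i) • (Uq.Kinv D j * Uq.F D i) := by
              rw [hr.Kinv_mul_F, smul_smul, ← zpow_add₀ (D.qi_ne_zero j)]; simp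
            rw [this, right_smul, right_mul, LinearMap.smul_apply, Module.End.mul_apply, h1]
            simp
          · rw [right_mul, Module.End.mul_apply, h1]
            simp
        · rw [← Module.End.mul_apply, (commute_left_right _ _).eq, Module.End.mul_apply, h2,
            map_smul]
        · rw [ev_right, one_mul]
          rcases hb with (⟨j, rfl⟩ | ⟨j, rfl⟩) | ⟨j, rfl⟩
          · rw [← mul_one (Uq.K D j), ← ev_left, h2]
            simp [h3]
          · have h4 : c j • ev D g (Uq.Kinv D j) = 0 := by
              rw [← LinearMap.smul_apply, ← map_smul, ← h2, ev_left, hr.K_mul_Kinv, h3]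
            exact (smul_eq_zero.1 h4).resolve_left (hc0 j)
          · rw [← one_mul (Uq.F D j), ← ev_right, h1]
            simp
      | algebraMap r =>
        intro g h1 h2 h3
        rw [Algebra.algebraMap_eq_smul_one, right_smul, right_one]
        refine ⟨fun i => by simp [h1], fun i => ?_, by simp [h3]⟩
        rw [LinearMap.smul_apply, Module.End.one_apply, map_smul, h2, smul_comm]
      | add x y _ _ hx hy =>
        intro g h1 h2 h3
        have hxy : right (x + y) g = right x g + right y g := by ext Z; simp [ev_right, mul_add]
        obtain ⟨a1, a2, a3⟩ := hx g h1 h2 h3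
        obtain ⟨b1, b2, b3⟩ := hy g h1 h2 h3
        rw [hxy]
        exact ⟨fun i => by rw [map_add, a1, b1, add_zero],
          fun i => by rw [map_add, a2, b2, smul_add],
          by rw [map_add, LinearMap.add_apply, a3, b3, add_zero]⟩
      | mul x y _ _ hx hy =>
        intro g h1 h2 h3
        obtain ⟨b1, b2, b3⟩ := hy g h1 h2 h3
        rw [right_mul]
        exact hx _ b1 b2 b3
    intro b hb
    have := (key b hb f hF hc h1).2.2
    rwa [ev_right, one_mul] at this
  -- The elements `X` such that `f` vanishes on `B X` form a left ideal.
  let N : Submodule ℂ (Uq D) :=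
    { carrier := {X | ∀ b ∈ B, ev D f (b * X) = 0}
      add_mem' := fun {x y} hx hy b hb => by rw [mul_add, map_add, hx b hb, hy b hb, add_zero]
      zero_mem' := fun b _ => by simp
      smul_mem' := fun r x hx b hb => by rw [mul_smul_comm, map_smul, hx b hb, smul_zero] }
  have hBN : ∀ b ∈ B, ∀ X ∈ N, b * X ∈ N := fun b hb X hX b' hb' => by
    rw [← mul_assoc]; exact hX _ (B.mul_mem hb' hb)
  let P : Submodule ℂ (Uq D) := N ⊔ ⨆ j, N.map (LinearMap.mulLeft ℂ (Uq.E D j))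
  have hNP : N ≤ P := le_sup_left
  have hEP : ∀ j, ∀ X ∈ N, Uq.E D j * X ∈ P := fun j X hX =>
    (le_sup_of_le_right (le_iSup (fun j => N.map (LinearMap.mulLeft ℂ (Uq.E D j))) j))
      (Submodule.mem_map_of_mem (f := LinearMap.mulLeft ℂ (Uq.E D j)) hX)
  have hBP : ∀ b ∈ B, ∀ X ∈ P, b * X ∈ P := by
    intro b hb
    induction hb using Algebra.adjoin_induction with
    | mem b hb =>
      have hbB : b ∈ B := Algebra.subset_adjoin hb
      have hle : P ≤ P.comap (LinearMap.mulLeft ℂ b) := by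
        refine sup_le (fun X hX => hNP (hBN b hbB X hX)) (iSup_le fun j => ?_)
        rintro _ ⟨X, hX, rfl⟩
        change b * (Uq.E D j * X) ∈ P
        rw [← mul_assoc]
        rcases hb with (⟨i, rfl⟩ | ⟨i, rfl⟩) | ⟨i, rfl⟩
        · rw [hr.K_mul_E, smul_mul_assoc, mul_assoc]
          exact P.smul_mem _ (hEP j _ (hBN _ hbB X hX))
        · rw [hr.Kinv_mul_E, smul_mul_assoc, mul_assoc]
          exact P.smul_mem _ (hEP j _ (hBN _ hbB X hX))
        · by_cases hij : j = i
          · subst hij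
            have e : Uq.F D j * Uq.E D j = Uq.E D j * Uq.F D j -
                (D.qi j - (D.qi j)⁻¹)⁻¹ • (Uq.K D j - Uq.Kinv D j) := by
              rw [← hr.E_mul_F_same]; abel
            rw [e, sub_mul, mul_assoc, smul_mul_assoc, sub_mul]
            exact P.sub_mem (hEP j _ (hBN _ hbB X hX)) (P.smul_mem _ (hNP
              (N.sub_mem (hBN _ (hKB j) X hX) (hBN _ (hKinvB j) X hX))))
          · rw [← sub_eq_zero.1 (hr.E_mul_F_ne j i hij), mul_assoc]
            exact hEP j _ (hBN _ hbB X hX)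
      exact hle
    | algebraMap r =>
      intro X hX
      rw [← Algebra.smul_def]
      exact P.smul_mem r hX
    | add x y _ _ hx hy => intro X hX; rw [add_mul]; exact P.add_mem (hx X hX) (hy X hX)
    | mul x y _ _ hx hy => intro X hX; rw [mul_assoc]; exact hx _ (hy X hX)
  have hfP : ∀ X ∈ P, ev D f X = 0 := by
    have hle : P ≤ LinearMap.ker (ev D f) := by
      refine sup_le (fun X hX => ?_) (iSup_le fun j => ?_)
      · have := hX 1 B.one_mem
        rwa [one_mul] at this
      · rintro _ ⟨X, -, rfl⟩
        change ev D f (Uq.E D j * X) = 0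
        rw [← ev_left, hE]
        simp
    exact hle
  have hN : ∀ X : Uq D, ∀ Y ∈ N, X * Y ∈ N := by
    intro X
    induction X using Uq.gen_induction with
    | alg r => intro Y hY; rw [← Algebra.smul_def]; exact N.smul_mem r hY
    | add a b ha hb => intro Y hY; rw [add_mul]; exact N.add_mem (ha Y hY) (hb Y hY)
    | mul a b ha hb => intro Y hY; rw [mul_assoc]; exact ha _ (hb Y hY)
    | E i => exact fun Y hY b hb => hfP _ (hBP b hb _ (hEP i Y hY))
    | F i => exact hBN _ (hFB i)
    | K i => exact hBN _ (hKB i)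
    | Kinv i => exact hBN _ (hKinvB i)
  ext X
  have := hN X 1 (fun b hb => by rw [mul_one]; exact hB b hb) 1 B.one_mem
  simpa using this

end Oq

/-! ### The Haar inner product and positivity of weights -/

lemma Generic.zpow_injective {t : ℂ} (h : Generic t) : Function.Injective fun n : ℤ => t ^ n := by
  have key : ∀ m n : ℤ, m < n → t ^ m ≠ t ^ n := by
    intro m n hmn he
    obtain ⟨k, rfl⟩ : ∃ k : ℕ, n = m + k := ⟨(n - m).toNat, by omega⟩
    rw [zpow_add₀ h.ne_zero, zpow_natCast] at he
    exact h.pow_ne_one (n := k) (by omega)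
      (mul_left_cancel₀ (zpow_ne_zero m h.ne_zero) (by rw [← he, mul_one]))
  intro m n he
  rcases lt_trichotomy m n with hlt | rfl | hlt
  · exact absurd he (key m n hlt)
  · rfl
  · exact absurd he.symm (key n m hlt)

namespace Oq

variable {ι : Type*} {D : QuantumDatum ι}

/-- Matrix coefficients are annihilated by long words in operators that lower a height function on
pairs of basis vectors. -/
lemma exists_coeff_mem_wordKernel {J : Type*} (E : J → Module.End ℂ (Oq D)) (V : Type1Rep D)
    (η : V.κ → V.κ → ℤ) (h : ∀ j k l, E j (coeff V k l) ∈
      Submodule.span ℂ {x | ∃ k' l', η k' l' < η k l ∧ x = coeff V k' l'}) (k l : V.κ) :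
    ∃ N, coeff V k l ∈ wordKernel E N := by
  obtain ⟨b, hb⟩ : ∃ b, ∀ k l, b ≤ η k l := by
    obtain ⟨b, hb⟩ := (Set.finite_range fun p : V.κ × V.κ => η p.1 p.2).bddBelow
    exact ⟨b, fun k l => hb ⟨(k, l), rfl⟩⟩
  have key : ∀ n : ℕ, ∀ k l, η k l < b + n → coeff V k l ∈ wordKernel E n := by
    intro n
    induction n with
    | zero => intro k l hkl; have := hb k l; simp at hkl; omega
    | succ n ih =>
      intro k l hkl
      refine mem_wordKernel_succ.2 fun j => Submodule.span_le.2 ?_ (h j k l)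
      rintro _ ⟨k', l', hlt, rfl⟩
      exact ih k' l' (by push_cast at hkl; omega)
  exact ⟨(η k l - b + 1).toNat, key _ k l (by have := hb k l; omega)⟩

lemma exists_mem_wordKernel {J : Type*} (E : J → Module.End ℂ (Oq D))
    (h : ∀ V k l, ∃ N, coeff V k l ∈ wordKernel E N) (a : Oq D) : ∃ N, a ∈ wordKernel E N := by
  induction a using coeff_induction with
  | coeff V k l => exact h V k l
  | zero => exact ⟨0, zero_mem _⟩
  | add f g hf hg =>
    obtain ⟨N, hN⟩ := hf
    obtain ⟨M, hM⟩ := hg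
    exact ⟨max N M, add_mem (wordKernel_mono E (le_max_left _ _) hN)
      (wordKernel_mono E (le_max_right _ _) hM)⟩
  | smul c f hf =>
    obtain ⟨N, hN⟩ := hf
    exact ⟨N, Submodule.smul_mem _ c hN⟩

lemma wt_of_hom_E_ne_zero {V : Type1Rep D} {j : ι} {k m : V.κ} (h : V.hom (Uq.E D j) k m ≠ 0)
    (i : ι) : V.wt k i = V.wt m i + D.a i j := by
  have e := congrArg (fun X => V.hom X k m) ((Uq.relations D).K_mul_E i j)
  simp only [map_mul, map_smul, V.hom_K, Matrix.smul_apply, Matrix.diagonal_mul,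
    Matrix.mul_diagonal, smul_eq_mul] at e
  have e2 : D.qi i ^ V.wt k i = D.qi i ^ (V.wt m i + D.a i j) := by
    apply mul_right_cancel₀ h
    rw [e, zpow_add₀ (D.qi_ne_zero i)]
    ring
  exact (D.generic i).zpow_injective e2

lemma wt_of_hom_F_ne_zero {V : Type1Rep D} {j : ι} {k m : V.κ} (h : V.hom (Uq.F D j) k m ≠ 0)
    (i : ι) : V.wt k i = V.wt m i - D.a i j := by
  have e := congrArg (fun X => V.hom X k m) ((Uq.relations D).K_mul_F i j)
  simp only [map_mul, map_smul, V.hom_K, Matrix.smul_apply, Matrix.diagonal_mul,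
    Matrix.mul_diagonal, smul_eq_mul] at e
  have e2 : D.qi i ^ V.wt k i = D.qi i ^ (V.wt m i - D.a i j) := by
    apply mul_right_cancel₀ h
    rw [e, sub_eq_add_neg, zpow_add₀ (D.qi_ne_zero i)]
    ring
  exact (D.generic i).zpow_injective e2

lemma left_coeff_mem {X : Uq D} {V : Type1Rep D} {η : V.κ → V.κ → ℤ}
    (h : ∀ k m l, V.hom X k m ≠ 0 → η m l < η k l) (k l : V.κ) : left X (coeff V k l) ∈
      Submodule.span ℂ {x | ∃ k' l', η k' l' < η k l ∧ x = coeff V k' l'} := by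
  rw [left_coeff]
  refine Submodule.sum_mem _ fun m _ => ?_
  by_cases h0 : V.hom X k m = 0
  · rw [h0, zero_smul]; exact zero_mem _
  · exact Submodule.smul_mem _ _ (Submodule.subset_span ⟨m, l, h k m l h0, rfl⟩)

lemma right_coeff_mem {X : Uq D} {V : Type1Rep D} {η : V.κ → V.κ → ℤ}
    (h : ∀ k m l, V.hom X m l ≠ 0 → η k m < η k l) (k l : V.κ) : right X (coeff V k l) ∈
      Submodule.span ℂ {x | ∃ k' l', η k' l' < η k l ∧ x = coeff V k' l'} := by
  rw [right_coeff]
  refine Submodule.sum_mem _ fun m _ => ?_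
  by_cases h0 : V.hom X m l = 0
  · rw [h0, zero_smul]; exact zero_mem _
  · exact Submodule.smul_mem _ _ (Submodule.subset_span ⟨k, m, h k m l h0, rfl⟩)

lemma left_E_nilpotent (i : ι) (a : Oq D) :
    ∃ N, a ∈ wordKernel (fun _ : Unit => left (Uq.E D i)) N := by
  refine exists_mem_wordKernel _ (fun V k l => exists_coeff_mem_wordKernel _ V
    (fun k _ => V.wt k i) (fun _ => left_coeff_mem fun k m l h => ?_) k l) a
  have := wt_of_hom_E_ne_zero h i
  rw [D.a_diag] at this
  omega

lemma left_F_nilpotent (i : ι) (a : Oq D) :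
    ∃ N, a ∈ wordKernel (fun _ : Unit => left (Uq.F D i)) N := by
  refine exists_mem_wordKernel _ (fun V k l => exists_coeff_mem_wordKernel _ V
    (fun k _ => -V.wt k i) (fun _ => left_coeff_mem fun k m l h => ?_) k l) a
  have := wt_of_hom_F_ne_zero h i
  rw [D.a_diag] at this
  omega

/-- A positive definite bi-invariant normalised functional on `O_q(G)`. -/
structure IsPosHaar (h : Oq D →ₗ[ℂ] ℂ) : Prop where
  isHaar : IsHaar (Oq D) h
  pos : ∀ a, a ≠ 0 → 0 < (h (star a * a)).re ∧ (h (star a * a)).im = 0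

namespace IsPosHaar

variable {h : Oq D →ₗ[ℂ] ℂ}

/-- Invariance of the Haar functional, in terms of left translation. -/
lemma map_left (hh : IsPosHaar h) (X : Uq D) (a : Oq D) :
    h (left X a) = Coalgebra.counit (R := ℂ) X * h a := by
  have key : ∀ t : Oq D ⊗[ℂ] Oq D,
      h (TensorProduct.lid ℂ (Oq D) (((ev D).flip X).rTensor (Oq D) t)) =
      ev D (TensorProduct.rid ℂ (Oq D) (h.lTensor (Oq D) t)) X := by
    intro t
    induction t with
    | zero => simp
    | add x y hx hy => simp only [map_add, LinearMap.add_apply, hx, hy]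
    | tmul f g => simp [mul_comm]
  refine (key _).trans ?_
  rw [hh.isHaar.left, Algebra.algebraMap_eq_smul_one, map_smul, LinearMap.smul_apply, ev_one,
    smul_eq_mul, mul_comm]

/-- Polarisation: a functional that is real on all `a^* a` gives a Hermitian form. -/
lemma symm (hh : IsPosHaar h) (a b : Oq D) :
    starRingEnd ℂ (h (star b * a)) = h (star a * b) := by
  have him : ∀ a, (h (star a * a)).im = 0 := fun a => by
    by_cases ha : a = 0
    · simp [ha]
    · exact (hh.pos a ha).2
  have h1 := him (a + b)
  have h2 := him (a + Complex.I • b)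
  simp only [star_add, star_smul, add_mul, mul_add, map_add, smul_mul_assoc, mul_smul_comm,
    map_smul, Complex.add_im, him, smul_eq_mul, Complex.star_def, Complex.conj_I, Complex.mul_im,
    Complex.neg_re, Complex.neg_im, Complex.I_re, Complex.I_im, Complex.mul_re] at h1 h2
  apply Complex.ext
  · simp only [Complex.conj_re]; linarith
  · simp only [Complex.conj_im]; linarith

lemma inner_left_K (hh : IsPosHaar h) (i : ι) (a b : Oq D) :
    h (star a * left (Uq.K D i) b) = h (star (left (Uq.K D i) a) * b) := by
  have e : left (Uq.Kinv D i) (left (Uq.K D i) a) = a := by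
    rw [← Module.End.mul_apply, ← left_mul, (Uq.relations D).K_mul_Kinv, left_one]; rfl
  have := hh.map_left (Uq.K D i) (star (left (Uq.K D i) a) * b)
  rw [left_K_mul, left_star, Uq.tau_K, e, Uq.counit_K, one_mul] at this
  exact this

lemma inner_left_Kinv (hh : IsPosHaar h) (i : ι) (a b : Oq D) :
    h (star a * left (Uq.Kinv D i) b) = h (star (left (Uq.Kinv D i) a) * b) := by
  have e : ∀ x, left (Uq.K D i) (left (Uq.Kinv D i) x) = x := fun x => by
    rw [← Module.End.mul_apply, ← left_mul, (Uq.relations D).Kinv_mul_K, left_one]; rfl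
  have := hh.inner_left_K i (left (Uq.Kinv D i) a) (left (Uq.Kinv D i) b)
  rw [e, e] at this
  exact this.symm

lemma inner_left_E (hh : IsPosHaar h) (i : ι) (a b : Oq D) :
    h (star a * left (Uq.E D i) b) = h (star (left (Uq.F D i) a) * left (Uq.K D i) b) := by
  have := hh.map_left (Uq.E D i) (star a * b)
  have e : left (-Uq.F D i) a = - left (Uq.F D i) a := by
    rw [← neg_one_smul ℂ (Uq.F D i), left_smul]; simp
  rw [left_E_mul, left_star, Uq.tau_E, Uq.counit_E, zero_mul, map_add, e, star_neg, neg_mul,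
    map_neg] at this
  linear_combination this

lemma inner_left_F (hh : IsPosHaar h) (i : ι) (a b : Oq D) :
    h (star (left (Uq.K D i) a) * left (Uq.F D i) b) = h (star (left (Uq.E D i) a) * b) := by
  have := hh.map_left (Uq.F D i) (star a * b)
  have e : left (-Uq.E D i) a = - left (Uq.E D i) a := by
    rw [← neg_one_smul ℂ (Uq.E D i), left_smul]; simp
  rw [left_F_mul, left_star, left_star, Uq.tau_F, Uq.tau_Kinv, Uq.counit_F, zero_mul, map_add, e,
    star_neg, neg_mul, map_neg] at this
  linear_combination this

end IsPosHaar

lemma left_K_left_E (i : ι) (a : Oq D) : left (Uq.K D i) (left (Uq.E D i) a) =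
    (D.qi i ^ (-2 : ℤ)) • left (Uq.E D i) (left (Uq.K D i) a) := by
  have e : Uq.E D i * Uq.K D i = D.qi i ^ (-2 : ℤ) • (Uq.K D i * Uq.E D i) := by
    rw [(Uq.relations D).K_mul_E, smul_smul, D.a_diag, ← zpow_add₀ (D.qi_ne_zero i)]; simp
  rw [← Module.End.mul_apply, ← left_mul, e, left_smul, left_mul]; rfl

lemma left_K_left_F (i : ι) (a : Oq D) : left (Uq.K D i) (left (Uq.F D i) a) =
    (D.qi i ^ (2 : ℤ)) • left (Uq.F D i) (left (Uq.K D i) a) := by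
  have e : Uq.F D i * Uq.K D i = D.qi i ^ (2 : ℤ) • (Uq.K D i * Uq.F D i) := by
    rw [(Uq.relations D).K_mul_F, smul_smul, D.a_diag, ← zpow_add₀ (D.qi_ne_zero i)]; simp
  rw [← Module.End.mul_apply, ← left_mul, e, left_smul, left_mul]; rfl

lemma left_E_left_F (i : ι) (a : Oq D) : left (Uq.E D i) (left (Uq.F D i) a) =
    left (Uq.F D i) (left (Uq.E D i) a) - (D.qi i - (D.qi i)⁻¹)⁻¹ •
      (left (Uq.K D i) a - left (Uq.Kinv D i) a) := by
  have e : Uq.F D i * Uq.E D i = Uq.E D i * Uq.F D i -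
      (D.qi i - (D.qi i)⁻¹)⁻¹ • (Uq.K D i - Uq.Kinv D i) := by
    rw [← (Uq.relations D).E_mul_F_same]; abel
  rw [← Module.End.mul_apply, ← left_mul, e, left_sub, left_mul, left_smul, left_sub]; rfl

/-- For odd `m > 0`, the real number `[m]_q` is positive, whatever the sign of `q`. -/
lemma qNumber_odd_pos {q : ℝ} (h0 : q ≠ 0) (h1 : q ≠ 1) (h2 : q ≠ -1) {m : ℤ} (hm : 0 < m)
    (hodd : Odd m) : 0 < (q ^ m - q ^ (-m)) * (q - q⁻¹)⁻¹ := by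
  have hq2 : 0 < q ^ 2 := by positivity
  have hq2' : q ^ 2 ≠ 1 := by
    intro h
    rcases sq_eq_one_iff.1 h with h | h
    · exact h1 h
    · exact h2 h
  have hd : q - q⁻¹ ≠ 0 := by
    intro h
    apply hq2'
    field_simp at h
    linarith
  have key : 0 < (q ^ m - q ^ (-m)) * (q - q⁻¹) := by
    have e : (q ^ m - q ^ (-m)) * (q - q⁻¹) =
        q ^ (-(m + 1)) * (((q ^ 2) ^ m - 1) * (q ^ 2 - 1)) := by
      rw [← zpow_natCast q 2, ← zpow_mul]
      have a1 : q ^ m = q ^ (-(m + 1)) * q ^ (2 * m) * q := by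
        rw [← zpow_add₀ h0, ← zpow_add_one₀ h0]; congr 1; ring
      have a2 : q ^ (-m) = q ^ (-(m + 1)) * q := by
        rw [← zpow_add_one₀ h0]; congr 1; ring
      push_cast
      rw [a1, a2]
      have : q ^ (2 : ℤ) = q * q := by rw [zpow_ofNat, sq]
      rw [this]
      field_simp
    rw [e]
    refine mul_pos (Even.zpow_pos (hodd.add_one).neg h0) ?_
    rcases lt_or_gt_of_ne hq2' with h | h
    · exact mul_pos_of_neg_of_neg (sub_neg.2 (zpow_lt_one₀ hq2 h hm)) (sub_neg.2 h)
    · exact mul_pos (sub_pos.2 (one_lt_zpow₀ h hm)) (sub_pos.2 h)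
  have := mul_pos key (inv_pos.2 (pow_pos (abs_pos.2 hd) 2))
  rw [sq_abs] at this
  calc 0 < _ := this
    _ = _ := by field_simp

/-- `q_i` as a real number. -/
def _root_.QG.QuantumDatum.qr (D : QuantumDatum ι) (i : ι) : ℝ := D.q ^ D.d i

lemma _root_.QG.QuantumDatum.qi_eq (D : QuantumDatum ι) (i : ι) : D.qi i = (D.qr i : ℂ) := by
  simp [QuantumDatum.qi, QuantumDatum.qr]

lemma left_Kinv_of_left_K {i : ι} {a : Oq D} {c : ℂ} (hc : c ≠ 0)
    (h : left (Uq.K D i) a = c • a) : left (Uq.Kinv D i) a = c⁻¹ • a := by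
  have e : left (Uq.Kinv D i) (left (Uq.K D i) a) = a := by
    rw [← Module.End.mul_apply, ← left_mul, (Uq.relations D).K_mul_Kinv, left_one]; rfl
  rw [h, map_smul] at e
  rw [← e, smul_smul, inv_mul_cancel₀ hc, one_smul, e]

/-- If the Haar functional is positive definite, then the operators `K_i` have positive eigenvalues
in all type 1 representations. For `q_i < 0` this says that all weights are even at `i`. Indeed, let
`f ≠ 0` have odd weight `n` and `E_i f = 0` for left translation. The squares `w_j` of the norms of
`F_i^j f` satisfy `-([n] + [n+2] + ⋯ + [n+2j]) w_j = q_i^{n+2j+2} w_{j+1}`, where `[m]` has the sign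
of `m` for odd `m` and the power of `q_i` on the right is negative. If `n < 0` this makes `w_1`
negative, and if `n > 0` it makes all `F_i^j f` nonzero, while `F_i` is locally nilpotent. -/
theorem zpow_wt_pos {h : Oq D →ₗ[ℂ] ℂ} (hh : IsPosHaar h) (V : Type1Rep D) (k : V.κ) (i : ι) :
    0 < D.qr i ^ V.wt k i := by
  obtain ⟨s, hs, h0, h1, h2⟩ := D.generic i
  have hsq : s = D.qr i := by
    rw [D.qi_eq] at hs
    exact_mod_cast hs.symm
  subst hsq
  rcases lt_or_gt_of_ne h0 with hq | hq
  swap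
  · exact zpow_pos hq _
  by_contra hcon
  have hodd : Odd (V.wt k i) := by
    rw [← Int.not_even_iff_odd]
    exact fun he => hcon (he.zpow_pos h0)
  set q := D.qr i with hqdef
  have hqC : (q : ℂ) ≠ 0 := by exact_mod_cast h0
  -- A vector of odd weight killed by `E_i`.
  obtain ⟨f, n, hn, hf0, hfE, hfK⟩ : ∃ (f : Oq D) (n : ℤ), Odd n ∧ f ≠ 0 ∧
      left (Uq.E D i) f = 0 ∧ left (Uq.K D i) f = (q : ℂ) ^ n • f := by
    obtain ⟨N, hN⟩ := left_E_nilpotent i (coeff V k k)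
    obtain ⟨m, r, -, hm1, hm2, -⟩ := exists_last_pow () hN (coeff_self_ne_zero V k)
    refine ⟨_, V.wt k i - 2 * m, ?_, hm1, hm2, ?_⟩
    · exact hodd.sub_even (even_two_mul _)
    · clear hm1 hm2
      induction m with
      | zero => simp [left_K_coeff, hs]
      | succ m ih =>
        rw [pow_succ', Module.End.mul_apply, left_K_left_E, ih, map_smul, smul_smul, hs,
          ← zpow_add₀ hqC]
        congr 2
        push_cast
        ring
  let br : ℤ → ℝ := fun m => (q ^ m - q ^ (-m)) * (q - q⁻¹)⁻¹
  have hbr : ∀ m : ℤ, 0 < m → Odd m → 0 < br m := fun m hm ho =>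
    qNumber_odd_pos h0 h1 h2 hm ho
  let u : ℕ → Oq D := fun j => (left (Uq.F D i) ^ j) f
  have hu : ∀ j, u (j + 1) = left (Uq.F D i) (u j) := fun j => by
    simp only [u, pow_succ', Module.End.mul_apply]
  have huK : ∀ j, left (Uq.K D i) (u j) = (q : ℂ) ^ (n + 2 * j) • u j := by
    intro j
    induction j with
    | zero => simpa [u] using hfK
    | succ j ih =>
      rw [hu, left_K_left_F, ih, map_smul, smul_smul, hs, ← zpow_add₀ hqC]
      congr 2
      push_cast
      ring
  have huE : ∀ j, left (Uq.E D i) (u (j + 1)) =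
      ((-∑ l ∈ Finset.range (j + 1), br (n + 2 * l) : ℝ) : ℂ) • u j := by
    have hstep : ∀ j, left (Uq.E D i) (u (j + 1)) =
        left (Uq.F D i) (left (Uq.E D i) (u j)) - ((br (n + 2 * j) : ℝ) : ℂ) • u j := by
      intro j
      rw [hu, left_E_left_F, huK, left_Kinv_of_left_K (zpow_ne_zero _ hqC) (huK j), ← sub_smul,
        smul_smul, hs]
      congr 2
      simp only [br, zpow_neg]
      push_cast
      ring
    intro j
    induction j with
    | zero => rw [hstep]; simp [u, hfE]
    | succ j ih =>
      rw [hstep, ih, map_smul, ← hu, ← sub_smul, Finset.sum_range_succ _ (j + 1)]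
      congr 1
      push_cast
      ring
  let w : ℕ → ℝ := fun j => (h (star (u j) * u j)).re
  have hw : ∀ j, (-∑ l ∈ Finset.range (j + 1), br (n + 2 * l)) * w j =
      q ^ (n + 2 * ((j : ℤ) + 1)) * w (j + 1) := by
    intro j
    have e := hh.inner_left_E i (u j) (u (j + 1))
    rw [huE, ← hu, huK, mul_smul_comm, mul_smul_comm, map_smul, map_smul, smul_eq_mul,
      smul_eq_mul] at e
    have e2 : (q : ℂ) ^ (n + 2 * ((j + 1 : ℕ) : ℤ)) =
        ((q ^ (n + 2 * ((j : ℤ) + 1)) : ℝ) : ℂ) := by push_cast; rfl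
    rw [e2] at e
    have := congrArg Complex.re e
    rwa [Complex.re_ofReal_mul, Complex.re_ofReal_mul] at this
  have hneg : ∀ j : ℕ, q ^ (n + 2 * ((j : ℤ) + 1)) < 0 := fun j =>
    (hn.add_even (even_two_mul _)).zpow_neg hq
  have hw0 : ∀ j, 0 ≤ w j := fun j => by
    by_cases h : u j = 0
    · simp [w, h]
    · exact (hh.pos _ h).1.le
  have hn0 : n ≠ 0 := by rintro rfl; simp at hn
  rcases lt_or_gt_of_ne hn0 with hn' | hn'
  · have e := hw 0
    have hb : 0 < -br n := by
      have := hbr (-n) (by omega) hn.neg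
      simp only [br, neg_neg] at this ⊢
      linarith
    have hpos : 0 < w 0 := (hh.pos _ (by simpa [u] using hf0)).1
    simp only [Finset.sum_range_succ, Finset.sum_range_zero, Nat.cast_zero, mul_zero, add_zero,
      zero_add] at e
    have h3 := mul_pos hb hpos
    have h4 := mul_nonpos_of_nonpos_of_nonneg (hneg 0).le (hw0 1)
    simp only [Nat.cast_zero, zero_add] at h4
    linarith
  · have hpos : ∀ j, 0 < w j := by
      intro j
      induction j with
      | zero => exact (hh.pos _ (by simpa [u] using hf0)).1
      | succ j ih =>
        have hs : 0 < ∑ l ∈ Finset.range (j + 1), br (n + 2 * l) :=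
          Finset.sum_pos (fun l _ => hbr _ (by omega) (hn.add_even (even_two_mul _))) (by simp)
        have h3 := mul_pos hs ih
        have h4 := hw j
        refine lt_of_le_of_ne (hw0 _) fun h5 => ?_
        rw [← h5, mul_zero, neg_mul] at h4
        linarith
    obtain ⟨N, hN⟩ := left_F_nilpotent i f
    have := pow_mem_wordKernel (E := fun _ : Unit => left (Uq.F D i)) () N (N := 0) (a := f)
      (by simpa using hN)
    have h0 : u N = 0 := by simpa [wordKernel] using this
    have := hpos N
    simp [w, h0] at this

/-! ### Commutation up to a scalar in the quantised coordinate algebra -/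

lemma iSup_eigenspace_eq_top {T : Module.End ℂ (Oq D)}
    (hT : ∀ V k l, ∃ c : ℝ, 0 < c ∧ T (coeff V k l) = (c : ℂ) • coeff V k l) :
    ⨆ c : {c : ℝ // 0 < c}, T.eigenspace ((c : ℝ) : ℂ) = ⊤ := by
  rw [eq_top_iff]
  rintro a -
  induction a using coeff_induction with
  | coeff V k l =>
    obtain ⟨c, hc, h⟩ := hT V k l
    exact Submodule.mem_iSup_of_mem ⟨c, hc⟩ (Module.End.mem_eigenspace_iff.2 h)
  | zero => exact zero_mem _
  | add f g hf hg => exact add_mem hf hg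
  | smul c f hf => exact Submodule.smul_mem _ c hf

/-- In `O_q(G)`, with a positive definite Haar functional, two nonzero elements that commute up to a
real scalar do so up to a positive scalar. The finite type condition on the Cartan matrix enters
through a functional `c` that is positive on all simple roots. -/
theorem pos_of_mul_eq [Finite ι] {h : Oq D →ₗ[ℂ] ℂ} (hh : IsPosHaar h) (c : ι → ℤ)
    (hc : ∀ j, 0 < ∑ᶠ i, c i * D.a i j) {a z : Oq D} (ha : a ≠ 0) (hz : z ≠ 0) {l : ℝ}
    (haz : a * z = (l : ℂ) • (z * a)) : 0 < l := by
  have := Fintype.ofFinite ι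
  simp only [finsum_eq_sum_of_fintype] at hc
  have hr := Uq.relations D
  let T : ι ⊕ ι → Module.End ℂ (Oq D) :=
    Sum.elim (fun i => left (Uq.K D i)) (fun i => right (Uq.K D i))
  let E : ι ⊕ ι → Module.End ℂ (Oq D) :=
    Sum.elim (fun i => left (Uq.E D i)) (fun i => right (Uq.F D i))
  have hTc : ∀ t V k l, ∃ c : ℝ, 0 < c ∧ T t (coeff V k l) = (c : ℂ) • coeff V k l := by
    rintro (i | i) V k l
    · exact ⟨_, zpow_wt_pos hh V k i, by simp [T, left_K_coeff, D.qi_eq]⟩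
    · exact ⟨_, zpow_wt_pos hh V l i, by simp [T, right_K_coeff, D.qi_eq]⟩
  refine pos_of_mul_eq_smul_mul T E (Bialgebra.counitAlgHom ℂ (Oq D)) ?_ ?_
    (fun t => iSup_eigenspace_eq_top (hTc t)) ?_ ?_ ?_ ?_ ha hz haz
  · rintro (i | i) a b
    · exact left_K_mul i a b
    · exact right_K_mul i a b
  · rintro (i | i) (j | j)
    · change left _ * left _ = left _ * left _
      rw [← left_mul, ← left_mul, hr.K_mul_K]
    · exact commute_left_right _ _
    · exact (commute_left_right _ _).symm
    · change right _ * right _ = right _ * right _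
      rw [← right_mul, ← right_mul, hr.K_mul_K]
  · rintro (i | i) (j | j)
    · refine ⟨D.qi i ^ (-D.a i j), ?_⟩
      change left _ * left _ = _ • (left _ * left _)
      rw [← left_mul, ← left_mul, hr.K_mul_E, left_smul, smul_smul, ← zpow_add₀ (D.qi_ne_zero i)]
      simp
    · exact ⟨1, by rw [one_smul]; exact commute_left_right _ _⟩
    · exact ⟨1, by rw [one_smul]; exact (commute_left_right _ _).symm⟩
    · refine ⟨D.qi i ^ (-D.a i j), ?_⟩
      change right _ * right _ = _ • (right _ * right _)
      rw [← right_mul, ← right_mul, hr.K_mul_F, right_smul]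
  · rintro (i | i) a b hwa hwb
    · obtain ⟨s, hs, e⟩ := hwb (.inl i)
      refine ⟨s, 1, hs, one_pos, ?_⟩
      change left _ _ = _
      rw [left_E_mul]
      change left _ b = _ at e
      rw [e, mul_smul_comm, Complex.ofReal_one, one_smul]
      rfl
    · obtain ⟨s, hs, e⟩ := hwa (.inr i)
      refine ⟨1, s⁻¹, one_pos, inv_pos.2 hs, ?_⟩
      change right _ _ = _
      change right _ a = _ at e
      have e' : right (Uq.Kinv D i) a = (s : ℂ)⁻¹ • a := by
        have h1 : right (Uq.Kinv D i) (right (Uq.K D i) a) = a := by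
          rw [← Module.End.mul_apply, ← right_mul, hr.Kinv_mul_K, right_one]; rfl
        have hs' : (s : ℂ) ≠ 0 := by exact_mod_cast hs.ne'
        rw [e, map_smul] at h1
        nth_rewrite 2 [← h1]
        rw [smul_smul, inv_mul_cancel₀ hs', one_smul]
      rw [right_F_mul, e', smul_mul_assoc, Complex.ofReal_one, one_smul, Complex.ofReal_inv]
      rfl
  -- The height of the two weights of a matrix coefficient, as measured by `c`, decreases
  -- under all `E`.
  · refine exists_mem_wordKernel E fun V k l => exists_coeff_mem_wordKernel E V
      (fun k l => ∑ i, c i * V.wt k i + ∑ i, c i * V.wt l i) ?_ k l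
    rintro (j | j)
    · refine left_coeff_mem fun k m l hne => ?_
      have : ∑ i, c i * V.wt k i = ∑ i, c i * V.wt m i + ∑ i, c i * D.a i j := by
        rw [← Finset.sum_add_distrib]
        exact Finset.sum_congr rfl fun i _ => by rw [wt_of_hom_E_ne_zero hne i, mul_add]
      have := hc j
      omega
    · refine right_coeff_mem fun k m l hne => ?_
      have : ∑ i, c i * V.wt m i = ∑ i, c i * V.wt l i - ∑ i, c i * D.a i j := by
        rw [← Finset.sum_sub_distrib]
        exact Finset.sum_congr rfl fun i _ => by rw [wt_of_hom_F_ne_zero hne i, mul_sub]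
      have := hc j
      omega
  · intro a hwa hEa hε
    refine eq_zero_of_counit_eq_zero (fun i => hEa (.inl i)) (fun i => hEa (.inr i))
      (fun i => ?_) hε
    obtain ⟨s, hs, e⟩ := hwa (.inl i)
    exact ⟨s, by exact_mod_cast hs.ne', e⟩

end Oq

/-! ### Graded components of forms -/

section Components

variable {A H Ω : Type*} [Ring A] [HopfAlgebra ℂ A] [StarRing A]
  [Ring H] [HopfAlgebra ℂ H] [StarRing H] [StarModule ℂ H] [Ring Ω] [Algebra ℂ Ω]

namespace DiffStarCalculus

variable {B : Subalgebra ℂ A} (X : DiffStarCalculus B Ω)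

/-- The component of degree `k` of a form, as an element of `Ω^k`. -/
def proj (k : ℕ) : Ω →ₗ[ℂ] X.deg k :=
  DirectSum.component ℂ ℕ (fun k => X.deg k) k ∘ₗ
    (LinearEquiv.ofBijective (DirectSum.coeLinearMap X.deg) X.isInternal).symm.toLinearMap

lemma component_eq_proj (k : ℕ) (x : Ω) : X.component k x = X.proj k x := rfl

lemma symm_of_mem {k : ℕ} {x : Ω} (hx : x ∈ X.deg k) :
    (LinearEquiv.ofBijective (DirectSum.coeLinearMap X.deg) X.isInternal).symm x =
      DirectSum.lof ℂ ℕ (fun k => X.deg k) k ⟨x, hx⟩ := by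
  rw [LinearEquiv.symm_apply_eq]
  exact (DirectSum.coeLinearMap_lof (R := ℂ) X.deg k ⟨x, hx⟩).symm

lemma proj_of_mem {k : ℕ} {x : Ω} (hx : x ∈ X.deg k) : X.proj k x = ⟨x, hx⟩ := by
  rw [proj, LinearMap.comp_apply, LinearEquiv.coe_coe, symm_of_mem X hx,
    DirectSum.component.lof_self]

lemma proj_of_mem_ne {k l : ℕ} {x : Ω} (hx : x ∈ X.deg k) (h : k ≠ l) : X.proj l x = 0 := by
  rw [proj, LinearMap.comp_apply, LinearEquiv.coe_coe, symm_of_mem X hx,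
    DirectSum.component.of, dif_neg h]

lemma iSup_deg : ⨆ k, X.deg k = ⊤ := X.isInternal.submodule_iSup_eq_top

lemma incl_mem (b : B) : X.incl b ∈ X.deg 0 := (X.mem_deg_zero _).2 ⟨b, rfl⟩

lemma proj_incl_mul (k : ℕ) (b : B) (x : Ω) :
    (X.proj k (X.incl b * x) : Ω) = X.incl b * X.proj k x := by
  have hx : x ∈ ⨆ k, X.deg k := by rw [iSup_deg]; trivial
  induction hx using Submodule.iSup_induction' with
  | mem l y hy =>
    have hy' : X.incl b * y ∈ X.deg l := by simpa using X.mul_mem (X.incl_mem b) hy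
    by_cases h : l = k
    · subst h; rw [proj_of_mem X hy, proj_of_mem X hy']
    · rw [proj_of_mem_ne X hy h, proj_of_mem_ne X hy' h]; simp
  | zero => simp
  | add y z _ _ hy hz => simp only [mul_add, map_add, Submodule.coe_add, hy, hz]

end DiffStarCalculus

variable [StarModule ℂ A]

namespace CQHComplexSpace

variable (X : CQHComplexSpace A H Ω)

lemma decomp_of_mem {p : ℕ × ℕ} {x : Ω} (hx : x ∈ X.bideg p) :
    X.decomp x = DirectSum.lof ℂ (ℕ × ℕ) (fun p => X.bideg p) p ⟨x, hx⟩ := by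
  unfold decomp
  rw [LinearEquiv.symm_apply_eq]
  exact (DirectSum.coeLinearMap_lof (R := ℂ) X.bideg p ⟨x, hx⟩).symm

lemma component_of_mem {p : ℕ × ℕ} {x : Ω} (hx : x ∈ X.bideg p) : X.component p x = x := by
  change ((DirectSum.component ℂ (ℕ × ℕ) (fun p => X.bideg p) p (X.decomp x) : X.bideg p) : Ω) = x
  rw [decomp_of_mem X hx, DirectSum.component.lof_self]

lemma component_of_mem_ne {p r : ℕ × ℕ} {x : Ω} (hx : x ∈ X.bideg p) (h : p ≠ r) :
    X.component r x = 0 := by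
  change ((DirectSum.component ℂ (ℕ × ℕ) (fun p => X.bideg p) r (X.decomp x) : X.bideg r) : Ω) = 0
  rw [decomp_of_mem X hx, DirectSum.component.of, dif_neg h]; rfl

lemma component_mem (p : ℕ × ℕ) (x : Ω) : X.component p x ∈ X.bideg p :=
  (DirectSum.component ℂ (ℕ × ℕ) (fun p => X.bideg p) p (X.decomp x)).2

lemma del_of_mem {a b : ℕ} {x : Ω} (hx : x ∈ X.bideg (a, b)) :
    X.del x = X.component (a + 1, b) (X.forms.d x) := by
  change DirectSum.toModule ℂ (ℕ × ℕ) Ω _ (X.decomp x) = _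
  rw [decomp_of_mem X hx, DirectSum.toModule_lof]; rfl

lemma delbar_of_mem {a b : ℕ} {x : Ω} (hx : x ∈ X.bideg (a, b)) :
    X.delbar x = X.component (a, b + 1) (X.forms.d x) := by
  change DirectSum.toModule ℂ (ℕ × ℕ) Ω _ (X.decomp x) = _
  rw [decomp_of_mem X hx, DirectSum.toModule_lof]; rfl

lemma iSup_bideg : ⨆ p, X.bideg p = ⊤ := X.isInternal.submodule_iSup_eq_top

lemma bideg_le_deg (p : ℕ × ℕ) : X.bideg p ≤ X.forms.deg (p.1 + p.2) := by
  rw [X.deg_eq]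
  exact le_iSup₂_of_le p rfl le_rfl

lemma incl_mem (b : coinvariants X.proj) : X.forms.incl b ∈ X.bideg (0, 0) := by
  have h := X.forms.incl_mem b
  rw [X.deg_eq] at h
  refine (iSup₂_le fun p hp => ?_ : _ ≤ X.bideg (0, 0)) h
  obtain ⟨h1, h2⟩ : p.1 = 0 ∧ p.2 = 0 := by omega
  rw [show p = (0, 0) from Prod.ext h1 h2]

lemma del_incl_mem (b : coinvariants X.proj) : X.del (X.forms.incl b) ∈ X.bideg (1, 0) := by
  rw [X.del_of_mem (X.incl_mem b)]
  exact X.component_mem _ _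

/-- `d b = ∂ b + ∂̄ b`. -/
lemma d_incl (b : coinvariants X.proj) :
    X.forms.d (X.forms.incl b) = X.del (X.forms.incl b) + X.delbar (X.forms.incl b) := by
  rw [X.del_of_mem (X.incl_mem b), X.delbar_of_mem (X.incl_mem b)]
  obtain ⟨y, hy, w, hw, h⟩ := Submodule.mem_sup.1 (X.d_mem (X.incl_mem b))
  rw [← h, map_add, map_add, X.component_of_mem hy, X.component_of_mem_ne hw (by simp),
    X.component_of_mem_ne hy (by simp), X.component_of_mem hw]
  simp

/-- Complex conjugation takes `ker ∂` to `ker ∂̄` in degree zero. -/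
lemma delbar_incl_star {b b' : coinvariants X.proj} (hb : (b' : A) = star (b : A))
    (h : X.del (X.forms.incl b) = 0) : X.delbar (X.forms.incl b') = 0 := by
  have hd := X.d_incl b
  rw [h, zero_add, X.delbar_of_mem (X.incl_mem b)] at hd
  have h1 : X.forms.d (X.forms.incl b') ∈ X.bideg (1, 0) := by
    rw [← X.forms.st_incl b b' hb, ← X.forms.st_d, hd]
    exact X.st_mem (X.component_mem _ _)
  rw [X.delbar_of_mem (X.incl_mem b'), X.component_of_mem_ne h1 (by simp)]

/-- The Hodge map has its defining property unless it is the junk value zero. -/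
lemma hodge_isHodge {n : ℕ} {σ : Ω} (h : X.hodge n σ ≠ 0) : X.IsHodge n σ (X.hodge n σ) := by
  unfold hodge at h ⊢
  split_ifs at h ⊢ with hT
  · exact hT.choose_spec
  · exact absurd rfl h

end CQHComplexSpace

/-! ### Embedding `Ω^{(1,0)}` into copies of the quantum group -/

namespace CQHCalculusSpace

variable (X : CQHCalculusSpace A H Ω)

/-- The functional `x ↦ ε(vol(x))`, extended by zero to forms that are not of top degree. -/
def topCounit : Ω →ₗ[ℂ] ℂ :=
  Coalgebra.counit (R := ℂ) (A := A) ∘ₗ (coinvariants X.proj).val.toLinearMap ∘ₗ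
    X.vol.toLinearMap ∘ₗ X.forms.proj X.m

lemma topCounit_incl_mul (b : coinvariants X.proj) (x : Ω) :
    X.topCounit (X.forms.incl b * x) = Coalgebra.counit (R := ℂ) (b : A) * X.topCounit x := by
  have h := X.vol_mul_left b _ _ (X.forms.proj_incl_mul X.m b x)
  simp only [topCounit, LinearMap.comp_apply, LinearEquiv.coe_coe, h]
  exact Bialgebra.counit_mul _ _

lemma topCounit_of_mem {x : Ω} (hx : x ∈ X.forms.deg X.m) :
    X.topCounit x = Coalgebra.counit (R := ℂ) (X.vol ⟨x, hx⟩ : A) := by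
  simp [topCounit, X.forms.proj_of_mem hx]

/-- The functional `x ↦ ε(vol(x ∧ ν))`. -/
def fibreFunctional (ν : Ω) : Ω →ₗ[ℂ] ℂ := X.topCounit ∘ₗ LinearMap.mulRight ℂ ν

lemma fibreFunctional_incl_mul (ν : Ω) (b : coinvariants X.proj) (x : Ω) :
    X.fibreFunctional ν (X.forms.incl b * x) =
      Coalgebra.counit (R := ℂ) (b : A) * X.fibreFunctional ν x := by
  simp only [fibreFunctional, LinearMap.comp_apply, LinearMap.mulRight_apply, mul_assoc,
    topCounit_incl_mul]

/-- The functional vanishes on `B⁺ Ω`, hence on `Ω B⁺`, because `Ω B⁺ ⊆ B⁺ Ω`. -/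
lemma fibreFunctional_mul_incl (ν : Ω) (b : coinvariants X.proj) (x : Ω) :
    X.fibreFunctional ν (x * X.forms.incl b) =
      X.fibreFunctional ν x * Coalgebra.counit (R := ℂ) (b : A) := by
  have hplus : X.forms.plusMul ≤ LinearMap.ker (X.fibreFunctional ν) := by
    refine Submodule.span_le.2 ?_
    rintro _ ⟨b, y, hb, rfl⟩
    change X.fibreFunctional ν _ = 0
    rw [fibreFunctional_incl_mul, hb, zero_mul]
  let b₀ : coinvariants X.proj :=
    b - algebraMap ℂ (coinvariants X.proj) (Coalgebra.counit (R := ℂ) (b : A))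
  have hb₀ : Coalgebra.counit (R := ℂ) (b₀ : A) = 0 := by
    change Coalgebra.counit (R := ℂ) ((b : A) - algebraMap ℂ A _) = 0
    rw [map_sub, Bialgebra.counit_algebraMap, sub_self]
  have h := hplus (X.mul_plus x b₀ hb₀)
  rw [LinearMap.mem_ker, map_sub, AlgHom.commutes, mul_sub, ← Algebra.commutes, ← Algebra.smul_def,
    map_sub, map_smul, sub_eq_zero] at h
  rw [h, smul_eq_mul, mul_comm]

/-- The map `ω ↦ ω₍₋₁₎ φ(ω₍₀₎)` from `Ω` to `A`, for the functional `φ(x) = ε(vol(x ∧ ν))`. It is a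
`B`-bimodule map. -/
def fibreMap (ν : Ω) : Ω →ₗ[ℂ] A :=
  (TensorProduct.rid ℂ A).toLinearMap ∘ₗ (X.fibreFunctional ν).lTensor A ∘ₗ X.coact.toLinearMap

lemma fibreMap_apply (ν x : Ω) : X.fibreMap ν x =
    TensorProduct.rid ℂ A ((X.fibreFunctional ν).lTensor A (X.coact x)) := rfl

lemma coact_incl (b : coinvariants X.proj) : ∃ t : A ⊗[ℂ] coinvariants X.proj,
    X.coact (X.forms.incl b) = X.forms.incl.toLinearMap.lTensor A t ∧
    TensorProduct.rid ℂ A ((Coalgebra.counit (R := ℂ) (A := A) ∘ₗ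
      (coinvariants X.proj).val.toLinearMap).lTensor A t) = b := by
  obtain ⟨t, ht, ht'⟩ := X.covariant.extends_comul b
  refine ⟨t, ht'.symm, ?_⟩
  rw [LinearMap.lTensor_comp, LinearMap.comp_apply, ht]
  have := LinearMap.congr_fun (Coalgebra.lTensor_counit_comp_comul (R := ℂ) (A := A)) (b : A)
  rw [LinearMap.comp_apply] at this
  rw [this]
  simp

lemma fibreMap_incl_mul (ν : Ω) (b : coinvariants X.proj) (x : Ω) :
    X.fibreMap ν (X.forms.incl b * x) = b * X.fibreMap ν x := by
  have key : ∀ (t : A ⊗[ℂ] coinvariants X.proj) (u : A ⊗[ℂ] Ω),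
      TensorProduct.rid ℂ A ((X.fibreFunctional ν).lTensor A
        (X.forms.incl.toLinearMap.lTensor A t * u)) =
      TensorProduct.rid ℂ A ((Coalgebra.counit (R := ℂ) (A := A) ∘ₗ
        (coinvariants X.proj).val.toLinearMap).lTensor A t) *
      TensorProduct.rid ℂ A ((X.fibreFunctional ν).lTensor A u) := by
    intro t u
    induction t with
    | zero => simp
    | add t t' ht ht' => simp only [map_add, add_mul, ht, ht']
    | tmul a c =>
      induction u with
      | zero => simp
      | add u u' hu hu' => rw [mul_add, map_add, map_add, hu, hu', map_add, map_add, mul_add]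
      | tmul a' y => simp [fibreFunctional_incl_mul, smul_smul, mul_comm]
  obtain ⟨t, ht, ht'⟩ := X.coact_incl b
  rw [fibreMap_apply, map_mul, ht, key, ht', fibreMap_apply]

lemma fibreMap_mul_incl (ν : Ω) (b : coinvariants X.proj) (x : Ω) :
    X.fibreMap ν (x * X.forms.incl b) = X.fibreMap ν x * b := by
  have key : ∀ (t : A ⊗[ℂ] coinvariants X.proj) (u : A ⊗[ℂ] Ω),
      TensorProduct.rid ℂ A ((X.fibreFunctional ν).lTensor A
        (u * X.forms.incl.toLinearMap.lTensor A t)) =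
      TensorProduct.rid ℂ A ((X.fibreFunctional ν).lTensor A u) *
      TensorProduct.rid ℂ A ((Coalgebra.counit (R := ℂ) (A := A) ∘ₗ
        (coinvariants X.proj).val.toLinearMap).lTensor A t) := by
    intro t u
    induction t with
    | zero => simp
    | add t t' ht ht' => simp only [map_add, mul_add, ht, ht']
    | tmul a c =>
      induction u with
      | zero => simp
      | add u u' hu hu' => rw [add_mul, map_add, map_add, hu, hu', map_add, map_add, add_mul]
      | tmul a' y => simp [fibreFunctional_mul_incl, smul_smul, mul_comm]
  obtain ⟨t, ht, ht'⟩ := X.coact_incl b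
  rw [fibreMap_apply, map_mul, ht, key, ht', fibreMap_apply]

/-- If all the maps `fibreMap ν` vanish at `ω`, then `ω` pairs to zero with all forms of
complementary degree. -/
lemma mul_eq_zero_of_fibreMap_eq_zero {ω : Ω} (h : ∀ ν, X.fibreMap ν ω = 0) {ν : Ω}
    (hν : ω * ν ∈ X.forms.deg X.m) : ω * ν = 0 := by
  have h1 : ∀ v : A ⊗[ℂ] Ω,
      TensorProduct.rid ℂ A (X.topCounit.lTensor A (X.coact ω * v)) = 0 := by
    intro v
    induction v with
    | zero => simp
    | add v v' hv hv' => rw [mul_add, map_add, map_add, hv, hv', add_zero]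
    | tmul a y =>
      have h2 : ∀ u : A ⊗[ℂ] Ω, TensorProduct.rid ℂ A (X.topCounit.lTensor A (u * (a ⊗ₜ y))) =
          TensorProduct.rid ℂ A ((X.fibreFunctional y).lTensor A u) * a := by
        intro u
        induction u with
        | zero => simp
        | add u u' hu hu' => rw [add_mul, map_add, map_add, hu, hu', map_add, map_add, add_mul]
        | tmul a' y' => simp [fibreFunctional]
      rw [h2, ← fibreMap_apply, h, zero_mul]
  have h2 := h1 (X.coact ν)
  rw [← map_mul] at h2
  obtain ⟨t, ht, ht'⟩ := X.vol_coact ⟨_, hν⟩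
  have h3 : X.topCounit ∘ₗ (X.forms.deg X.m).subtype =
      Coalgebra.counit (R := ℂ) (A := A) ∘ₗ
        ((coinvariants X.proj).val.toLinearMap ∘ₗ X.vol.toLinearMap) := by
    ext x
    exact X.topCounit_of_mem x.2
  rw [← ht, ← LinearMap.comp_apply, ← LinearMap.lTensor_comp, h3, LinearMap.lTensor_comp,
    LinearMap.comp_apply, ht'] at h2
  have h4 := LinearMap.congr_fun (Coalgebra.lTensor_counit_comp_comul (R := ℂ) (A := A))
    (X.vol ⟨_, hν⟩ : A)
  rw [LinearMap.comp_apply] at h4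
  rw [h4] at h2
  have h5 : X.vol ⟨_, hν⟩ = 0 := Subtype.ext (by simpa using h2)
  have h6 := X.vol.map_eq_zero_iff.1 h5
  exact congrArg Subtype.val h6

end CQHCalculusSpace

namespace CQHHermitianSpace

variable (X : CQHHermitianSpace A H Ω)

lemma hodgeStar_ne_zero (h : (1 : Ω) ≠ 0) : X.hodgeStar ≠ 0 := by
  intro h0
  obtain ⟨b, hb, hb'⟩ := X.metric_pos 1 h
  apply hb.1
  have h1 : X.metric X.n X.σ 1 1 = 0 := by
    unfold CQHComplexSpace.metric
    refine Finset.sum_eq_zero fun k _ => ?_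
    change X.hodgeStar _ = 0
    rw [h0]; rfl
  rw [h1] at hb'
  have h2 : b = 0 := X.forms.incl_injective (by rw [map_zero, hb'])
  rw [h2]; rfl

lemma deg_eq_bot {k : ℕ} (hk : 2 * X.n < k) : X.forms.deg k = ⊥ :=
  X.totalDegree.2 k (by rw [X.m_eq]; exact hk)

lemma σ_pow_mem (k : ℕ) : X.σ ^ k ∈ X.bideg (k, k) := by
  induction k with
  | zero => simpa using X.incl_mem 1
  | succ k ih => rw [pow_succ]; exact X.mul_mem ih X.σ_mem

/-- The maps `fibreMap ν` separate the points of `Ω^{(1,0)}`, because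
`g(ω^*, ω^*) = *(*(ω) ∧ ω^*)` is nonzero and `*(ω)` is a multiple of `σ^{n-1} ∧ ω`. -/
lemma exists_fibreMap_ne_zero {ω : Ω} (hω : ω ∈ X.bideg (1, 0)) (h0 : ω ≠ 0) :
    ∃ ν, X.fibreMap ν ω ≠ 0 := by
  by_contra hcon
  push Not at hcon
  have h1 : (1 : Ω) ≠ 0 := fun h => h0 (by rw [← one_mul ω, h, zero_mul])
  have hH := X.hodge_isHodge (X.hodgeStar_ne_zero h1)
  have hdeg : ω ∈ X.forms.deg 1 := X.bideg_le_deg (1, 0) hω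
  have hn : 1 ≤ X.n := by
    by_contra hn
    rw [X.deg_eq_bot (by omega)] at hdeg
    exact h0 ((Submodule.mem_bot ℂ).1 hdeg)
  have hst : X.forms.st ω ∈ X.forms.deg 1 := X.bideg_le_deg (0, 1) (X.st_mem hω)
  have hst0 : X.forms.st ω ≠ 0 := fun h => h0 (by rw [← X.forms.st_st ω, h, map_zero])
  have hprim : X.IsPrimitive X.n X.σ 1 0 ω := by
    refine ⟨hn, hω, ?_⟩
    have : X.σ ^ (X.n - (1 + 0) + 1) * ω ∈ X.forms.deg (2 * X.n + 1) := by
      have := X.bideg_le_deg _ (X.mul_mem (X.σ_pow_mem (X.n - (1 + 0) + 1)) hω)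
      convert this using 2
      simp
      omega
    rw [X.deg_eq_bot (by omega)] at this
    exact (Submodule.mem_bot ℂ).1 this
  have hstar := hH 1 0 0 ω hprim (by omega)
  rw [pow_zero, one_mul] at hstar
  have hzero : ω * (X.σ ^ (X.n - 0 - (1 + 0)) * X.forms.st ω) = 0 := by
    refine X.mul_eq_zero_of_fibreMap_eq_zero hcon ?_
    rw [X.m_eq]
    have := X.bideg_le_deg _ (X.mul_mem hω (X.mul_mem (X.σ_pow_mem (X.n - 0 - (1 + 0)))
      (X.st_mem hω)))
    convert this using 2
    simp
    omega
  have hcen : ∀ k (x : Ω), X.σ ^ k * x = x * X.σ ^ k := fun k x =>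
    (Commute.pow_left (X.σ_central x) k)
  rw [← mul_assoc, ← hcen] at hzero
  obtain ⟨b, hb, hb'⟩ := X.metric_pos _ hst0
  apply hb.1
  have hmet : X.metric X.n X.σ (X.forms.st ω) (X.forms.st ω) = 0 := by
    unfold CQHComplexSpace.metric
    refine Finset.sum_eq_zero fun k _ => ?_
    rw [DiffStarCalculus.component_eq_proj]
    by_cases hk : 1 = k
    · subst hk
      rw [DiffStarCalculus.proj_of_mem _ hst, X.forms.st_st, hstar, smul_mul_assoc, hzero,
        smul_zero, map_zero]
    · rw [DiffStarCalculus.proj_of_mem_ne _ hst hk]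
      simp
  rw [hmet] at hb'
  have h2 : b = 0 := X.forms.incl_injective (by rw [map_zero, hb'])
  rw [h2]; rfl

/-- An element `b` of `B` killed by `∂̄` is harmonic: the form `*_σ(b)` has top degree, so that
`∂̄^†` vanishes on `B`. -/
lemma laplacian_incl_eq_zero {b : X.space} (hb : X.delbar (X.forms.incl b) = 0) :
    X.laplacian (X.forms.incl b) = 0 := by
  have hadj : X.delbarAdj (X.forms.incl b) = 0 := by
    change -(X.hodgeStar (X.del (X.hodgeStar (X.forms.incl b)))) = 0
    by_cases h0 : X.hodgeStar = 0
    · rw [h0]; simp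
    have hprim : X.IsPrimitive X.n X.σ 0 0 (X.forms.incl b) := by
      refine ⟨by omega, X.incl_mem b, ?_⟩
      have := X.bideg_le_deg _ (X.mul_mem (X.σ_pow_mem (X.n - (0 + 0) + 1)) (X.incl_mem b))
      rw [X.deg_eq_bot (by simp; omega)] at this
      exact (Submodule.mem_bot ℂ).1 this
    have hstar := X.hodge_isHodge h0 0 0 0 _ hprim (by omega)
    rw [pow_zero, one_mul] at hstar
    have hmem := X.mul_mem (X.σ_pow_mem (X.n - 0 - (0 + 0))) (X.incl_mem b)
    have hd := X.forms.d_mem (X.bideg_le_deg _ hmem)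
    rw [X.deg_eq_bot (by simp; omega)] at hd
    rw [hstar, map_smul,
      X.del_of_mem (a := X.n - 0 - (0 + 0) + 0) (b := X.n - 0 - (0 + 0) + 0) hmem,
      (Submodule.mem_bot ℂ).1 hd]
    simp
  change (X.delbar + X.delbarAdj) ((X.delbar + X.delbarAdj) (X.forms.incl b)) = 0
  rw [LinearMap.add_apply _ _ (X.forms.incl b), hb, hadj]
  simp

end CQHHermitianSpace

end Components

/-! ### Semisimplicity of comodules -/

namespace Oq

variable {ι : Type*} {D : QuantumDatum ι}

lemma left_apply (Y : Uq D) (f : Oq D) : left Y f = TensorProduct.lid ℂ (Oq D)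
    (((ev D).flip Y).rTensor (Oq D) (Coalgebra.comul (R := ℂ) f)) := rfl

/-- Elements of `O_q(G) ⊗ M` are separated by evaluating the first leg. -/
lemma eq_zero_of_forall_ev {M : Type*} [AddCommGroup M] [Module ℂ M] {t : Oq D ⊗[ℂ] M}
    (h : ∀ Y, TensorProduct.lid ℂ M (((ev D).flip Y).rTensor M t) = 0) : t = 0 := by
  classical
  let b := Module.Basis.ofVectorSpace ℂ M
  let e := TensorProduct.equivFinsuppOfBasisRight (M := Oq D) b
  have key : ∀ Y t n, b.repr (TensorProduct.lid ℂ M (((ev D).flip Y).rTensor M t)) n =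
      ev D (e t n) Y := by
    intro Y t n
    induction t with
    | zero => simp
    | add x y hx hy => simp only [map_add, Finsupp.add_apply, LinearMap.add_apply, hx, hy]
    | tmul f g => simp [e, mul_comm]
  have : e t = 0 := by
    ext n Y
    rw [← key, h]
    simp
  exact e.map_eq_zero_iff.1 this

/-- Subspaces stable under left translation are subcomodules, as elements of `O_q(G)` are determined
by their values on `U_q(𝔤)`. -/
lemma isSubcomodule_of_left_mem {W : Submodule ℂ (Oq D)} (h : ∀ Y, ∀ w ∈ W, left Y w ∈ W) :
    IsSubcomodule (Coalgebra.comul (R := ℂ) (A := Oq D)) W := by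
  intro w hw
  have hex := lTensor_exact (Oq D) (LinearMap.exact_subtype_mkQ W) W.mkQ_surjective
  refine (hex _).1 (eq_zero_of_forall_ev fun Y => ?_)
  have key : ∀ t : Oq D ⊗[ℂ] Oq D, TensorProduct.lid ℂ (Oq D ⧸ W)
      (((ev D).flip Y).rTensor (Oq D ⧸ W) (W.mkQ.lTensor (Oq D) t)) =
      W.mkQ (TensorProduct.lid ℂ (Oq D) (((ev D).flip Y).rTensor (Oq D) t)) := by
    intro t
    induction t with
    | zero => simp
    | add x y hx hy => simp only [map_add, hx, hy]
    | tmul f g => simp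
  rw [key, ← left_apply]
  simpa using h Y w hw

lemma lid_rTensor_mem {M : Type*} [AddCommGroup M] [Module ℂ M] {W : Submodule ℂ M} (Y : Uq D)
    {t : Oq D ⊗[ℂ] M} (ht : t ∈ LinearMap.range (W.subtype.lTensor (Oq D))) :
    TensorProduct.lid ℂ M (((ev D).flip Y).rTensor M t) ∈ W := by
  obtain ⟨u, rfl⟩ := ht
  induction u with
  | zero => simp
  | add x y hx hy => simp only [map_add]; exact W.add_mem hx hy
  | tmul f g => simpa using W.smul_mem _ g.2

lemma left_mem_of_isSubcomodule {W : Submodule ℂ (Oq D)}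
    (h : IsSubcomodule (Coalgebra.comul (R := ℂ) (A := Oq D)) W) (Y : Uq D) {w : Oq D}
    (hw : w ∈ W) : left Y w ∈ W :=
  lid_rTensor_mem Y (h w hw)

/-- The map `Y ↦ left Y f`, whose range is the subcomodule generated by `f`. -/
def orbit (f : Oq D) : Uq D →ₗ[ℂ] Oq D where
  toFun Y := left Y f
  map_add' X Y := by rw [left_add]; rfl
  map_smul' c X := by rw [left_smul]; rfl

lemma finiteDimensional_orbit (f : Oq D) : FiniteDimensional ℂ (LinearMap.range (orbit f)) := by
  suffices ∃ W : Submodule ℂ (Oq D), FiniteDimensional ℂ W ∧ LinearMap.range (orbit f) ≤ W by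
    obtain ⟨W, hW, hle⟩ := this
    exact Submodule.finiteDimensional_of_le hle
  induction f using coeff_induction with
  | coeff V k l =>
    refine ⟨Submodule.span ℂ (Set.range fun m => coeff V m l),
      FiniteDimensional.span_of_finite ℂ (Set.finite_range _), ?_⟩
    rintro _ ⟨Y, rfl⟩
    change left Y (coeff V k l) ∈ _
    rw [left_coeff]
    exact Submodule.sum_mem _ fun m _ =>
      Submodule.smul_mem _ _ (Submodule.subset_span ⟨m, rfl⟩)
  | zero =>
    refine ⟨⊥, inferInstance, ?_⟩
    rintro _ ⟨Y, rfl⟩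
    exact (Submodule.mem_bot ℂ).2 (map_zero (left Y))
  | add f g hf hg =>
    obtain ⟨V, hV, hV'⟩ := hf
    obtain ⟨W, hW, hW'⟩ := hg
    refine ⟨V ⊔ W, inferInstance, ?_⟩
    rintro _ ⟨Y, rfl⟩
    change left Y (f + g) ∈ _
    rw [map_add]
    exact Submodule.add_mem_sup (hV' ⟨Y, rfl⟩) (hW' ⟨Y, rfl⟩)
  | smul c f hf =>
    obtain ⟨V, hV, hV'⟩ := hf
    refine ⟨V, hV, ?_⟩
    rintro _ ⟨Y, rfl⟩
    change left Y (c • f) ∈ _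
    rw [map_smul]
    exact V.smul_mem c (hV' ⟨Y, rfl⟩)

/-- The inner product `⟨a, b⟩ = h(a^* b)`. -/
abbrev IsPosHaar.core {h : Oq D →ₗ[ℂ] ℂ} (hh : IsPosHaar h) :
    InnerProductSpace.Core ℂ (Oq D) where
  inner a b := h (star a * b)
  conj_inner_symm a b := hh.symm a b
  re_inner_nonneg a := by
    by_cases ha : a = 0
    · simp [ha]
    · exact (hh.pos a ha).1.le
  add_left a b c := by rw [star_add, add_mul, map_add]
  smul_left a b r := by rw [star_smul, smul_mul_assoc, map_smul]; rfl
  definite a ha := by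
    by_contra h0
    have := (hh.pos a h0).1
    rw [ha] at this
    simp at this

/-- Finite-dimensional subcomodules have complements, namely their orthogonal complements for the
Haar inner product. -/
lemma IsPosHaar.exists_complement {h : Oq D →ₗ[ℂ] ℂ} (hh : IsPosHaar h)
    {W C : Submodule ℂ (Oq D)} [FiniteDimensional ℂ W] (hWC : W ≤ C)
    (hW : ∀ Y, ∀ w ∈ W, left Y w ∈ W) (hC : ∀ Y, ∀ w ∈ C, left Y w ∈ C) :
    ∃ W' ≤ C, (∀ Y, ∀ w ∈ W', left Y w ∈ W') ∧ W ⊔ W' = C ∧ W ⊓ W' = ⊥ := by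
  let N : Submodule ℂ (Oq D) :=
    { carrier := {b | ∀ a ∈ W, h (star a * b) = 0}
      add_mem' := fun {x y} hx hy a ha => by rw [mul_add, map_add, hx a ha, hy a ha, add_zero]
      zero_mem' := fun a _ => by simp
      smul_mem' := fun c x hx a ha => by rw [mul_smul_comm, map_smul, hx a ha, smul_zero] }
  have hN : ∀ Y, ∀ b ∈ N, left Y b ∈ N := by
    intro Y
    induction Y using Uq.gen_induction with
    | alg c =>
      intro b hb
      rw [Algebra.algebraMap_eq_smul_one, left_smul, left_one]
      exact N.smul_mem c hb
    | add X Y hX hY => intro b hb; rw [left_add]; exact N.add_mem (hX b hb) (hY b hb)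
    | mul X Y hX hY => intro b hb; rw [left_mul]; exact hY _ (hX b hb)
    | K i => intro b hb a ha; rw [hh.inner_left_K]; exact hb _ (hW _ a ha)
    | Kinv i => intro b hb a ha; rw [hh.inner_left_Kinv]; exact hb _ (hW _ a ha)
    | E i =>
      intro b hb a ha
      rw [hh.inner_left_E, hh.inner_left_K]
      exact hb _ (hW _ _ (hW _ a ha))
    | F i =>
      intro b hb a ha
      -- `K_i` is invertible on `W`, so `a` may be replaced by `K_i a`.
      have e : left (Uq.K D i) (left (Uq.Kinv D i) a) = a := by
        rw [← Module.End.mul_apply, ← left_mul, (Uq.relations D).Kinv_mul_K, left_one]; rfl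
      rw [← e, hh.inner_left_F]
      exact hb _ (hW _ _ (hW _ a ha))
  have hsup : W ⊔ N = ⊤ := by
    let _ : NormedAddCommGroup (Oq D) := hh.core.toNormedAddCommGroup
    let _ : InnerProductSpace ℂ (Oq D) := InnerProductSpace.ofCore hh.core.toCore
    have hNW : N = Wᗮ := by
      ext x
      exact Iff.rfl.trans (Submodule.mem_orthogonal W x).symm
    rw [hNW]
    exact Submodule.sup_orthogonal_of_hasOrthogonalProjection (K := W)
  have hinf : W ⊓ N = ⊥ := by
    rw [eq_bot_iff]
    rintro x ⟨hx, hx'⟩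
    by_contra h0
    have := (hh.pos x h0).1
    rw [hx' x hx] at this
    simp at this
  refine ⟨C ⊓ N, inf_le_left, fun Y w hw => ⟨hC Y w hw.1, hN Y w hw.2⟩, ?_, ?_⟩
  · rw [inf_comm, ← sup_inf_assoc_of_le N hWC, hsup, top_inf_eq]
  · rw [eq_bot_iff, ← hinf]
    exact inf_le_inf_left W inf_le_right

end Oq

/-! ### Translation of forms -/

namespace CQHComplexSpace

variable {ι : Type*} {D : QuantumDatum ι} {H Ω : Type*} [Ring H] [HopfAlgebra ℂ H] [StarRing H]
  [StarModule ℂ H] [Ring Ω] [Algebra ℂ Ω] (X : CQHComplexSpace (Oq D) H Ω)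

/-- The operator `ω ↦ ⟨Y, ω₍₋₁₎⟩ ω₍₀₎` on forms. -/
def formLeft (Y : Uq D) : Ω →ₗ[ℂ] Ω :=
  (TensorProduct.lid ℂ Ω).toLinearMap ∘ₗ ((Oq.ev D).flip Y).rTensor Ω ∘ₗ X.coact.toLinearMap

lemma formLeft_mem (Y : Uq D) {p : ℕ × ℕ} {x : Ω} (hx : x ∈ X.bideg p) :
    X.formLeft Y x ∈ X.bideg p :=
  Oq.lid_rTensor_mem Y (X.isSubcomodule p x hx)

lemma formLeft_component (Y : Uq D) (p : ℕ × ℕ) (x : Ω) :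
    X.formLeft Y (X.component p x) = X.component p (X.formLeft Y x) := by
  have hx : x ∈ ⨆ p, X.bideg p := by rw [iSup_bideg]; trivial
  induction hx using Submodule.iSup_induction' with
  | mem r y hy =>
    by_cases h : r = p
    · subst h; rw [component_of_mem X hy, component_of_mem X (X.formLeft_mem Y hy)]
    · rw [component_of_mem_ne X hy h, component_of_mem_ne X (X.formLeft_mem Y hy) h, map_zero]
  | zero => simp
  | add y z _ _ hy hz => simp only [map_add, hy, hz]

lemma formLeft_d (Y : Uq D) (x : Ω) : X.formLeft Y (X.forms.d x) = X.forms.d (X.formLeft Y x) := by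
  have key : ∀ t : Oq D ⊗[ℂ] Ω, TensorProduct.lid ℂ Ω (((Oq.ev D).flip Y).rTensor Ω
      (X.forms.d.lTensor (Oq D) t)) =
      X.forms.d (TensorProduct.lid ℂ Ω (((Oq.ev D).flip Y).rTensor Ω t)) := by
    intro t
    induction t with
    | zero => simp
    | add x y hx hy => simp only [map_add, hx, hy]
    | tmul f g => simp
  change TensorProduct.lid ℂ Ω (((Oq.ev D).flip Y).rTensor Ω (X.coact (X.forms.d x))) = _
  rw [X.covariant.d_comm, key]
  rfl

/-- On `B ⊆ Ω` the translation of forms is left translation in `O_q(G)`. -/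
lemma formLeft_incl (Y : Uq D) (b : coinvariants X.proj) : ∃ b' : coinvariants X.proj,
    (b' : Oq D) = Oq.left Y b ∧ X.formLeft Y (X.forms.incl b) = X.forms.incl b' := by
  obtain ⟨t, ht, ht'⟩ := X.covariant.extends_comul b
  refine ⟨TensorProduct.lid ℂ _ (((Oq.ev D).flip Y).rTensor _ t), ?_, ?_⟩
  · rw [Oq.left_apply, ← ht]
    clear ht ht'
    induction t with
    | zero => simp
    | add x y hx hy => simp only [map_add, ← hx, ← hy]; rfl
    | tmul f g => simp
  · change TensorProduct.lid ℂ Ω (((Oq.ev D).flip Y).rTensor Ω (X.coact (X.forms.incl b))) = _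
    rw [← ht']
    clear ht ht'
    induction t with
    | zero => simp
    | add x y hx hy => simp only [map_add, hx, hy]
    | tmul f g => simp

/-- The elements of `B` killed by `∂`. -/
def kerDel : Submodule ℂ (Oq D) :=
  (LinearMap.ker (X.del ∘ₗ X.forms.incl.toLinearMap)).map (coinvariants X.proj).val.toLinearMap

/-- The elements of `B` killed by `∂̄`. -/
def kerDelbar : Submodule ℂ (Oq D) :=
  (LinearMap.ker (X.delbar ∘ₗ X.forms.incl.toLinearMap)).map (coinvariants X.proj).val.toLinearMap

lemma mem_kerDel {b : coinvariants X.proj} : (b : Oq D) ∈ X.kerDel ↔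
    X.del (X.forms.incl b) = 0 := by
  constructor
  · rintro ⟨c, hc, h⟩
    rw [← Subtype.ext (a1 := c) (a2 := b) h]
    exact hc
  · exact fun h => ⟨b, h, rfl⟩

lemma mem_kerDelbar {b : coinvariants X.proj} : (b : Oq D) ∈ X.kerDelbar ↔
    X.delbar (X.forms.incl b) = 0 := by
  constructor
  · rintro ⟨c, hc, h⟩
    rw [← Subtype.ext (a1 := c) (a2 := b) h]
    exact hc
  · exact fun h => ⟨b, h, rfl⟩

lemma left_mem_kerDel (Y : Uq D) {a : Oq D} (ha : a ∈ X.kerDel) : Oq.left Y a ∈ X.kerDel := by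
  obtain ⟨b, hb, rfl⟩ := ha
  obtain ⟨b', hb', h⟩ := X.formLeft_incl Y b
  change Oq.left Y (b : Oq D) ∈ _
  rw [← hb', mem_kerDel, ← h, X.del_of_mem (X.formLeft_mem Y (X.incl_mem b)), ← formLeft_d,
    ← formLeft_component, ← X.del_of_mem (X.incl_mem b)]
  change X.del (X.forms.incl b) = 0 at hb
  rw [hb, map_zero]

/-- On a self-conjugate space, `∂b = 0` implies `∂̄b = 0` for `b ∈ B`: every irreducible subcomodule
of `ker ∂` equals its conjugate, which lies in `ker ∂̄`, and every finite-dimensional subcomodule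
is a sum of irreducible ones. -/
lemma kerDel_le_kerDelbar {h : Oq D →ₗ[ℂ] ℂ} (hh : Oq.IsPosHaar h)
    (hself : IsSelfConjugate (coinvariants X.proj)) : X.kerDel ≤ X.kerDelbar := by
  have key : ∀ (n : ℕ) (C : Submodule ℂ (Oq D)), FiniteDimensional ℂ C → Module.finrank ℂ C = n →
      C ≤ X.kerDel → (∀ Y, ∀ w ∈ C, Oq.left Y w ∈ C) → C ≤ X.kerDelbar := by
    intro n
    induction n using Nat.strong_induction_on with
    | _ n ih =>
    intro C hfin hn hC hCl
    by_cases hirr : IsIrreducibleSubcomodule (Coalgebra.comul (R := ℂ) (A := Oq D)) C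
    · have hle : X.kerDel ≤ Subalgebra.toSubmodule (coinvariants X.proj) := by
        rintro _ ⟨b, -, rfl⟩
        exact b.2
      have hstar := hself C (hC.trans hle) hirr
      intro c hc
      have hc' : c ∈ star '' (C : Set (Oq D)) := by rw [← hstar]; exact hc
      obtain ⟨a, ha, rfl⟩ := hc'
      exact (X.mem_kerDelbar (b := ⟨star a, hle (hC hc)⟩)).2 (X.delbar_incl_star
        (b := ⟨a, hle (hC ha)⟩) rfl ((X.mem_kerDel (b := ⟨a, hle (hC ha)⟩)).1 (hC ha)))
    · by_cases hbot : C = ⊥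
      · rw [hbot]; exact bot_le
      obtain ⟨W, hWC, hWs, hW0, hW1⟩ : ∃ W ≤ C,
          IsSubcomodule (Coalgebra.comul (R := ℂ) (A := Oq D)) W ∧ W ≠ ⊥ ∧ W ≠ C := by
        by_contra hcon
        push Not at hcon
        exact hirr ⟨Oq.isSubcomodule_of_left_mem hCl, hbot, fun W hW hWs => by
          by_cases h0 : W = ⊥
          · exact .inl h0
          · exact .inr (hcon W hW hWs h0)⟩
      have hWl : ∀ Y, ∀ w ∈ W, Oq.left Y w ∈ W := fun Y w hw =>
        Oq.left_mem_of_isSubcomodule hWs Y hw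
      have hWf : FiniteDimensional ℂ W := Submodule.finiteDimensional_of_le hWC
      obtain ⟨W', hW'C, hW'l, hsup, hinf⟩ := hh.exists_complement hWC hWl hCl
      have hW'f : FiniteDimensional ℂ W' := Submodule.finiteDimensional_of_le hW'C
      have hlt : W < C := lt_of_le_of_ne hWC hW1
      have hlt' : W' < C := by
        refine lt_of_le_of_ne hW'C fun he => hW0 ?_
        rw [he, inf_eq_left.2 hWC] at hinf
        exact hinf
      rw [← hsup]
      exact sup_le
        (ih _ (hn ▸ Submodule.finrank_lt_finrank_of_lt hlt) W hWf rfl (hWC.trans hC) hWl)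
        (ih _ (hn ▸ Submodule.finrank_lt_finrank_of_lt hlt') W' hW'f rfl (hW'C.trans hC) hW'l)
  intro a ha
  refine key _ (LinearMap.range (Oq.orbit a)) (Oq.finiteDimensional_orbit a) rfl ?_ ?_ ?_
  · rintro _ ⟨Y, rfl⟩
    exact X.left_mem_kerDel Y ha
  · rintro Y _ ⟨Z, rfl⟩
    refine ⟨Z * Y, ?_⟩
    change Oq.left (Z * Y) a = _
    rw [Oq.left_mul]
    rfl
  · exact ⟨1, by change Oq.left 1 a = a; rw [Oq.left_one]; rfl⟩

end CQHComplexSpace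

section

variable {M N : Type*} {κ : Type*} [Fintype κ] [AddCommGroup M] [Module ℂ M] [AddCommGroup N]
  [Module ℂ N] {P : RootPairing κ ℂ M N} [P.IsCrystallographic] [P.IsRootSystem] (b : P.Base)
  [P.IsReduced] [P.IsIrreducible]

/-- There is an integral coweight that is positive on all simple roots, as the Cartan matrix is
invertible over the rational numbers. -/
lemma exists_pos_coweight (q : ℝ) (h0 : q ≠ 0) (h1 : q ≠ 1) (h2 : q ≠ -1) :
    ∃ c : b.support → ℤ, ∀ j, 0 < ∑ᶠ i, c i * (quantumDatum b q h0 h1 h2).a i j := by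
  classical
  have hdet : b.cartanMatrix.det ≠ 0 :=
    Matrix.nondegenerate_iff_det_ne_zero.1 b.cartanMatrix_nondegenerate
  -- By Cramer's rule this coweight has the pairing `det ^ 2` with every simple root.
  refine ⟨b.cartanMatrix.det • b.cartanMatrix.adjugate.mulVec 1, fun j => ?_⟩
  rw [finsum_eq_sum_of_fintype]
  have e : ∑ i, (b.cartanMatrix.det • b.cartanMatrix.adjugate.mulVec 1) i *
      (quantumDatum b q h0 h1 h2).a i j = b.cartanMatrix.det ^ 2 := by
    have h3 : b.cartanMatrix.mulVec (b.cartanMatrix.det • b.cartanMatrix.adjugate.mulVec 1) j =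
        b.cartanMatrix.det ^ 2 := by
      rw [Matrix.mulVec_smul, Matrix.mulVec_mulVec, Matrix.mul_adjugate, Matrix.smul_mulVec,
        Matrix.one_mulVec]
      simp [sq]
    rw [← h3]
    exact Finset.sum_congr rfl fun i _ => mul_comm _ _
  rw [e]
  positivity

end

/-- On a self-conjugate space over `O_q(G)`, real Leibniz constants of elements of `B` that are not
harmonic are positive. -/
theorem CQHHermitianSpace.leibniz_constant_pos {ι : Type*} [Finite ι] {D : QuantumDatum ι}
    {H Ω : Type*} [Ring H] [HopfAlgebra ℂ H] [StarRing H] [StarModule ℂ H] [Ring Ω] [Algebra ℂ Ω]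
    (X : CQHHermitianSpace (Oq D) H Ω) (hself : IsSelfConjugate X.space) (c : ι → ℤ)
    (hc : ∀ j, 0 < ∑ᶠ i, c i * D.a i j) {z : X.space} (hz : (z : Oq D) ≠ 0)
    (hharm : X.laplacian (X.forms.incl z) ≠ 0) {l : ℝ}
    (hl : X.del (X.forms.incl z) * X.forms.incl z =
      (l : ℂ) • (X.forms.incl z * X.del (X.forms.incl z))) : 0 < l := by
  obtain ⟨h, hH, hpos⟩ := X.homogeneous.left.haar
  have hh : Oq.IsPosHaar h := ⟨hH, hpos⟩
  have hdel : X.del (X.forms.incl z) ≠ 0 := fun h0 => hharm <| X.laplacian_incl_eq_zero <|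
    X.mem_kerDelbar.1 (X.kerDel_le_kerDelbar hh hself (X.mem_kerDel.2 h0))
  obtain ⟨ν, hν⟩ := X.exists_fibreMap_ne_zero (X.del_incl_mem z) hdel
  have hcomm := congrArg (X.fibreMap ν) hl
  rw [map_smul, X.fibreMap_mul_incl, X.fibreMap_incl_mul] at hcomm
  exact Oq.pos_of_mul_eq hh c hc hν hz hcomm

end QG

end

theorem mainTheorem9 {𝔤 : Type*} [LieRing 𝔤] [LieAlgebra ℂ 𝔤] [FiniteDimensional ℂ 𝔤]
    [LieAlgebra.IsSimple ℂ 𝔤] (𝔥 : LieSubalgebra ℂ 𝔤) [𝔥.IsCartanSubalgebra]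
    (b : (LieAlgebra.IsKilling.rootSystem 𝔥).Base)
    (q : ℝ) (hq₀ : q ≠ 0) (hq₁ : q ≠ 1) (hq₂ : q ≠ -1)
    {H : Type*} [Ring H] [HopfAlgebra ℂ H] [StarRing H] [StarModule ℂ H]
    {Ω : Type*} [Ring Ω] [Algebra ℂ Ω]
    (X : QG.CQHHermitianSpace (QG.Oq (QG.quantumDatum b q hq₀ hq₁ hq₂)) H Ω)
    (hconn : X.forms.IsConnected) (hself : QG.IsSelfConjugate X.space)
    (hgelf : X.IsGelfandType) (z : X.space)
    (hz : QG.Oq.IsHighestWeight (QG.quantumDatum b q hq₀ hq₁ hq₂) z)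
    (hharm : X.laplacian (X.forms.incl z) ≠ 0)
    (lam : ℝ) (hlam : X.del (X.forms.incl z) * X.forms.incl z =
      (lam : ℂ) • (X.forms.incl z * X.del (X.forms.incl z))) :
    lam ∉ Set.Ico (-1 : ℝ) 0 ∧
      ∀ c : ℂ, X.del (X.forms.incl z) * X.hodgeStar (X.delbar (X.forms.incl z)) =
          c • (X.forms.incl z * X.del (X.hodgeStar (X.delbar (X.forms.incl z)))) →
        c ≠ 0 → 0 < lam := by
  obtain ⟨c, hc⟩ := QG.exists_pos_coweight b q hq₀ hq₁ hq₂
  have hpos : 0 < lam := X.leibniz_constant_pos hself c hc hz.ne_zero hharm hlam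
  exact ⟨fun hm => absurd hm.2 (not_lt.2 hpos.le), fun _ _ _ => hpos⟩
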